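/- **Setting.** $\lambda^L$ has values $v ::= c \mid \lambda x.e$; expressions $e ::= v \mid x \mid e\,e \mid \mathsf{if}\ e\ \mathsf{then}\ e\ \mathsf{else}\ e \mid \mathsf{get}\ e \mid \mathsf{bind}\ e\ e \mid \lfloor e\rfloor$ (safe downgrading); programs $s ::= \mathsf{let}\ x=e\ \mathsf{in}\ s \mid \mathsf{set}\ e\ e \mid \mathsf{print}\ e\ e$; base types $B ::= \mathsf{Bool}\mid\mathsf{Str}\mid\mathsf{User}\mid\langle T\rangle^{\pi}\mid \mathsf{Ref}\ T$; and types $T ::= \{B\mid r\}\mid x{:}T\to T$. A policy is a predicate $\pi=\lambda(s,u).r$ on stores and users. Refinements $r$ are terms over program variables, constants, the value variable $\nu$ and the current store, built with $\neg,\wedge,\vee,\Rightarrow,=$, array read and write, and application. They are interpreted semantically: $\Gamma\models r\Rightarrow r'$ means validity under all well-sorted valuations satisfying the refinements and path conditions in $\Gamma$. The constants are Booleans, strings, users, a fixed set of locations, and total built-in functions on primitive values with primitive or location results, typed by their exact result. Each location $l$ has a closed, function-free content type $\mathrm{ty}(l)$ (which does not mention the current store). A store $\sigma$ maps locations to values of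 their content types and users $u$ to output channels $\sigma[u]$ (lists of values). Write $\pi[(\sigma,o)]$ for the instance of $\pi$ at store $\sigma$ and user $o$. Evaluation is call-by-value small-step, also reducing under $\lambda$ and in the branches of a conditional whose guard is a value: $\mathsf{get}\ l\to\sigma[l]$, $\lfloor e\rfloor\to e$, $\mathsf{bind}\ v\ f$ applies $f$ to $v$, $\mathsf{set}\ l\ v$ updates $\sigma[l]$, and $\mathsf{print}\ u\ v$ appends $v$ to $\sigma[u]$. Typing is the refinement type system with $T<:\langle T\rangle^{\lambda.\top}$; $\Gamma\vdash\langle T\rangle^{\lambda.r}<:\langle T'\rangle^{\lambda.r'}$ if $\Gamma\vdash T<:T'$ and $\Gamma\models r'\Rightarrow r$; the usual subtyping of refined base types and functions; the usual rules for constants, variables, $\lambda$, application, subsumption, $\mathsf{let}$ and path-sensitive conditionals; and - $\mathsf{get}\,x::\{B\mid r\wedge\nu=\sigma[x]\}$ if $x::\mathsf{Ref}\,\{B\mid r\}$, and $\mathsf{get}\,x::\langle\{B\mid r\wedge\nu=\sigma[x]\}\rangle^{\pi}$ if $x::\mathsf{Ref}\,\langle\{B\mid r\}\rangle^{\pi}$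 (here $x$ is a variable, a constant, or a built-in function applied to such terms); - $\mathsf{bind}\,e_1\,e_2::\langle T_2\rangle^{\pi}$ if $e_1::\langle T_1\rangle^{\pi}$ and $e_2::T_1\to\langle T_2\rangle^{\pi}$; - $\lfloor e\rfloor::\langle\{\mathsf{Bool}\mid\nu\Rightarrow r\}\rangle^{\pi}$ if $e::\langle\{\mathsf{Bool}\mid\nu\Rightarrow r\}\rangle^{\pi\wedge r}$; - $\mathsf{print}\,e_1\,e_2$ is typed if $e_1::\langle\{\mathsf{User}\mid\pi[(\sigma,\nu)]\}\rangle^{\pi}$ and $e_2::\langle\mathsf{Str}\rangle^{\pi}$ for some $\pi$; $\mathsf{set}\,e_1\,e_2$ is typed if $e_1::\mathsf{Ref}\,T$ and $e_2::T$. **Noninterference.** Let $\mathrm{pol}(T)=\pi$ if $T$ is $\langle T'\rangle^{\pi}$ (possibly refined), and $\lambda.\top$ otherwise. Location $l$ is in $\mathrm{obs}_o(\sigma_1,\sigma_2)$ if $\mathrm{pol}(\mathrm{ty}(l))$ holds at $(\sigma_1,o)$ or at $(\sigma_2,o)$. Let $\sigma_1\sim_o\sigma_2$ if $\sigma_1[o]=\sigma_2[o]$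 and $\sigma_1[l]=\sigma_2[l]$ for all $l\in\mathrm{obs}_o(\sigma_1,\sigma_2)$. Call a type flat if it is a (refined) primitive or reference type with at most one tag. A program $s$ satisfies *contextual noninterference* if, for every user $o$ and all well-typed stores $\sigma_1\sim_o\sigma_2$ from which executions of $s$ end in $\sigma_1'$ and $\sigma_2'$ respectively: - if $s$ is $\mathsf{let}\,x_1=e_1\,\mathsf{in}\dots\mathsf{print}\,e\,e'$, then $\sigma_1'\sim_o\sigma_2'$; - if $s$ is $\mathsf{let}\,x_1=e_1\,\mathsf{in}\dots\mathsf{set}\,e\,e'$, then $\sigma'_1[o]=\sigma'_2[o]$, and $\sigma_1'[l]=\sigma_2'[l]$ for all $l\in\mathrm{obs}_o(\sigma_1,\sigma_2)$ with $\mathrm{ty}(l)$ flat. A closed expression $e$ satisfies contextual noninterference at a flat type $T$ if, for all well-typed $\sigma_1\sim_o\sigma_2$ such that $\mathrm{pol}(T)[(\sigma_j,o)]$ and $\sigma_j,e\to^* v_j$ (with $v_j$ a value) for $j=1,2$, one has $v_1=v_2$. **Enforcement.** Extend values by casts $\langle T'\Rightarrow T\rangle$ of type $T'\to T$, with no reduction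 rule. A sound localization of a closed expression $e$ at $T$ (of a closed program $s$) is a term $\hat e$ obtained by replacing some subterms $d$ by $\langle T_a\Rightarrow T_e\rangle d$ such that $\vdash\hat e::T$ (such that $\vdash\hat s$). $\mathsf{Enforce}$ takes a sound localization and replaces each cast $\langle T_a\Rightarrow T_e\rangle d$, with local typing environment $\Gamma$, by $p[x_0\mapsto d']$, where $d'$ is the result of replacing the casts in $d$, and $p$ is produced by $\mathsf{Generate}$. The latter requires $T_e=\langle T\rangle^{\pi}$ and works as follows, for a given set $\mathcal R$ of redaction constants. 1. $\mathsf{SynthesizeAll}$ returns a list of branches $b$ of type $\langle T\rangle^{\lambda.\bot}$ built from $x_0:T_a$ and $\mathcal R$. 2. $\mathsf{Abduce}$ returns, for each branch $b$, a condition $c_b$ over $\Gamma$. 3. The branches are sorted from the weakest to the strongest condition. The first condition must be valid in $\Gamma$, and the first branch is the initial patch. 4. For each remaining pair $(c,b)$ in order, $\mathsf{Synthesize}$ returns a term $g$ for the type $\langle\{\mathsf{Bool}\mid\nu\Leftrightarrow c\}\rangle^{\pi}$ in $\Gamma$, and the patch is replaced by $\mathsf{bind}\ g\ (\lambda y.\,\mathsf{if}\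 y\ \mathsf{then}\ b\ \mathsf{else}\ \mathit{patch})$. $\mathsf{Enforce}$ fails if any of these calls or checks fails. **Theorem (soundness of type-targeted synthesis).** Assume that $\mathsf{SynthesizeAll}$ and $\mathsf{Synthesize}$ are correct (they return only cast-free terms that have the requested type in the given environment) and that $\mathsf{Abduce}$ is correct (a returned $c$ mentions only the variables of $\Gamma$ and the current store, not $\nu$, $s$ or $u$, and $\Gamma,x_0{:}T_a,c\vdash b::\langle T\rangle^{\pi}$). If $\mathsf{Enforce}$ succeeds on a closed program $s$ with result $s'$, then $s'$ satisfies contextual noninterference. Likewise, if $\mathsf{Enforce}$ succeeds on a closed expression $e$ with type annotation $T$ and returns $e'$, then $e'$ satisfies contextual noninterference at $T$ whenever $T$ is flat. -/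

import Mathlib

namespace Lifty

/-! ### Constants and refinement terms -/

/-- Primitive base types. -/
inductive Prim : Type
  | bool
  | str
  | user

/-- Data constants: Booleans, strings, users and store locations. -/
inductive Datum (User Loc : Type) : Type
  | bool (b : Bool)
  | str (w : String)
  | user (u : User)
  | loc (l : Loc)

/-- The sort of a primitive datum. -/
def Datum.HasPrim {User Loc : Type} : Datum User Loc → Prim → Prop
  | .bool _, .bool => True
  | .str _, .str => True
  | .user _, .user => True
  | _, _ => False

/-- Constants: data, and built-in functions (this includes fields, which return locations)
together with the arguments they have already received. The function constant itself
is `op f []`. -/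
inductive Const (User Loc Op : Type) : Type
  | datum (d : Datum User Loc)
  | op (f : Op) (args : List (Datum User Loc))

/-- Refinement terms. Program variables are de Bruijn indices. `nu` is the value variable,
`cur` the current store of the typing judgment, and `pstore`, `puser` are the two variables
`s`, `u` bound by a policy predicate `λ(s,u). r`. -/
inductive RTerm (User Loc Op : Type) : Type
  | const (c : Const User Loc Op)
  | var (n : ℕ)
  | nu
  | cur
  | pstore
  | puser
  | neg (r : RTerm User Loc Op)
  | eq (r r' : RTerm User Loc Op)
  | and (r r' : RTerm User Loc Op)
  | or (r r' : RTerm User Loc Op)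
  | imp (r r' : RTerm User Loc Op)
  | sel (r r' : RTerm User Loc Op)
  | upd (r r' r'' : RTerm User Loc Op)
  | app (r r' : RTerm User Loc Op)

namespace RTerm

variable {User Loc Op : Type}

def top : RTerm User Loc Op := .const (.datum (.bool true))

def bot : RTerm User Loc Op := .const (.datum (.bool false))

/-- Simultaneous replacement of all variables. -/
def map (r : RTerm User Loc Op) (fv : ℕ → RTerm User Loc Op) (fnu fps fpu : RTerm User Loc Op) :
    RTerm User Loc Op :=
  match r with
  | .const c => .const c
  | .var n => fv n
  | .nu => fnu
  | .cur => .cur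
  | .pstore => fps
  | .puser => fpu
  | .neg r => .neg (r.map fv fnu fps fpu)
  | .eq r r' => .eq (r.map fv fnu fps fpu) (r'.map fv fnu fps fpu)
  | .and r r' => .and (r.map fv fnu fps fpu) (r'.map fv fnu fps fpu)
  | .or r r' => .or (r.map fv fnu fps fpu) (r'.map fv fnu fps fpu)
  | .imp r r' => .imp (r.map fv fnu fps fpu) (r'.map fv fnu fps fpu)
  | .sel r r' => .sel (r.map fv fnu fps fpu) (r'.map fv fnu fps fpu)
  | .upd r r' r'' =>
      .upd (r.map fv fnu fps fpu) (r'.map fv fnu fps fpu) (r''.map fv fnu fps fpu)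
  | .app r r' => .app (r.map fv fnu fps fpu) (r'.map fv fnu fps fpu)

/-- Make room for a new program variable with index `k`. -/
def shift (r : RTerm User Loc Op) (k : ℕ) : RTerm User Loc Op :=
  r.map (fun n => if n < k then .var n else .var (n + 1)) .nu .pstore .puser

/-- `[x_k ↦ t] r`, removing the variable with index `k`. -/
def subst (r : RTerm User Loc Op) (k : ℕ) (t : RTerm User Loc Op) : RTerm User Loc Op :=
  r.map (fun n => if n < k then .var n else if n = k then t else .var (n - 1))
    .nu .pstore .puser

/-- `[ν ↦ t] r`. -/
def substNu (r t : RTerm User Loc Op) : RTerm User Loc Op :=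
  r.map .var t .pstore .puser

/-- Application of a policy predicate: `(λ(s,u). r)[(t, w)]`. -/
def applyPolicy (r t w : RTerm User Loc Op) : RTerm User Loc Op :=
  r.map .var .nu t w

/-- `r` has program variables below `n`, and mentions the value variable, the current store,
and the policy variables only if the corresponding flag is set. -/
def Scoped (n : ℕ) (hnu hcur hpol : Bool) : RTerm User Loc Op → Prop
  | .const _ => True
  | .var k => k < n
  | .nu => hnu = true
  | .cur => hcur = true
  | .pstore => hpol = true
  | .puser => hpol = true
  | .neg r => r.Scoped n hnu hcur hpol
  | .eq r r' => r.Scoped n hnu hcur hpol ∧ r'.Scoped n hnu hcur hpol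
  | .and r r' => r.Scoped n hnu hcur hpol ∧ r'.Scoped n hnu hcur hpol
  | .or r r' => r.Scoped n hnu hcur hpol ∧ r'.Scoped n hnu hcur hpol
  | .imp r r' => r.Scoped n hnu hcur hpol ∧ r'.Scoped n hnu hcur hpol
  | .sel r r' => r.Scoped n hnu hcur hpol ∧ r'.Scoped n hnu hcur hpol
  | .upd r r' r'' => r.Scoped n hnu hcur hpol ∧ r'.Scoped n hnu hcur hpol ∧
      r''.Scoped n hnu hcur hpol
  | .app r r' => r.Scoped n hnu hcur hpol ∧ r'.Scoped n hnu hcur hpol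

end RTerm

/-! ### Types -/

mutual

/-- Base types `B`: primitive types, tagged types `⟨T⟩^π`, references. A policy predicate is
given by its body, a refinement term in `pstore` and `puser`. -/
inductive BTy (User Loc Op : Type) : Type
  | prim (p : Prim)
  | tag (T : Ty User Loc Op) (pol : RTerm User Loc Op)
  | ref (T : Ty User Loc Op)

/-- Types `T`: refined base types `{B | r}` and dependent functions `x:T → T'`
(`x` has index `0` in `T'`). -/
inductive Ty (User Loc Op : Type) : Type
  | base (B : BTy User Loc Op) (r : RTerm User Loc Op)
  | fn (T T' : Ty User Loc Op)

end

section types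

variable {User Loc Op : Type}

mutual

/-- Well-scopedness below `n` program variables; `hcur` says whether the current store may be
mentioned. The content type of a reference type is closed, as the types of locations are. -/
def BTy.WF (n : ℕ) (hcur : Bool) : BTy User Loc Op → Prop
  | .prim _ => True
  | .tag T pol => Ty.WF n hcur T ∧ pol.Scoped n false hcur true
  | .ref T => Ty.WF 0 false T

def Ty.WF (n : ℕ) (hcur : Bool) : Ty User Loc Op → Prop
  | .base B r => BTy.WF n hcur B ∧ r.Scoped n true hcur false
  | .fn T T' => Ty.WF n hcur T ∧ Ty.WF (n + 1) hcur T'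

end

mutual

/-- Content types of reference types are closed, hence not affected by shifting. -/
def BTy.shift (k : ℕ) : BTy User Loc Op → BTy User Loc Op
  | .prim p => .prim p
  | .tag T pol => .tag (Ty.shift k T) (pol.shift k)
  | .ref T => .ref T

def Ty.shift (k : ℕ) : Ty User Loc Op → Ty User Loc Op
  | .base B r => .base (BTy.shift k B) (r.shift k)
  | .fn T T' => .fn (Ty.shift k T) (Ty.shift (k + 1) T')

end

mutual

def BTy.subst (k : ℕ) (t : RTerm User Loc Op) : BTy User Loc Op → BTy User Loc Op
  | .prim p => .prim p
  | .tag T pol => .tag (Ty.subst k t T) (pol.subst k t)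
  | .ref T => .ref T

/-- `T[x_k ↦ t]`. -/
def Ty.subst (k : ℕ) (t : RTerm User Loc Op) : Ty User Loc Op → Ty User Loc Op
  | .base B r => .base (BTy.subst k t B) (r.subst k t)
  | .fn T T' => .fn (Ty.subst k t T) (Ty.subst (k + 1) (t.shift 0) T')

end

mutual

/-- Types of storable data: no function type occurs (under tags). -/
def BTy.Ground : BTy User Loc Op → Prop
  | .prim _ => True
  | .tag T _ => Ty.Ground T
  | .ref _ => True

def Ty.Ground : Ty User Loc Op → Prop
  | .base B _ => BTy.Ground B
  | .fn _ _ => False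

end

/-- A refined primitive or reference type. -/
def Ty.Plain : Ty User Loc Op → Prop
  | .base (.prim _) _ => True
  | .base (.ref _) _ => True
  | _ => False

/-- A refined primitive or reference type with at most one tag. -/
def Ty.Flat : Ty User Loc Op → Prop
  | .base (.prim _) _ => True
  | .base (.ref _) _ => True
  | .base (.tag T _) _ => T.Plain
  | .fn _ _ => False

/-- The policy of a type. -/
def Ty.pol : Ty User Loc Op → RTerm User Loc Op
  | .base (.tag _ pol) _ => pol
  | _ => RTerm.top

/-- `⟨T⟩^π`, without an outer refinement. -/
def Ty.tagged (T : Ty User Loc Op) (pol : RTerm User Loc Op) : Ty User Loc Op :=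
  .base (.tag T pol) RTerm.top

/-- The unrefined reference type `Ref T`. -/
def Ty.refTo (T : Ty User Loc Op) : Ty User Loc Op := .base (.ref T) RTerm.top

end types

/-! ### Policy modules -/

/-- Result of a built-in function: a primitive value, or (for a field) a location with the given
content type. -/
inductive Cod (User Loc Op : Type) : Type
  | prim (p : Prim)
  | field (T : Ty User Loc Op)

/-- The predefined constants: the content type `locTy l` of each location `l` (so `l` has type
`Ref (locTy l)`), and the built-in functions on primitive values with their meaning. -/
structure Sig (User Loc Op : Type) where
  locTy : Loc → Ty User Loc Op
  locTy_wf : ∀ l, (locTy l).WF 0 false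
  locTy_ground : ∀ l, (locTy l).Ground
  dom : Op → List Prim
  dom_ne_nil : ∀ f, dom f ≠ []
  cod : Op → Cod User Loc Op
  cod_wf : ∀ f T, cod f = .field T → T.WF 0 false
  sem : Op → List (Datum User Loc) → Datum User Loc
  sem_prim : ∀ f p args, cod f = .prim p → List.Forall₂ Datum.HasPrim args (dom f) →
    (sem f args).HasPrim p
  sem_field : ∀ f T args, cod f = .field T → List.Forall₂ Datum.HasPrim args (dom f) →
    ∃ l, sem f args = .loc l ∧ locTy l = T

section signature

variable {User Loc Op : Type}

/-- Application of a (partially applied) built-in function to one more argument. -/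
def Sig.delta (S : Sig User Loc Op) (f : Op) (args : List (Datum User Loc))
    (d : Datum User Loc) : Const User Loc Op :=
  if args.length + 1 < (S.dom f).length then .op f (args ++ [d])
  else .datum (S.sem f (args ++ [d]))

def Cod.toBTy : Cod User Loc Op → BTy User Loc Op
  | .prim p => .prim p
  | .field T => .ref T

/-- `x₁:p₁ → … → xₖ:pₖ → {B | ν = t x₁ … xₖ}`. -/
def opTy (B : BTy User Loc Op) : List Prim → RTerm User Loc Op → Ty User Loc Op
  | [], t => .base B (.eq .nu t)
  | p :: ps, t => .fn (.base (.prim p) RTerm.top) (opTy B ps (.app (t.shift 0) (.var 0)))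

def Sig.datumTy (S : Sig User Loc Op) : Datum User Loc → BTy User Loc Op
  | .bool _ => .prim .bool
  | .str _ => .prim .str
  | .user _ => .prim .user
  | .loc l => .ref (S.locTy l)

/-- The type `ty(c)` of a constant. -/
def Sig.ty (S : Sig User Loc Op) : Const User Loc Op → Ty User Loc Op
  | .datum d => .base (S.datumTy d) (.eq .nu (.const (.datum d)))
  | .op f args => opTy (S.cod f).toBTy ((S.dom f).drop args.length) (.const (.op f args))

/-- A function constant has received fewer arguments than it takes, all of the right sort. -/
def Sig.ConstOK (S : Sig User Loc Op) : Const User Loc Op → Prop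
  | .datum _ => True
  | .op f args => args.length < (S.dom f).length ∧
      List.Forall₂ Datum.HasPrim args ((S.dom f).take args.length)

end signature

/-! ### Meaning of refinements -/

/-- Values of the refinement logic: constants, stores, and one element `closure` that stands for
every program function that is not a constant (it is also the value of ill-sorted terms). -/
inductive RVal (User Loc Op : Type) : Type
  | const (c : Const User Loc Op)
  | closure
  | store (m : Loc → RVal User Loc Op)

/-- Valuation of program variables, current store, value variable and policy variables. -/
structure REnv (User Loc Op : Type) where
  var : ℕ → RVal User Loc Op
  cur : Loc → RVal User Loc Op
  nu : RVal User Loc Op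
  pstore : Loc → RVal User Loc Op
  puser : User

noncomputable section meaning

variable {User Loc Op : Type}

open Classical in
/-- The Boolean `P` as a value. -/
def RVal.ofProp (P : Prop) : RVal User Loc Op :=
  if P then .const (.datum (.bool true)) else .const (.datum (.bool false))

def RVal.IsTrue (v : RVal User Loc Op) : Prop := v = .const (.datum (.bool true))

/-- Array read. -/
def RVal.sel : RVal User Loc Op → RVal User Loc Op → RVal User Loc Op
  | .store m, .const (.datum (.loc l)) => m l
  | _, _ => .closure

open Classical in
/-- Array write. -/
def RVal.upd : RVal User Loc Op → RVal User Loc Op → RVal User Loc Op → RVal User Loc Op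
  | .store m, .const (.datum (.loc l)), v => .store (Function.update m l v)
  | _, _, _ => .closure

def RVal.app (S : Sig User Loc Op) : RVal User Loc Op → RVal User Loc Op → RVal User Loc Op
  | .const (.op f args), .const (.datum d) => .const (S.delta f args d)
  | _, _ => .closure

def RTerm.eval (S : Sig User Loc Op) (E : REnv User Loc Op) :
    RTerm User Loc Op → RVal User Loc Op
  | .const c => .const c
  | .var n => E.var n
  | .nu => E.nu
  | .cur => .store E.cur
  | .pstore => .store E.pstore
  | .puser => .const (.datum (.user E.puser))
  | .neg r => .ofProp (¬ (r.eval S E).IsTrue)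
  | .eq r r' => .ofProp (r.eval S E = r'.eval S E)
  | .and r r' => .ofProp ((r.eval S E).IsTrue ∧ (r'.eval S E).IsTrue)
  | .or r r' => .ofProp ((r.eval S E).IsTrue ∨ (r'.eval S E).IsTrue)
  | .imp r r' => .ofProp ((r.eval S E).IsTrue → (r'.eval S E).IsTrue)
  | .sel r r' => (r.eval S E).sel (r'.eval S E)
  | .upd r r' r'' => (r.eval S E).upd (r'.eval S E) (r''.eval S E)
  | .app r r' => RVal.app S (r.eval S E) (r'.eval S E)

/-- The refinement `r` holds under the valuation `E`. -/
def RTerm.Holds (S : Sig User Loc Op) (E : REnv User Loc Op) (r : RTerm User Loc Op) : Prop :=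
  (r.eval S E).IsTrue

mutual

/-- The logical values of the sort of `B` (tags and refinements are irrelevant for sorts). -/
def BTy.Shape (S : Sig User Loc Op) : BTy User Loc Op → RVal User Loc Op → Prop
  | .prim p, v => ∃ d, v = .const (.datum d) ∧ d.HasPrim p
  | .tag T _, v => Ty.Shape S T v
  | .ref T, v => ∃ l, v = .const (.datum (.loc l)) ∧ S.locTy l = T

def Ty.Shape (S : Sig User Loc Op) : Ty User Loc Op → RVal User Loc Op → Prop
  | .base B _, v => BTy.Shape S B v
  | .fn _ _, v => v = .closure ∨ ∃ f args, v = .const (.op f args)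

end

/-- A well-sorted store. -/
def Sig.StoreShape (S : Sig User Loc Op) (m : Loc → RVal User Loc Op) : Prop :=
  ∀ l, (S.locTy l).Shape S (m l)

/-- Drop the valuation of the innermost program variable. -/
def REnv.tail (E : REnv User Loc Op) : REnv User Loc Op :=
  { E with var := fun n => E.var (n + 1) }

end meaning

/-! ### Typing environments and expressions -/

/-- An entry of a typing environment: a program variable or a path condition. -/
inductive Entry (User Loc Op : Type) : Type
  | var (T : Ty User Loc Op)
  | cond (r : RTerm User Loc Op)

/-- Typing environments, innermost entry first. Only variable entries count for indices. -/
abbrev Ctx (User Loc Op : Type) : Type := List (Entry User Loc Op)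

section contexts

variable {User Loc Op : Type}

/-- Number of program variables. -/
def nvars : Ctx User Loc Op → ℕ
  | [] => 0
  | .var _ :: Γ => nvars Γ + 1
  | .cond _ :: Γ => nvars Γ

/-- The type of a variable, as a type over the whole environment. -/
def lookup : Ctx User Loc Op → ℕ → Option (Ty User Loc Op)
  | [], _ => none
  | .var T :: _, 0 => some (T.shift 0)
  | .var _ :: Γ, n + 1 => (lookup Γ n).map (Ty.shift 0)
  | .cond _ :: Γ, n => lookup Γ n

/-- The refinement that a variable declaration contributes to the assumptions. -/
def Ty.Assumption (S : Sig User Loc Op) (E : REnv User Loc Op) (v : RVal User Loc Op) :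
    Ty User Loc Op → Prop
  | .base _ r => r.Holds S { E with nu := v }
  | .fn _ _ => True

/-- The valuation `E` is well-sorted and satisfies the assumptions stored in `Γ`. -/
def Models (S : Sig User Loc Op) : Ctx User Loc Op → REnv User Loc Op → Prop
  | [], E => S.StoreShape E.cur ∧ S.StoreShape E.pstore
  | .var T :: Γ, E => Models S Γ E.tail ∧ T.Shape S (E.var 0) ∧ T.Assumption S E.tail (E.var 0)
  | .cond r :: Γ, E => Models S Γ E ∧ r.Holds S E

/-- `Γ ⊨ r ⇒ r'`. -/
def Entails (S : Sig User Loc Op) (Γ : Ctx User Loc Op) (r r' : RTerm User Loc Op) : Prop :=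
  ∀ E, Models S Γ E → r.Holds S E → r'.Holds S E

end contexts

/-- Expressions. `down e` is safe downgrading. The value `cast Γ T T'` is the type cast from `T`
to `T'`; it records the typing environment `Γ` of the place where it has been inserted. -/
inductive Expr (User Loc Op : Type) : Type
  | const (c : Const User Loc Op)
  | lam (e : Expr User Loc Op)
  | var (n : ℕ)
  | app (e e' : Expr User Loc Op)
  | ite (e e₁ e₂ : Expr User Loc Op)
  | get (e : Expr User Loc Op)
  | bind (e e' : Expr User Loc Op)
  | down (e : Expr User Loc Op)
  | cast (Γ : Ctx User Loc Op) (T T' : Ty User Loc Op)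

/-- Statements: `let x = e in s`, `set e e'`, `print e e'`. -/
inductive Stmt (User Loc Op : Type) : Type
  | lt (e : Expr User Loc Op) (s : Stmt User Loc Op)
  | set (e e' : Expr User Loc Op)
  | print (e e' : Expr User Loc Op)

section expressions

variable {User Loc Op : Type}

namespace Expr

def IsValue : Expr User Loc Op → Prop
  | .const _ => True
  | .lam _ => True
  | .cast _ _ _ => True
  | _ => False

def CastFree : Expr User Loc Op → Prop
  | .const _ => True
  | .var _ => True
  | .lam e => e.CastFree
  | .app e e' => e.CastFree ∧ e'.CastFree
  | .ite e e₁ e₂ => e.CastFree ∧ e₁.CastFree ∧ e₂.CastFree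
  | .get e => e.CastFree
  | .bind e e' => e.CastFree ∧ e'.CastFree
  | .down e => e.CastFree
  | .cast _ _ _ => False

/-- Make room for a new variable with index `k` (used on cast-free expressions only). -/
def shift (k : ℕ) : Expr User Loc Op → Expr User Loc Op
  | .const c => .const c
  | .var n => if n < k then .var n else .var (n + 1)
  | .lam e => .lam (e.shift (k + 1))
  | .app e e' => .app (e.shift k) (e'.shift k)
  | .ite e e₁ e₂ => .ite (e.shift k) (e₁.shift k) (e₂.shift k)
  | .get e => .get (e.shift k)
  | .bind e e' => .bind (e.shift k) (e'.shift k)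
  | .down e => .down (e.shift k)
  | .cast Γ T T' => .cast Γ T T'

/-- `[x_k ↦ d] e` (used on cast-free expressions only). -/
def subst (e : Expr User Loc Op) (k : ℕ) (d : Expr User Loc Op) : Expr User Loc Op :=
  match e with
  | .const c => .const c
  | .var n => if n < k then .var n else if n = k then d else .var (n - 1)
  | .lam e => .lam (e.subst (k + 1) (d.shift 0))
  | .app e e' => .app (e.subst k d) (e'.subst k d)
  | .ite e e₁ e₂ => .ite (e.subst k d) (e₁.subst k d) (e₂.subst k d)
  | .get e => .get (e.subst k d)
  | .bind e e' => .bind (e.subst k d) (e'.subst k d)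
  | .down e => .down (e.subst k d)
  | .cast Γ T T' => .cast Γ T T'

/-- Function constants applied to arguments. -/
def opSpine : Expr User Loc Op → Bool
  | .const (.op _ _) => true
  | .app e _ => e.opSpine
  | _ => false

/-- The refinement term denoted by an expression, when it has one: variables, constants, and
applications of function constants to such expressions. -/
def toRTerm : Expr User Loc Op → Option (RTerm User Loc Op)
  | .const c => some (.const c)
  | .var n => some (.var n)
  | .app e e' =>
      if e.opSpine then
        match e.toRTerm, e'.toRTerm with
        | some t, some t' => some (.app t t')
        | _, _ => none
      else none
  | _ => none

/-- `e` is built from the variable with index `k`, bound variables and constants in `R` only. -/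
def Over (R : Set (Const User Loc Op)) (k : ℕ) : Expr User Loc Op → Prop
  | .const c => c ∈ R
  | .var n => n ≤ k
  | .lam e => e.Over R (k + 1)
  | .app e e' => e.Over R k ∧ e'.Over R k
  | .ite e e₁ e₂ => e.Over R k ∧ e₁.Over R k ∧ e₂.Over R k
  | .get e => e.Over R k
  | .bind e e' => e.Over R k ∧ e'.Over R k
  | .down e => e.Over R k
  | .cast _ _ _ => False

/-- The logical value of a program value. -/
def abs : Expr User Loc Op → RVal User Loc Op
  | .const c => .const c
  | _ => .closure

end Expr

namespace Stmt

def shift (k : ℕ) : Stmt User Loc Op → Stmt User Loc Op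
  | .lt e s => .lt (e.shift k) (s.shift (k + 1))
  | .set e e' => .set (e.shift k) (e'.shift k)
  | .print e e' => .print (e.shift k) (e'.shift k)

def subst (k : ℕ) (d : Expr User Loc Op) : Stmt User Loc Op → Stmt User Loc Op
  | .lt e s => .lt (e.subst k d) (s.subst (k + 1) (d.shift 0))
  | .set e e' => .set (e.subst k d) (e'.subst k d)
  | .print e e' => .print (e.subst k d) (e'.subst k d)

/-- Programs of the form `let x₁ = e₁ in … print e e'`. -/
def IsPrint : Stmt User Loc Op → Prop
  | .lt _ s => s.IsPrint
  | .set _ _ => False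
  | .print _ _ => True

/-- Programs of the form `let x₁ = e₁ in … set e e'`. -/
def IsSet : Stmt User Loc Op → Prop
  | .lt _ s => s.IsSet
  | .set _ _ => True
  | .print _ _ => False

end Stmt

end expressions

/-! ### Dynamic semantics -/

/-- A store: the content of each location, and the output channel of each user. -/
structure Store (User Loc Op : Type) where
  mem : Loc → Expr User Loc Op
  out : User → List (Expr User Loc Op)

section dynamics

variable {User Loc Op : Type}

/-- Expression evaluation `σ, e ⟶ e'`: the computation rules, then one rule for each form of
evaluation context. There is no rule for casts. -/
inductive Step (S : Sig User Loc Op) (σ : Store User Loc Op) :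
    Expr User Loc Op → Expr User Loc Op → Prop
  | beta (e v) : v.IsValue → Step S σ (.app (.lam e) v) (e.subst 0 v)
  | delta (f args d) : Step S σ (.app (.const (.op f args)) (.const (.datum d)))
      (.const (S.delta f args d))
  | get (l) : Step S σ (.get (.const (.datum (.loc l)))) (σ.mem l)
  | ite_true (e₁ e₂) : Step S σ (.ite (.const (.datum (.bool true))) e₁ e₂) e₁
  | ite_false (e₁ e₂) : Step S σ (.ite (.const (.datum (.bool false))) e₁ e₂) e₂
  | bind (v e) : v.IsValue → Step S σ (.bind v (.lam e)) (e.subst 0 v)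
  | bind_op (v f args) : v.IsValue →
      Step S σ (.bind v (.const (.op f args))) (.app (.const (.op f args)) v)
  | down (e) : Step S σ (.down e) e
  | app_left (e e' d) : Step S σ e e' → Step S σ (.app e d) (.app e' d)
  | app_right (v e e') : v.IsValue → Step S σ e e' → Step S σ (.app v e) (.app v e')
  | under_lam (e e') : Step S σ e e' → Step S σ (.lam e) (.lam e')
  | under_get (e e') : Step S σ e e' → Step S σ (.get e) (.get e')
  | ite_cond (e e' e₁ e₂) : Step S σ e e' → Step S σ (.ite e e₁ e₂) (.ite e' e₁ e₂)
  | ite_then (v e e' e₂) : v.IsValue → Step S σ e e' → Step S σ (.ite v e e₂) (.ite v e' e₂)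
  | ite_else (v v₁ e e') : v.IsValue → v₁.IsValue → Step S σ e e' →
      Step S σ (.ite v v₁ e) (.ite v v₁ e')
  | bind_left (e e' d) : Step S σ e e' → Step S σ (.bind e d) (.bind e' d)
  | bind_right (v e e') : v.IsValue → Step S σ e e' → Step S σ (.bind v e) (.bind v e')

/-- `σ, e ⟶* v` for a value `v`. -/
def EvalsTo (S : Sig User Loc Op) (σ : Store User Loc Op) (e v : Expr User Loc Op) : Prop :=
  Relation.ReflTransGen (Step S σ) e v ∧ v.IsValue

open Classical in
/-- Statement execution `σ, s ⟶* σ'`. -/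
inductive Exec (S : Sig User Loc Op) :
    Store User Loc Op → Stmt User Loc Op → Store User Loc Op → Prop
  | lt (σ σ' e v s) : EvalsTo S σ e v → Exec S σ (s.subst 0 v) σ' → Exec S σ (.lt e s) σ'
  | set (σ l v) : v.IsValue → Exec S σ (.set (.const (.datum (.loc l))) v)
      { σ with mem := Function.update σ.mem l v }
  | print (σ u v) : v.IsValue → Exec S σ (.print (.const (.datum (.user u))) v)
      { σ with out := Function.update σ.out u (σ.out u ++ [v]) }

end dynamics

/-! ### Static semantics -/

section statics

variable {User Loc Op : Type}

mutual

/-- Subtyping of base types. -/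
inductive BSub (S : Sig User Loc Op) :
    Ctx User Loc Op → BTy User Loc Op → BTy User Loc Op → Prop
  | refl (Γ B) : BSub S Γ B B
  | tag (Γ T T' r r') : Sub S Γ T T' → Entails S Γ r' r → BSub S Γ (.tag T r) (.tag T' r')

/-- Subtyping `Γ ⊢ T <: T'`. -/
inductive Sub (S : Sig User Loc Op) :
    Ctx User Loc Op → Ty User Loc Op → Ty User Loc Op → Prop
  | scalar (Γ B B' r r') : BSub S Γ B B' →
      (∀ E, Models S Γ E → B.Shape S E.nu → r.Holds S E → r'.Holds S E) →
      Sub S Γ (.base B r) (.base B' r')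
  | fn (Γ T₁ T₁' T₂ T₂') : Sub S Γ T₁' T₁ → Sub S (.var T₁' :: Γ) T₂ T₂' →
      Sub S Γ (.fn T₁ T₂) (.fn T₁' T₂')
  | tag (Γ T) : Sub S Γ T (T.tagged RTerm.top)

end

/-- Expression typing `Γ; σ ⊢ e :: T`, where the current store `σ` is denoted by the refinement
term `cur`. In the rule for `get`, if the content of the location is tagged, the retrieved value
may also be characterized below the tag. -/
inductive HasType (S : Sig User Loc Op) :
    Ctx User Loc Op → Expr User Loc Op → Ty User Loc Op → Prop
  | const (Γ c) : S.ConstOK c → HasType S Γ (.const c) (S.ty c)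
  | var (Γ n T) : lookup Γ n = some T → HasType S Γ (.var n) T
  | lam (Γ e T T') : T.WF (nvars Γ) true → HasType S (.var T :: Γ) e T' →
      HasType S Γ (.lam e) (.fn T T')
  | app_dep (Γ e e' T T' t) : HasType S Γ e (.fn T T') → HasType S Γ e' T →
      e'.toRTerm = some t → HasType S Γ (.app e e') (T'.subst 0 t)
  | app (Γ e e' T T') : HasType S Γ e (.fn T (T'.shift 0)) → HasType S Γ e' T →
      HasType S Γ (.app e e') T'
  | get (Γ e B r t) : HasType S Γ e (Ty.refTo (.base B r)) → e.toRTerm = some t →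
      HasType S Γ (.get e) (.base B (.and r (.eq .nu (.sel .cur t))))
  | get_tagged (Γ e B r pol t) :
      HasType S Γ e (Ty.refTo (.base (.tag (.base B r) pol) RTerm.top)) → e.toRTerm = some t →
      HasType S Γ (.get e) (Ty.tagged (.base B (.and r (.eq .nu (.sel .cur t)))) pol)
  | ite (Γ e e₁ e₂ r T) : HasType S Γ e (.base (.prim .bool) r) →
      HasType S (.cond (r.substNu RTerm.top) :: Γ) e₁ T →
      HasType S (.cond (r.substNu RTerm.bot) :: Γ) e₂ T →
      HasType S Γ (.ite e e₁ e₂) T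
  | bind (Γ e₁ e₂) (T₁ T₂ : Ty User Loc Op) (pol) : HasType S Γ e₁ (T₁.tagged pol) →
      HasType S Γ e₂ (.fn T₁ ((T₂.tagged pol).shift 0)) →
      HasType S Γ (.bind e₁ e₂) (T₂.tagged pol)
  | down (Γ e r pol) :
      HasType S Γ e (Ty.tagged (.base (.prim .bool) (.imp .nu r)) (.and pol r)) →
      HasType S Γ (.down e) (Ty.tagged (.base (.prim .bool) (.imp .nu r)) pol)
  | sub (Γ e T T') : HasType S Γ e T → Sub S Γ T T' → T'.WF (nvars Γ) true → HasType S Γ e T'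
  | cast (Γ T T') : T.WF (nvars Γ) true → T'.WF (nvars Γ) true →
      HasType S Γ (.cast Γ T T') (.fn T (T'.shift 0))

/-- Statement typing `Γ; σ ⊢ s`. -/
inductive StmtTyped (S : Sig User Loc Op) : Ctx User Loc Op → Stmt User Loc Op → Prop
  | lt (Γ e s T) : HasType S Γ e T → StmtTyped S (.var T :: Γ) s → StmtTyped S Γ (.lt e s)
  | print (Γ e e' pol) :
      HasType S Γ e (Ty.tagged (.base (.prim .user) (pol.applyPolicy .cur .nu)) pol) →
      HasType S Γ e' (Ty.tagged (.base (.prim .str) RTerm.top) pol) →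
      StmtTyped S Γ (.print e e')
  | set (Γ e e' T) : HasType S Γ e (Ty.refTo T) → HasType S Γ e' T → StmtTyped S Γ (.set e e')

end statics

/-! ### Contextual noninterference -/

section noninterference

variable {User Loc Op : Type}

/-- Each location contains a value of its type. -/
def WellTyped (S : Sig User Loc Op) (σ : Store User Loc Op) : Prop :=
  ∀ l, (σ.mem l).IsValue ∧ (σ.mem l).CastFree ∧ HasType S [] (σ.mem l) (S.locTy l)

/-- The contents of the store as an array of the refinement logic. -/
def Store.abs (σ : Store User Loc Op) : Loc → RVal User Loc Op := fun l => (σ.mem l).abs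

/-- `π[(σ, o)]` for a policy without program variables; a current store mentioned in `π`
is `σ` as well. -/
def PolicyHolds (S : Sig User Loc Op) (pol : RTerm User Loc Op) (σ : Store User Loc Op)
    (o : User) : Prop :=
  pol.Holds S { var := fun _ => .closure, cur := σ.abs, nu := .closure,
                pstore := σ.abs, puser := o }

/-- `l ∈ obs_o(σ₁, σ₂)`. -/
def Observable (S : Sig User Loc Op) (o : User) (σ₁ σ₂ : Store User Loc Op) (l : Loc) : Prop :=
  PolicyHolds S (S.locTy l).pol σ₁ o ∨ PolicyHolds S (S.locTy l).pol σ₂ o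

/-- `σ₁ ∼_o σ₂`. -/
def ObsEquiv (S : Sig User Loc Op) (o : User) (σ₁ σ₂ : Store User Loc Op) : Prop :=
  σ₁.out o = σ₂.out o ∧ ∀ l, Observable S o σ₁ σ₂ l → σ₁.mem l = σ₂.mem l

/-- Contextual noninterference of a program. From `o`-equivalent stores, a print-program produces
`o`-equivalent stores, and a set-program produces stores that agree on the output of `o` and on
all locations (with content type of at most one tag) that were `o`-observable before. -/
def ContextualNI (S : Sig User Loc Op) (s : Stmt User Loc Op) : Prop :=
  ∀ (o : User) (σ₁ σ₂ σ₁' σ₂' : Store User Loc Op),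
    WellTyped S σ₁ → WellTyped S σ₂ → ObsEquiv S o σ₁ σ₂ →
    Exec S σ₁ s σ₁' → Exec S σ₂ s σ₂' →
    (s.IsPrint → ObsEquiv S o σ₁' σ₂') ∧
    (s.IsSet → σ₁'.out o = σ₂'.out o ∧
      ∀ l, Observable S o σ₁ σ₂ l → (S.locTy l).Flat → σ₁'.mem l = σ₂'.mem l)

/-- Contextual noninterference of a closed expression of type `T`: in `o`-equivalent stores it
evaluates to the same value whenever `T` is visible to `o` in both (for data with at most one
tag, that is, when nothing is hidden inside the value). -/
def ExprContextualNI (S : Sig User Loc Op) (e : Expr User Loc Op) (T : Ty User Loc Op) : Prop :=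
  T.Flat → ∀ (o : User) (σ₁ σ₂ : Store User Loc Op) (v₁ v₂ : Expr User Loc Op),
    WellTyped S σ₁ → WellTyped S σ₂ → ObsEquiv S o σ₁ σ₂ →
    PolicyHolds S T.pol σ₁ o → PolicyHolds S T.pol σ₂ o →
    EvalsTo S σ₁ e v₁ → EvalsTo S σ₂ e v₂ → v₁ = v₂

end noninterference

/-! ### Policy enforcement -/

section enforcement

variable {User Loc Op : Type}

/-- `ê` is obtained from the cast-free expression `e` by replacing subterms `d` with casts
applied to `d`. -/
inductive InsertCasts : Expr User Loc Op → Expr User Loc Op → Prop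
  | const (c) : InsertCasts (.const c) (.const c)
  | var (n) : InsertCasts (.var n) (.var n)
  | lam (e e') : InsertCasts e e' → InsertCasts (.lam e) (.lam e')
  | app (e e' d d') : InsertCasts e e' → InsertCasts d d' → InsertCasts (.app e d) (.app e' d')
  | ite (e e' e₁ e₁' e₂ e₂') : InsertCasts e e' → InsertCasts e₁ e₁' → InsertCasts e₂ e₂' →
      InsertCasts (.ite e e₁ e₂) (.ite e' e₁' e₂')
  | get (e e') : InsertCasts e e' → InsertCasts (.get e) (.get e')
  | bind (e e' d d') : InsertCasts e e' → InsertCasts d d' →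
      InsertCasts (.bind e d) (.bind e' d')
  | down (e e') : InsertCasts e e' → InsertCasts (.down e) (.down e')
  | cast (e e' Γ T T') : InsertCasts e e' → InsertCasts e (.app (.cast Γ T T') e')

inductive InsertCastsStmt : Stmt User Loc Op → Stmt User Loc Op → Prop
  | lt (e e' s s') : InsertCasts e e' → InsertCastsStmt s s' →
      InsertCastsStmt (.lt e s) (.lt e' s')
  | set (e e' d d') : InsertCasts e e' → InsertCasts d d' →
      InsertCastsStmt (.set e d) (.set e' d')
  | print (e e' d d') : InsertCasts e e' → InsertCasts d d' →
      InsertCastsStmt (.print e d) (.print e' d')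

/-- `ê` is a sound localization of `e` at type `T` in `Γ`. -/
def SoundLocalization (S : Sig User Loc Op) (Γ : Ctx User Loc Op) (e : Expr User Loc Op)
    (T : Ty User Loc Op) (ê : Expr User Loc Op) : Prop :=
  InsertCasts e ê ∧ HasType S Γ ê T

/-- `ŝ` is a sound localization of the statement `s` in `Γ`. -/
def SoundLocalizationStmt (S : Sig User Loc Op) (Γ : Ctx User Loc Op) (s : Stmt User Loc Op)
    (ŝ : Stmt User Loc Op) : Prop :=
  InsertCastsStmt s ŝ ∧ StmtTyped S Γ ŝ

/-- The two subprocedures, as arbitrary procedures.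
* `synthesizeAll R Γ Ta T`: terms of type `T` built from a variable `x₀ : Ta` and from constants
  in `R`, where `Γ` is the environment over which `Ta` and `T` are formed.
* `synthesize Γ T`: a term of type `T` in `Γ`, or failure.
* `abduce Γ Ta b T`: a condition over `Γ` under which `b` has type `T` in `Γ, x₀ : Ta`,
  or failure. -/
structure Procs (User Loc Op : Type) where
  synthesizeAll : Set (Const User Loc Op) → Ctx User Loc Op → Ty User Loc Op → Ty User Loc Op →
    List (Expr User Loc Op)
  synthesize : Ctx User Loc Op → Ty User Loc Op → Option (Expr User Loc Op)
  abduce : Ctx User Loc Op → Ty User Loc Op → Expr User Loc Op → Ty User Loc Op →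
    Option (RTerm User Loc Op)

/-- Whatever the subprocedures return meets their specification. An abduced condition does not
mention the value variable or the policy variables. -/
structure Procs.Correct (S : Sig User Loc Op) (P : Procs User Loc Op) : Prop where
  synthesizeAll : ∀ R Γ Ta T b, b ∈ P.synthesizeAll R Γ Ta T →
    b.CastFree ∧ b.Over R 0 ∧ HasType S (.var Ta :: Γ) b (T.shift 0)
  synthesize : ∀ Γ T e, P.synthesize Γ T = some e → e.CastFree ∧ HasType S Γ e T
  abduce : ∀ Γ Ta b T c, P.abduce Γ Ta b T = some c →
    c.Scoped (nvars Γ) false true false ∧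
    HasType S (.cond (c.shift 0) :: .var Ta :: Γ) b (T.shift 0)

/-- `{ν : Bool | ν ⇔ c}`. -/
def guardTy (c : RTerm User Loc Op) : Ty User Loc Op :=
  .base (.prim .bool) (.and (.imp .nu c) (.imp c .nu))

/-- The loop that puts the guarded branches in front of the current patch. Branches and patches
are expressions over `Γ, x₀`, guards are synthesized in `Γ`. -/
inductive Combine (P : Procs User Loc Op) (Γ : Ctx User Loc Op) (pol : RTerm User Loc Op) :
    List (Expr User Loc Op × RTerm User Loc Op) → Expr User Loc Op → Expr User Loc Op → Prop
  | nil (patch) : Combine P Γ pol [] patch patch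
  | cons (b c rest patch guard result) :
      P.synthesize Γ ((guardTy c).tagged pol) = some guard →
      Combine P Γ pol rest
        (.bind (guard.shift 0) (.lam (.ite (.var 0) (b.shift 0) (patch.shift 0)))) result →
      Combine P Γ pol ((b, c) :: rest) patch result

/-- Procedure `Generate` for the original term `x₀ : Ta` and the expected type `Te` succeeds and
returns the patch `p`, an expression over `Γ, x₀`. -/
def Generate (S : Sig User Loc Op) (P : Procs User Loc Op) (R : Set (Const User Loc Op))
    (Γ : Ctx User Loc Op) (Ta Te : Ty User Loc Op) (p : Expr User Loc Op) : Prop :=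
  ∃ (T : Ty User Loc Op) (pol : RTerm User Loc Op) (conds : List (RTerm User Loc Op))
    (dflt : Expr User Loc Op) (c : RTerm User Loc Op)
    (guarded : List (Expr User Loc Op × RTerm User Loc Op)),
    Te = T.tagged pol ∧
    (P.synthesizeAll R Γ Ta (T.tagged RTerm.bot)).mapM
      (fun b => P.abduce Γ Ta b (T.tagged pol)) = some conds ∧
    ((dflt, c) :: guarded).Perm ((P.synthesizeAll R Γ Ta (T.tagged RTerm.bot)).zip conds) ∧
    -- sorted from weakest to strongest: nothing is followed by something strictly weaker
    ((dflt, c) :: guarded).Pairwise (fun x y => Entails S Γ x.2 y.2 → Entails S Γ y.2 x.2) ∧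
    Entails S Γ RTerm.top c ∧
    Combine P Γ pol guarded dflt p

/-- Replacement of every cast applied to a term by a generated patch for that term. -/
inductive Patch (S : Sig User Loc Op) (P : Procs User Loc Op) (R : Set (Const User Loc Op)) :
    Expr User Loc Op → Expr User Loc Op → Prop
  | const (c) : Patch S P R (.const c) (.const c)
  | var (n) : Patch S P R (.var n) (.var n)
  | lam (e e') : Patch S P R e e' → Patch S P R (.lam e) (.lam e')
  | app (e e' d d') : Patch S P R e e' → Patch S P R d d' → Patch S P R (.app e d) (.app e' d')
  | ite (e e' e₁ e₁' e₂ e₂') : Patch S P R e e' → Patch S P R e₁ e₁' → Patch S P R e₂ e₂' →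
      Patch S P R (.ite e e₁ e₂) (.ite e' e₁' e₂')
  | get (e e') : Patch S P R e e' → Patch S P R (.get e) (.get e')
  | bind (e e' d d') : Patch S P R e e' → Patch S P R d d' →
      Patch S P R (.bind e d) (.bind e' d')
  | down (e e') : Patch S P R e e' → Patch S P R (.down e) (.down e')
  | cast (d d' Γ Ta Te p) : Patch S P R d d' → Generate S P R Γ Ta Te p →
      Patch S P R (.app (.cast Γ Ta Te) d) (p.subst 0 d')

inductive PatchStmt (S : Sig User Loc Op) (P : Procs User Loc Op) (R : Set (Const User Loc Op)) :
    Stmt User Loc Op → Stmt User Loc Op → Prop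
  | lt (e e' s s') : Patch S P R e e' → PatchStmt S P R s s' →
      PatchStmt S P R (.lt e s) (.lt e' s')
  | set (e e' d d') : Patch S P R e e' → Patch S P R d d' →
      PatchStmt S P R (.set e d) (.set e' d')
  | print (e e' d d') : Patch S P R e e' → Patch S P R d d' →
      PatchStmt S P R (.print e d) (.print e' d')

/-- `Enforce(Γ, e, T)` succeeds and returns `e'`. -/
def Enforce (S : Sig User Loc Op) (P : Procs User Loc Op) (R : Set (Const User Loc Op))
    (Γ : Ctx User Loc Op) (e : Expr User Loc Op) (T : Ty User Loc Op)
    (e' : Expr User Loc Op) : Prop :=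
  ∃ ê, SoundLocalization S Γ e T ê ∧ Patch S P R ê e'

/-- `Enforce` on a program: it succeeds on `s` and returns `s'`. -/
def EnforceStmt (S : Sig User Loc Op) (P : Procs User Loc Op) (R : Set (Const User Loc Op))
    (Γ : Ctx User Loc Op) (s s' : Stmt User Loc Op) : Prop :=
  ∃ ŝ, SoundLocalizationStmt S Γ s ŝ ∧ PatchStmt S P R ŝ s'

end enforcement

end Lifty

namespace Lifty

/-! ### Simultaneous substitution -/

section substitution

variable {User Loc Op : Type}

/-- Extend a renaming under a binder. -/
def liftRen (ρ : ℕ → ℕ) : ℕ → ℕ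
  | 0 => 0
  | n + 1 => ρ n + 1

namespace Expr

/-- Simultaneous renaming. -/
def ren (ρ : ℕ → ℕ) : Expr User Loc Op → Expr User Loc Op
  | .const c => .const c
  | .var n => .var (ρ n)
  | .lam e => .lam (e.ren (liftRen ρ))
  | .app e e' => .app (e.ren ρ) (e'.ren ρ)
  | .ite e e₁ e₂ => .ite (e.ren ρ) (e₁.ren ρ) (e₂.ren ρ)
  | .get e => .get (e.ren ρ)
  | .bind e e' => .bind (e.ren ρ) (e'.ren ρ)
  | .down e => .down (e.ren ρ)
  | .cast Γ T T' => .cast Γ T T'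

/-- Add a term for variable `0` to a substitution. -/
def scons (d : Expr User Loc Op) (γ : ℕ → Expr User Loc Op) : ℕ → Expr User Loc Op
  | 0 => d
  | n + 1 => γ n

/-- Extend a substitution under a binder. -/
def up (γ : ℕ → Expr User Loc Op) : ℕ → Expr User Loc Op :=
  scons (.var 0) fun n => (γ n).ren Nat.succ

/-- Simultaneous substitution. -/
def inst (γ : ℕ → Expr User Loc Op) : Expr User Loc Op → Expr User Loc Op
  | .const c => .const c
  | .var n => γ n
  | .lam e => .lam (e.inst (up γ))
  | .app e e' => .app (e.inst γ) (e'.inst γ)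
  | .ite e e₁ e₂ => .ite (e.inst γ) (e₁.inst γ) (e₂.inst γ)
  | .get e => .get (e.inst γ)
  | .bind e e' => .bind (e.inst γ) (e'.inst γ)
  | .down e => .down (e.inst γ)
  | .cast Γ T T' => .cast Γ T T'

theorem inst_ren (e : Expr User Loc Op) (ρ : ℕ → ℕ) (γ : ℕ → Expr User Loc Op) :
    (e.ren ρ).inst γ = e.inst (γ ∘ ρ) := by
  induction e generalizing ρ γ with
  | lam e ih =>
    have : up γ ∘ liftRen ρ = up (γ ∘ ρ) := by funext n; cases n <;> rfl
    simp [ren, inst, ih, this]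
  | _ => simp_all [ren, inst]

theorem ren_ren (e : Expr User Loc Op) (ρ ρ' : ℕ → ℕ) :
    (e.ren ρ).ren ρ' = e.ren (ρ' ∘ ρ) := by
  induction e generalizing ρ ρ' with
  | lam e ih =>
    have : liftRen ρ' ∘ liftRen ρ = liftRen (ρ' ∘ ρ) := by funext n; cases n <;> rfl
    simp [ren, ih, this]
  | _ => simp_all [ren]

theorem ren_inst (e : Expr User Loc Op) (γ : ℕ → Expr User Loc Op) (ρ : ℕ → ℕ) :
    (e.inst γ).ren ρ = e.inst (fun n => (γ n).ren ρ) := by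
  induction e generalizing ρ γ with
  | lam e ih =>
    have : (fun n => (up γ n).ren (liftRen ρ)) = up (fun n => (γ n).ren ρ) := by
      funext n; cases n
      · rfl
      · simp only [up, scons, ren_ren]; rfl
    simp [ren, inst, ih, this]
  | _ => simp_all [ren, inst]

theorem inst_inst (e : Expr User Loc Op) (γ δ : ℕ → Expr User Loc Op) :
    (e.inst γ).inst δ = e.inst (fun n => (γ n).inst δ) := by
  induction e generalizing γ δ with
  | lam e ih =>
    have : (fun n => (up γ n).inst (up δ)) = up (fun n => (γ n).inst δ) := by
      funext n; cases n
      · rfl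
      · simp only [up, scons, inst_ren, ren_inst]; rfl
    simp [inst, ih, this]
  | _ => simp_all [inst]

theorem inst_var (e : Expr User Loc Op) : e.inst .var = e := by
  induction e with
  | lam e ih =>
    have : up (.var : ℕ → Expr User Loc Op) = .var := by funext n; cases n <;> rfl
    simp [inst, this, ih]
  | _ => simp_all [inst]

theorem shift_eq_ren (e : Expr User Loc Op) (k : ℕ) :
    e.shift k = e.ren (fun n => if n < k then n else n + 1) := by
  induction e generalizing k with
  | lam e ih =>
    have : liftRen (fun n => if n < k then n else n + 1) =
        fun n => if n < k + 1 then n else n + 1 := by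
      funext n; cases n
      · simp [liftRen]
      · simp only [liftRen]; split_ifs <;> omega
    simp [shift, ren, ih, this]
  | var n => simp only [shift, ren]; split_ifs <;> rfl
  | _ => simp_all [shift, ren]

theorem shift_zero_eq_ren (e : Expr User Loc Op) : e.shift 0 = e.ren Nat.succ := by
  simp [shift_eq_ren]

theorem subst_eq_inst (e : Expr User Loc Op) (k : ℕ) (d : Expr User Loc Op) :
    e.subst k d = e.inst (fun n => if n < k then .var n else if n = k then d else .var (n - 1)) := by
  induction e generalizing k d with
  | lam e ih =>
    have : up (fun n => if n < k then .var n else if n = k then d else .var (n - 1)) =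
        fun n => if n < k + 1 then .var n else if n = k + 1 then d.shift 0 else .var (n - 1) := by
      funext n; cases n with
      | zero => simp [up, scons]
      | succ n =>
        simp only [up, scons, shift_zero_eq_ren]
        split_ifs <;> first | omega | rfl | (simp only [ren]; congr 1; omega)
    simp [subst, inst, ih, this]
  | _ => simp_all [subst, inst]

theorem subst_zero_eq_inst (e d : Expr User Loc Op) : e.subst 0 d = e.inst (scons d .var) := by
  rw [subst_eq_inst]
  congr 1
  funext n; cases n <;> simp [scons]

theorem inst_up_subst (e d : Expr User Loc Op) (γ : ℕ → Expr User Loc Op) :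
    (e.inst (up γ)).subst 0 d = e.inst (scons d γ) := by
  rw [subst_zero_eq_inst, inst_inst]
  congr 1
  funext n; cases n
  · rfl
  · simp only [up, scons, inst_ren]; exact inst_var _

theorem inst_subst (e d : Expr User Loc Op) (γ : ℕ → Expr User Loc Op) :
    (e.subst 0 d).inst γ = e.inst (scons (d.inst γ) γ) := by
  rw [subst_zero_eq_inst, inst_inst]
  congr 1
  funext n; cases n <;> rfl

theorem shift_inst (e : Expr User Loc Op) (γ : ℕ → Expr User Loc Op) :
    (e.shift 0).inst γ = e.inst (fun n => γ (n + 1)) := by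
  rw [shift_zero_eq_ren, inst_ren]; rfl

end Expr

/-- Simultaneous substitution in statements. -/
def Stmt.inst (γ : ℕ → Expr User Loc Op) : Stmt User Loc Op → Stmt User Loc Op
  | .lt e s => .lt (e.inst γ) (s.inst (Expr.up γ))
  | .set e e' => .set (e.inst γ) (e'.inst γ)
  | .print e e' => .print (e.inst γ) (e'.inst γ)

theorem Stmt.inst_inst (s : Stmt User Loc Op) (γ δ : ℕ → Expr User Loc Op) :
    (s.inst γ).inst δ = s.inst (fun n => (γ n).inst δ) := by
  induction s generalizing γ δ with
  | lt e s ih =>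
    have : (fun n => (Expr.up γ n).inst (Expr.up δ)) = Expr.up (fun n => (γ n).inst δ) := by
      funext n; cases n
      · rfl
      · simp only [Expr.up, Expr.scons, Expr.inst_ren, Expr.ren_inst]; rfl
    simp [inst, ih, this, Expr.inst_inst]
  | _ => simp [inst, Expr.inst_inst]

theorem Stmt.subst_eq_inst (s : Stmt User Loc Op) (k : ℕ) (d : Expr User Loc Op) :
    s.subst k d =
      s.inst (fun n => if n < k then .var n else if n = k then d else .var (n - 1)) := by
  induction s generalizing k d with
  | lt e s ih =>
    have : Expr.up (fun n => if n < k then .var n else if n = k then d else .var (n - 1)) =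
        fun n => if n < k + 1 then .var n else if n = k + 1 then d.shift 0 else .var (n - 1) := by
      funext n; cases n with
      | zero => simp [Expr.up, Expr.scons]
      | succ n =>
        simp only [Expr.up, Expr.scons, Expr.shift_zero_eq_ren]
        split_ifs <;> first | omega | rfl | (simp only [Expr.ren]; congr 1; omega)
    simp [subst, inst, ih, this, Expr.subst_eq_inst]
  | _ => simp [subst, inst, Expr.subst_eq_inst]

theorem Stmt.inst_up_subst (s : Stmt User Loc Op) (d : Expr User Loc Op)
    (γ : ℕ → Expr User Loc Op) :
    (s.inst (Expr.up γ)).subst 0 d = s.inst (Expr.scons d γ) := by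
  rw [subst_eq_inst, inst_inst]
  congr 1
  funext n; cases n
  · rfl
  · simp only [Expr.up, Expr.scons, Expr.inst_ren]
    refine Eq.trans ?_ (Expr.inst_var _)
    congr 1

theorem Stmt.inst_var (s : Stmt User Loc Op) : s.inst .var = s := by
  induction s with
  | lt e s ih =>
    have : Expr.up (.var : ℕ → Expr User Loc Op) = .var := by funext n; cases n <;> rfl
    simp [inst, this, ih, Expr.inst_var]
  | _ => simp [inst, Expr.inst_var]

end substitution

/-! ### Parallel reduction -/

section reduction

variable {User Loc Op : Type}

/-- Parallel reduction in arbitrary contexts, with call-by-name functions; `bind` is reversed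
application. -/
inductive Par (S : Sig User Loc Op) (σ : Store User Loc Op) :
    Expr User Loc Op → Expr User Loc Op → Prop
  | const (c) : Par S σ (.const c) (.const c)
  | var (n) : Par S σ (.var n) (.var n)
  | lam {e e'} : Par S σ e e' → Par S σ (.lam e) (.lam e')
  | app {e e' d d'} : Par S σ e e' → Par S σ d d' → Par S σ (.app e d) (.app e' d')
  | ite {e e' e₁ e₁' e₂ e₂'} : Par S σ e e' → Par S σ e₁ e₁' → Par S σ e₂ e₂' →
      Par S σ (.ite e e₁ e₂) (.ite e' e₁' e₂')
  | get {e e'} : Par S σ e e' → Par S σ (.get e) (.get e')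
  | bind {e e' d d'} : Par S σ e e' → Par S σ d d' → Par S σ (.bind e d) (.bind e' d')
  | down {e e'} : Par S σ e e' → Par S σ (.down e) (.down e')
  | cast (Γ T T') : Par S σ (.cast Γ T T') (.cast Γ T T')
  | beta {e e' d d'} : Par S σ e e' → Par S σ d d' →
      Par S σ (.app (.lam e) d) (e'.subst 0 d')
  | delta (f args d) : Par S σ (.app (.const (.op f args)) (.const (.datum d)))
      (.const (S.delta f args d))
  | read (l) : Par S σ (.get (.const (.datum (.loc l)))) (σ.mem l)
  | ite_true {e₁ e₁'} (e₂) : Par S σ e₁ e₁' →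
      Par S σ (.ite (.const (.datum (.bool true))) e₁ e₂) e₁'
  | ite_false {e₂ e₂'} (e₁) : Par S σ e₂ e₂' →
      Par S σ (.ite (.const (.datum (.bool false))) e₁ e₂) e₂'
  | unbind {e e' d d'} : Par S σ e e' → Par S σ d d' → Par S σ (.bind e d) (.app d' e')
  | lower {e e'} : Par S σ e e' → Par S σ (.down e) e'

/-- Every location holds a constant. -/
def Store.Data (σ : Store User Loc Op) : Prop := ∀ l, ∃ c, σ.mem l = .const c

variable {S : Sig User Loc Op} {σ : Store User Loc Op}

theorem Par.refl (e : Expr User Loc Op) : Par S σ e e := by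
  induction e <;> constructor <;> assumption

theorem Par.ren (hσ : σ.Data) {e e' : Expr User Loc Op} (h : Par S σ e e') (ρ : ℕ → ℕ) :
    Par S σ (e.ren ρ) (e'.ren ρ) := by
  induction h generalizing ρ with
  | beta _ _ ih ih' =>
    rename_i e e' d d' _ _
    have : (e'.subst 0 d').ren ρ = (e'.ren (liftRen ρ)).subst 0 (d'.ren ρ) := by
      rw [Expr.subst_zero_eq_inst, Expr.subst_zero_eq_inst, Expr.ren_inst, Expr.inst_ren]
      congr 1; funext n; cases n <;> rfl
    rw [this]
    exact .beta (ih _) (ih' _)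
  | read l =>
    obtain ⟨c, hc⟩ := hσ l
    have := Par.read (S := S) (σ := σ) l
    rw [hc] at this ⊢
    exact this
  | const | var | cast | delta => constructor
  | lam _ ih => exact .lam (ih _)
  | app _ _ ih ih' => exact .app (ih _) (ih' _)
  | ite _ _ _ ih ih' ih'' => exact .ite (ih _) (ih' _) (ih'' _)
  | get _ ih => exact .get (ih _)
  | bind _ _ ih ih' => exact .bind (ih _) (ih' _)
  | down _ ih => exact .down (ih _)
  | ite_true _ _ ih => exact .ite_true _ (ih _)
  | ite_false _ _ ih => exact .ite_false _ (ih _)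
  | unbind _ _ ih ih' => exact .unbind (ih _) (ih' _)
  | lower _ ih => exact .lower (ih _)

theorem Par.inst (hσ : σ.Data) {e e' : Expr User Loc Op} (h : Par S σ e e')
    {γ γ' : ℕ → Expr User Loc Op} (hγ : ∀ n, Par S σ (γ n) (γ' n)) :
    Par S σ (e.inst γ) (e'.inst γ') := by
  have hup : ∀ {γ γ' : ℕ → Expr User Loc Op}, (∀ n, Par S σ (γ n) (γ' n)) →
      ∀ n, Par S σ (Expr.up γ n) (Expr.up γ' n) := by
    intro γ γ' hγ n
    cases n
    · exact .refl _
    · exact (hγ _).ren hσ _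
  induction h generalizing γ γ' with
  | beta _ _ ih ih' =>
    rw [Expr.inst_subst, ← Expr.inst_up_subst]
    exact .beta (ih (hup hγ)) (ih' hγ)
  | read l =>
    obtain ⟨c, hc⟩ := hσ l
    have := Par.read (S := S) (σ := σ) l
    rw [hc] at this ⊢
    exact this
  | var n => exact hγ n
  | const | cast | delta => constructor
  | lam _ ih => exact .lam (ih (hup hγ))
  | app _ _ ih ih' => exact .app (ih hγ) (ih' hγ)
  | ite _ _ _ ih ih' ih'' => exact .ite (ih hγ) (ih' hγ) (ih'' hγ)
  | get _ ih => exact .get (ih hγ)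
  | bind _ _ ih ih' => exact .bind (ih hγ) (ih' hγ)
  | down _ ih => exact .down (ih hγ)
  | ite_true _ _ ih => exact .ite_true _ (ih hγ)
  | ite_false _ _ ih => exact .ite_false _ (ih hγ)
  | unbind _ _ ih ih' => exact .unbind (ih hγ) (ih' hγ)
  | lower _ ih => exact .lower (ih hγ)

theorem Par.subst (hσ : σ.Data) {e e' d d' : Expr User Loc Op} (h : Par S σ e e')
    (h' : Par S σ d d') : Par S σ (e.subst 0 d) (e'.subst 0 d') := by
  rw [Expr.subst_zero_eq_inst, Expr.subst_zero_eq_inst]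
  refine h.inst hσ fun n => ?_
  cases n
  · exact h'
  · exact .refl _

theorem Par.diamond (hσ : σ.Data) {e e₁ e₂ : Expr User Loc Op} (h₁ : Par S σ e e₁)
    (h₂ : Par S σ e e₂) : ∃ u, Par S σ e₁ u ∧ Par S σ e₂ u := by
  induction h₁ generalizing e₂ with
  | const c => exact ⟨_, h₂, .refl _⟩
  | var n => exact ⟨_, h₂, .refl _⟩
  | cast => exact ⟨_, h₂, .refl _⟩
  | lam _ ih =>
    cases h₂ with
    | lam h => obtain ⟨u, h, h'⟩ := ih h; exact ⟨_, .lam h, .lam h'⟩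
  | app p q ih ih' =>
    cases h₂ with
    | app h k =>
      obtain ⟨u, h, h'⟩ := ih h
      obtain ⟨w, k, k'⟩ := ih' k
      exact ⟨_, .app h k, .app h' k'⟩
    | beta h k =>
      obtain ⟨w, k, k'⟩ := ih' k
      cases p with
      | lam p =>
        obtain ⟨u, h, h'⟩ := ih (.lam h)
        cases h with
        | lam h => cases h' with
          | lam h' => exact ⟨_, .beta h k, .subst hσ h' k'⟩
    | delta =>
      cases p
      cases q
      exact ⟨_, .delta _ _ _, .refl _⟩
  | ite p p' p'' ih ih' ih'' =>
    cases h₂ with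
    | ite h k l =>
      obtain ⟨u, h, h'⟩ := ih h
      obtain ⟨w, k, k'⟩ := ih' k
      obtain ⟨z, l, l'⟩ := ih'' l
      exact ⟨_, .ite h k l, .ite h' k' l'⟩
    | ite_true _ k =>
      cases p
      obtain ⟨w, k, k'⟩ := ih' k
      exact ⟨_, .ite_true _ k, k'⟩
    | ite_false _ k =>
      cases p
      obtain ⟨w, k, k'⟩ := ih'' k
      exact ⟨_, .ite_false _ k, k'⟩
  | get p ih =>
    cases h₂ with
    | get h => obtain ⟨u, h, h'⟩ := ih h; exact ⟨_, .get h, .get h'⟩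
    | read l => cases p; exact ⟨_, .read l, .refl _⟩
  | bind _ _ ih ih' =>
    cases h₂ with
    | bind h k =>
      obtain ⟨u, h, h'⟩ := ih h
      obtain ⟨w, k, k'⟩ := ih' k
      exact ⟨_, .bind h k, .bind h' k'⟩
    | unbind h k =>
      obtain ⟨u, h, h'⟩ := ih h
      obtain ⟨w, k, k'⟩ := ih' k
      exact ⟨_, .unbind h k, .app k' h'⟩
  | down _ ih =>
    cases h₂ with
    | down h => obtain ⟨u, h, h'⟩ := ih h; exact ⟨_, .down h, .down h'⟩
    | lower h => obtain ⟨u, h, h'⟩ := ih h; exact ⟨_, .lower h, h'⟩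
  | beta _ _ ih ih' =>
    cases h₂ with
    | app h k =>
      cases h with
      | lam h =>
        obtain ⟨u, h, h'⟩ := ih h
        obtain ⟨w, k, k'⟩ := ih' k
        exact ⟨_, .subst hσ h k, .beta h' k'⟩
    | beta h k =>
      obtain ⟨u, h, h'⟩ := ih h
      obtain ⟨w, k, k'⟩ := ih' k
      exact ⟨_, .subst hσ h k, .subst hσ h' k'⟩
  | delta =>
    cases h₂ with
    | app h k => cases h; cases k; exact ⟨_, .refl _, .delta _ _ _⟩
    | delta => exact ⟨_, .refl _, .refl _⟩
  | read l =>
    cases h₂ with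
    | get h => cases h; exact ⟨_, .refl _, .read l⟩
    | read => exact ⟨_, .refl _, .refl _⟩
  | ite_true _ _ ih =>
    cases h₂ with
    | ite h k l =>
      cases h
      obtain ⟨w, k, k'⟩ := ih k
      exact ⟨_, k, .ite_true _ k'⟩
    | ite_true _ k => exact ih k
  | ite_false _ _ ih =>
    cases h₂ with
    | ite h k l =>
      cases h
      obtain ⟨w, k, k'⟩ := ih l
      exact ⟨_, k, .ite_false _ k'⟩
    | ite_false _ k => exact ih k
  | unbind _ _ ih ih' =>
    cases h₂ with
    | bind h k =>
      obtain ⟨u, h, h'⟩ := ih h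
      obtain ⟨w, k, k'⟩ := ih' k
      exact ⟨_, .app k h, .unbind h' k'⟩
    | unbind h k =>
      obtain ⟨u, h, h'⟩ := ih h
      obtain ⟨w, k, k'⟩ := ih' k
      exact ⟨_, .app k h, .app k' h'⟩
  | lower _ ih =>
    cases h₂ with
    | down h => obtain ⟨u, h, h'⟩ := ih h; exact ⟨_, h, .lower h'⟩
    | lower h => exact ih h

/-- Reduction in arbitrary contexts. -/
abbrev Red (S : Sig User Loc Op) (σ : Store User Loc Op) :
    Expr User Loc Op → Expr User Loc Op → Prop :=
  Relation.ReflTransGen (Par S σ)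

theorem Par.red {e e' : Expr User Loc Op} (h : Par S σ e e') : Red S σ e e' := .single h

theorem Red.confluent (hσ : σ.Data) {e e₁ e₂ : Expr User Loc Op} (h₁ : Red S σ e e₁)
    (h₂ : Red S σ e e₂) : ∃ u, Red S σ e₁ u ∧ Red S σ e₂ u :=
  Relation.church_rosser (fun _ _ _ h h' =>
    let ⟨u, k, k'⟩ := Par.diamond hσ h h'
    ⟨u, .single k, .single k'⟩) h₁ h₂

theorem Red.app {e e' d d' : Expr User Loc Op} (h : Red S σ e e') (h' : Red S σ d d') :
    Red S σ (.app e d) (.app e' d') :=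
  (h.lift (fun x => Expr.app x d) fun _ _ k => Par.app k (.refl _)).trans
    (h'.lift (fun x => Expr.app e' x) fun _ _ k => Par.app (.refl _) k)

theorem Red.get {e e' : Expr User Loc Op} (h : Red S σ e e') : Red S σ (.get e) (.get e') :=
  h.lift _ fun _ _ => Par.get

theorem Red.ite {e e' : Expr User Loc Op} (h : Red S σ e e') (e₁ e₂ : Expr User Loc Op) :
    Red S σ (.ite e e₁ e₂) (.ite e' e₁ e₂) :=
  h.lift (fun x => Expr.ite x e₁ e₂) fun _ _ k => Par.ite k (.refl _) (.refl _)

theorem Step.red {e e' : Expr User Loc Op} (h : Step S σ e e') : Red S σ e e' := by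
  induction h with
  | beta e v _ => exact (Par.beta (.refl _) (.refl _)).red
  | delta => exact (Par.delta _ _ _).red
  | get l => exact (Par.read l).red
  | ite_true => exact (Par.ite_true _ (.refl _)).red
  | ite_false => exact (Par.ite_false _ (.refl _)).red
  | bind v e _ =>
    exact (Par.unbind (.refl _) (.refl _)).red.trans (Par.beta (.refl _) (.refl _)).red
  | bind_op => exact (Par.unbind (.refl _) (.refl _)).red
  | down => exact (Par.lower (.refl _)).red
  | app_left _ _ _ _ ih => exact ih.app .refl
  | app_right _ _ _ _ _ ih => exact Red.app .refl ih
  | under_lam _ _ _ ih => exact ih.lift _ fun _ _ => Par.lam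
  | under_get _ _ _ ih => exact ih.get
  | ite_cond _ _ _ _ _ ih => exact ih.ite _ _
  | ite_then v _ _ e₂ _ _ ih =>
    exact ih.lift (fun x => Expr.ite v x e₂) fun _ _ k => Par.ite (.refl _) k (.refl _)
  | ite_else v v₁ _ _ _ _ _ ih =>
    exact ih.lift (fun x => Expr.ite v v₁ x) fun _ _ k => Par.ite (.refl _) (.refl _) k
  | bind_left _ _ d _ ih =>
    exact ih.lift (fun x => Expr.bind x d) fun _ _ k => Par.bind k (.refl _)
  | bind_right v _ _ _ _ ih =>
    exact ih.lift (fun x => Expr.bind v x) fun _ _ k => Par.bind (.refl _) k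

theorem EvalsTo.red {e v : Expr User Loc Op} (h : EvalsTo S σ e v) : Red S σ e v := by
  obtain ⟨h, -⟩ := h
  induction h with
  | refl => exact .refl
  | tail _ k ih => exact ih.trans k.red

theorem Red.of_value {v u : Expr User Loc Op} (h : Red S σ v u) (hv : v.IsValue) :
    u.IsValue ∧ u.abs = v.abs := by
  induction h with
  | refl => exact ⟨hv, rfl⟩
  | tail _ k ih =>
    obtain ⟨hu, ha⟩ := ih
    rw [← ha]
    cases k <;> first | exact hu.elim | exact ⟨trivial, rfl⟩

/-- The logical value of an expression that reduces to a value. -/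
def HasAbs (S : Sig User Loc Op) (σ : Store User Loc Op) (e : Expr User Loc Op)
    (a : RVal User Loc Op) : Prop :=
  ∃ v, Red S σ e v ∧ v.IsValue ∧ v.abs = a

theorem HasAbs.unique (hσ : σ.Data) {e : Expr User Loc Op} {a b : RVal User Loc Op}
    (h : HasAbs S σ e a) (h' : HasAbs S σ e b) : a = b := by
  obtain ⟨v, h, hv, rfl⟩ := h
  obtain ⟨w, h', hw, rfl⟩ := h'
  obtain ⟨u, k, k'⟩ := h.confluent hσ h'
  rw [← (k.of_value hv).2, ← (k'.of_value hw).2]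

theorem HasAbs.expand {e e' : Expr User Loc Op} {a : RVal User Loc Op}
    (h : HasAbs S σ e' a) (k : Red S σ e e') : HasAbs S σ e a := by
  obtain ⟨v, h, hv⟩ := h
  exact ⟨v, k.trans h, hv⟩

theorem HasAbs.reduce (hσ : σ.Data) {e e' : Expr User Loc Op} {a : RVal User Loc Op}
    (h : HasAbs S σ e a) (k : Red S σ e e') : HasAbs S σ e' a := by
  obtain ⟨v, h, hv, rfl⟩ := h
  obtain ⟨u, p, p'⟩ := h.confluent hσ k
  exact ⟨u, p', p.of_value hv⟩

theorem hasAbs_congr (hσ : σ.Data) {e e' : Expr User Loc Op} {a : RVal User Loc Op}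
    (k : Red S σ e e') : HasAbs S σ e a ↔ HasAbs S σ e' a :=
  ⟨fun h => h.reduce hσ k, fun h => h.expand k⟩

theorem hasAbs_value {v : Expr User Loc Op} (hv : v.IsValue) : HasAbs S σ v v.abs :=
  ⟨v, .refl, hv, rfl⟩

theorem hasAbs_const (c : Const User Loc Op) : HasAbs S σ (.const c) (.const c) :=
  hasAbs_value (v := .const c) trivial

theorem hasAbs_const_iff {e : Expr User Loc Op} {c : Const User Loc Op} :
    HasAbs S σ e (.const c) ↔ Red S σ e (.const c) := by
  refine ⟨?_, fun h => (hasAbs_const c).expand h⟩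
  rintro ⟨v, h, hv, ha⟩
  cases v <;> simp_all [Expr.abs]

end reduction

/-! ### Evaluation of refinement terms -/

section evaluation

variable {User Loc Op : Type} {S : Sig User Loc Op}

/-- Add the value of a new innermost program variable. -/
def REnv.cons (a : RVal User Loc Op) (E : REnv User Loc Op) : REnv User Loc Op :=
  { E with var := fun | 0 => a | n + 1 => E.var n }

/-- Forget the value of variable `k`. -/
def REnv.drop (k : ℕ) (E : REnv User Loc Op) : REnv User Loc Op :=
  { E with var := fun n => if n < k then E.var n else E.var (n + 1) }

/-- Insert a value for variable `k`. -/
def REnv.insert (k : ℕ) (a : RVal User Loc Op) (E : REnv User Loc Op) : REnv User Loc Op :=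
  { E with var := fun n => if n < k then E.var n else if n = k then a else E.var (n - 1) }

theorem REnv.cons_drop (a : RVal User Loc Op) (k : ℕ) (E : REnv User Loc Op) :
    (E.cons a).drop (k + 1) = (E.drop k).cons a := by
  simp only [cons, drop, REnv.mk.injEq, and_true]
  funext n; cases n with
  | zero => simp
  | succ n => simp

theorem REnv.cons_insert (a b : RVal User Loc Op) (k : ℕ) (E : REnv User Loc Op) :
    (E.cons a).insert (k + 1) b = (E.insert k b).cons a := by
  simp only [cons, insert, REnv.mk.injEq, and_true]
  funext n; cases n with
  | zero => simp
  | succ n =>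
    simp only [add_lt_add_iff_right, add_left_inj, add_tsub_cancel_right]
    split_ifs <;> first | rfl | skip
    obtain ⟨m, rfl⟩ : ∃ m, n = m + 1 := ⟨n - 1, by omega⟩
    rfl

theorem REnv.drop_zero_cons (a : RVal User Loc Op) (E : REnv User Loc Op) :
    (E.cons a).drop 0 = E := by simp [cons, drop]

theorem REnv.drop_zero (E : REnv User Loc Op) : E.drop 0 = E.tail := by
  simp [tail, drop]

theorem REnv.insert_zero (a : RVal User Loc Op) (E : REnv User Loc Op) :
    E.insert 0 a = E.cons a := by
  simp only [cons, insert, REnv.mk.injEq, and_true]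
  funext n; cases n <;> simp

namespace RTerm

theorem eval_map {fv : ℕ → RTerm User Loc Op} {fnu fps fpu : RTerm User Loc Op}
    {E E' : REnv User Loc Op} (hv : ∀ n, (fv n).eval S E = E'.var n) (hcur : E.cur = E'.cur)
    (hnu : fnu.eval S E = E'.nu) (hps : fps.eval S E = .store E'.pstore)
    (hpu : fpu.eval S E = .const (.datum (.user E'.puser))) (r : RTerm User Loc Op) :
    (r.map fv fnu fps fpu).eval S E = r.eval S E' := by
  induction r <;> simp_all [map, eval]

theorem eval_shift (r : RTerm User Loc Op) (k : ℕ) (E : REnv User Loc Op) :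
    (r.shift k).eval S E = r.eval S (E.drop k) := by
  refine eval_map (E' := E.drop k) (fun n => ?_) ?_ ?_ ?_ ?_ r
  · simp only [REnv.drop]
    split_ifs <;> rfl
  all_goals rfl

theorem holds_shift (r : RTerm User Loc Op) (k : ℕ) (E : REnv User Loc Op) :
    (r.shift k).Holds S E ↔ r.Holds S (E.drop k) := by
  rw [Holds, eval_shift, Holds]

theorem eval_subst (r : RTerm User Loc Op) (k : ℕ) (t : RTerm User Loc Op)
    (E : REnv User Loc Op) :
    (r.subst k t).eval S E = r.eval S (E.insert k (t.eval S E)) := by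
  refine eval_map (E' := E.insert k (t.eval S E)) (fun n => ?_) ?_ ?_ ?_ ?_ r
  · simp only [REnv.insert]
    split_ifs <;> rfl
  all_goals rfl

theorem holds_subst (r : RTerm User Loc Op) (k : ℕ) (t : RTerm User Loc Op)
    (E : REnv User Loc Op) :
    (r.subst k t).Holds S E ↔ r.Holds S (E.insert k (t.eval S E)) := by
  rw [Holds, eval_subst, Holds]

theorem holds_substNu (r t : RTerm User Loc Op) (E : REnv User Loc Op) :
    (r.substNu t).Holds S E ↔ r.Holds S { E with nu := t.eval S E } := by
  rw [Holds, Holds, substNu, eval_map (E' := { E with nu := t.eval S E })] <;> intros <;> rfl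

theorem holds_applyPolicy (r : RTerm User Loc Op) {E : REnv User Loc Op} {o : User}
    (hnu : E.nu = .const (.datum (.user o))) :
    (r.applyPolicy .cur .nu).Holds S E ↔
      r.Holds S { E with pstore := E.cur, puser := o } := by
  rw [Holds, Holds, applyPolicy, eval_map (E' := { E with pstore := E.cur, puser := o })] <;>
    intros <;> first | exact hnu | rfl

/-- The value of a term depends only on what the term may mention. -/
theorem Scoped.eval_congr {n : ℕ} {hnu hcur hpol : Bool} {E E' : REnv User Loc Op}
    {r : RTerm User Loc Op} (h : r.Scoped n hnu hcur hpol) (hv : ∀ k < n, E.var k = E'.var k)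
    (h₁ : hnu = true → E.nu = E'.nu) (h₂ : hcur = true → E.cur = E'.cur)
    (h₃ : hpol = true → E.pstore = E'.pstore ∧ E.puser = E'.puser) :
    r.eval S E = r.eval S E' := by
  induction r <;> simp_all [Scoped, eval]

theorem Scoped.holds_congr {n : ℕ} {hnu hcur hpol : Bool} {E E' : REnv User Loc Op}
    {r : RTerm User Loc Op} (h : r.Scoped n hnu hcur hpol) (hv : ∀ k < n, E.var k = E'.var k)
    (h₁ : hnu = true → E.nu = E'.nu) (h₂ : hcur = true → E.cur = E'.cur)
    (h₃ : hpol = true → E.pstore = E'.pstore ∧ E.puser = E'.puser) :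
    r.Holds S E ↔ r.Holds S E' := by
  rw [Holds, Holds, h.eval_congr hv h₁ h₂ h₃]

theorem Scoped.holds_nu {n : ℕ} {hcur hpol : Bool} {r : RTerm User Loc Op}
    (h : r.Scoped n false hcur hpol) (E : REnv User Loc Op) (a : RVal User Loc Op) :
    r.Holds S { E with nu := a } ↔ r.Holds S E :=
  h.holds_congr (fun _ _ => rfl) (by simp) (fun _ => rfl) (fun _ => ⟨rfl, rfl⟩)

theorem isTrue_ofProp {P : Prop} : (RVal.ofProp P : RVal User Loc Op).IsTrue ↔ P := by
  unfold RVal.ofProp RVal.IsTrue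
  split_ifs with h <;> simp [h]

theorem holds_and {r r' : RTerm User Loc Op} {E : REnv User Loc Op} :
    (RTerm.and r r').Holds S E ↔ r.Holds S E ∧ r'.Holds S E := isTrue_ofProp

theorem holds_imp {r r' : RTerm User Loc Op} {E : REnv User Loc Op} :
    (RTerm.imp r r').Holds S E ↔ (r.Holds S E → r'.Holds S E) := isTrue_ofProp

theorem holds_eq {r r' : RTerm User Loc Op} {E : REnv User Loc Op} :
    (RTerm.eq r r').Holds S E ↔ r.eval S E = r'.eval S E := isTrue_ofProp

theorem holds_nu_iff {E : REnv User Loc Op} :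
    (RTerm.nu : RTerm User Loc Op).Holds S E ↔ E.nu = .const (.datum (.bool true)) := Iff.rfl

end RTerm

end evaluation

/-! ### Interpretation of types -/

section interpretation

variable {User Loc Op : Type}

mutual

/-- Expressions that behave as elements of `B` in the store `σ`. -/
def BTy.Sem (S : Sig User Loc Op) (σ : Store User Loc Op) :
    BTy User Loc Op → REnv User Loc Op → Expr User Loc Op → Prop
  | .prim p, _, e => ∃ d, HasAbs S σ e (.const (.datum d)) ∧ d.HasPrim p
  | .tag T _, E, e => Ty.Sem S σ T E e
  | .ref T, _, e => ∃ l, HasAbs S σ e (.const (.datum (.loc l))) ∧ S.locTy l = T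

def Ty.Sem (S : Sig User Loc Op) (σ : Store User Loc Op) :
    Ty User Loc Op → REnv User Loc Op → Expr User Loc Op → Prop
  | .base B r, E, e => BTy.Sem S σ B E e ∧ ∃ a, HasAbs S σ e a ∧ r.Holds S { E with nu := a }
  | .fn T T', E, e =>
      (∃ a, HasAbs S σ e a ∧ (a = .closure ∨ ∃ f args, a = .const (.op f args))) ∧
      ∀ d a, Ty.Sem S σ T E d → HasAbs S σ d a → Ty.Sem S σ T' (E.cons a) (.app e d)

end

mutual

/-- Indistinguishability at `B` of expressions in two stores. Tagged expressions have to be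
related when both runs satisfy the policy; when one run satisfies it, its expression has to be
related to some possible expression of the other run. -/
def BTy.Rel (S : Sig User Loc Op) (σ₁ σ₂ : Store User Loc Op) :
    BTy User Loc Op → REnv User Loc Op → REnv User Loc Op →
    Expr User Loc Op → Expr User Loc Op → Prop
  | .prim _, _, _, e₁, e₂ => ∃ a, HasAbs S σ₁ e₁ a ∧ HasAbs S σ₂ e₂ a
  | .ref _, _, _, e₁, e₂ => ∃ a, HasAbs S σ₁ e₁ a ∧ HasAbs S σ₂ e₂ a
  | .tag T pol, E₁, E₂, e₁, e₂ =>
      (pol.Holds S E₁ → ∃ d₂, Ty.Sem S σ₂ T E₂ d₂ ∧ Ty.Rel S σ₁ σ₂ T E₁ E₂ e₁ d₂) ∧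
      (pol.Holds S E₂ → ∃ d₁, Ty.Sem S σ₁ T E₁ d₁ ∧ Ty.Rel S σ₁ σ₂ T E₁ E₂ d₁ e₂) ∧
      (pol.Holds S E₁ → pol.Holds S E₂ → Ty.Rel S σ₁ σ₂ T E₁ E₂ e₁ e₂)

def Ty.Rel (S : Sig User Loc Op) (σ₁ σ₂ : Store User Loc Op) :
    Ty User Loc Op → REnv User Loc Op → REnv User Loc Op →
    Expr User Loc Op → Expr User Loc Op → Prop
  | .base B _, E₁, E₂, e₁, e₂ => BTy.Rel S σ₁ σ₂ B E₁ E₂ e₁ e₂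
  | .fn T T', E₁, E₂, e₁, e₂ => ∀ d₁ d₂ a₁ a₂, Ty.Sem S σ₁ T E₁ d₁ → Ty.Sem S σ₂ T E₂ d₂ →
      HasAbs S σ₁ d₁ a₁ → HasAbs S σ₂ d₂ a₂ → Ty.Rel S σ₁ σ₂ T E₁ E₂ d₁ d₂ →
      Ty.Rel S σ₁ σ₂ T' (E₁.cons a₁) (E₂.cons a₂) (.app e₁ d₁) (.app e₂ d₂)

end

variable {S : Sig User Loc Op} {σ σ₁ σ₂ : Store User Loc Op}

mutual

theorem BTy.sem_red (hσ : σ.Data) : ∀ (B : BTy User Loc Op) (E : REnv User Loc Op)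
    {e e' : Expr User Loc Op}, Red S σ e e' → (B.Sem S σ E e ↔ B.Sem S σ E e')
  | .prim p, E, e, e', h => by simp only [BTy.Sem, hasAbs_congr hσ h]
  | .tag T pol, E, e, e', h => by simp only [BTy.Sem, Ty.sem_red hσ T E h]
  | .ref T, E, e, e', h => by simp only [BTy.Sem, hasAbs_congr hσ h]

/-- The interpretation of types is invariant under reduction. -/
theorem Ty.sem_red (hσ : σ.Data) : ∀ (T : Ty User Loc Op) (E : REnv User Loc Op)
    {e e' : Expr User Loc Op}, Red S σ e e' → (T.Sem S σ E e ↔ T.Sem S σ E e')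
  | .base B r, E, e, e', h => by simp only [Ty.Sem, BTy.sem_red hσ B E h, hasAbs_congr hσ h]
  | .fn T T', E, e, e', h => by
    have : ∀ d a, T'.Sem S σ (E.cons a) (.app e d) ↔ T'.Sem S σ (E.cons a) (.app e' d) :=
      fun d a => Ty.sem_red hσ T' _ (h.app .refl)
    simp only [Ty.Sem, this, hasAbs_congr hσ h]

end

mutual

theorem BTy.rel_red (h₁ : σ₁.Data) (h₂ : σ₂.Data) :
    ∀ (B : BTy User Loc Op) (E₁ E₂ : REnv User Loc Op) {e₁ e₂ e₁' e₂' : Expr User Loc Op},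
    Red S σ₁ e₁ e₁' → Red S σ₂ e₂ e₂' →
    (B.Rel S σ₁ σ₂ E₁ E₂ e₁ e₂ ↔ B.Rel S σ₁ σ₂ E₁ E₂ e₁' e₂')
  | .prim p, E₁, E₂, _, _, _, _, k₁, k₂ => by
    simp only [BTy.Rel, hasAbs_congr h₁ k₁, hasAbs_congr h₂ k₂]
  | .ref T, E₁, E₂, _, _, _, _, k₁, k₂ => by
    simp only [BTy.Rel, hasAbs_congr h₁ k₁, hasAbs_congr h₂ k₂]
  | .tag T pol, E₁, E₂, e₁, e₂, _, _, k₁, k₂ => by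
    have l := fun d => Ty.rel_red h₁ h₂ T E₁ E₂ k₁ (.refl (a := d))
    have r := fun d => Ty.rel_red h₁ h₂ T E₁ E₂ (.refl (a := d)) k₂
    simp only [BTy.Rel, l, r]

theorem Ty.rel_red (h₁ : σ₁.Data) (h₂ : σ₂.Data) :
    ∀ (T : Ty User Loc Op) (E₁ E₂ : REnv User Loc Op) {e₁ e₂ e₁' e₂' : Expr User Loc Op},
    Red S σ₁ e₁ e₁' → Red S σ₂ e₂ e₂' →
    (T.Rel S σ₁ σ₂ E₁ E₂ e₁ e₂ ↔ T.Rel S σ₁ σ₂ E₁ E₂ e₁' e₂')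
  | .base B r, E₁, E₂, _, _, _, _, k₁, k₂ => by
    simp only [Ty.Rel, BTy.rel_red h₁ h₂ B E₁ E₂ k₁ k₂]
  | .fn T T', E₁, E₂, e₁, e₂, e₁', e₂', k₁, k₂ => by
    have : ∀ d₁ d₂ a₁ a₂,
        T'.Rel S σ₁ σ₂ (E₁.cons a₁) (E₂.cons a₂) (.app e₁ d₁) (.app e₂ d₂) ↔
        T'.Rel S σ₁ σ₂ (E₁.cons a₁) (E₂.cons a₂) (.app e₁' d₁) (.app e₂' d₂) :=
      fun d₁ d₂ a₁ a₂ => Ty.rel_red h₁ h₂ T' _ _ (k₁.app .refl) (k₂.app .refl)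
    simp only [Ty.Rel, this]

end

mutual

theorem BTy.sem_shift : ∀ (B : BTy User Loc Op) (k : ℕ) (E : REnv User Loc Op)
    (e : Expr User Loc Op), (B.shift k).Sem S σ E e ↔ B.Sem S σ (E.drop k) e
  | .prim p, k, E, e => by simp only [BTy.shift, BTy.Sem]
  | .tag T pol, k, E, e => by simp only [BTy.shift, BTy.Sem, Ty.sem_shift T]
  | .ref T, k, E, e => by simp only [BTy.shift, BTy.Sem]

theorem Ty.sem_shift : ∀ (T : Ty User Loc Op) (k : ℕ) (E : REnv User Loc Op)
    (e : Expr User Loc Op), (T.shift k).Sem S σ E e ↔ T.Sem S σ (E.drop k) e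
  | .base B r, k, E, e => by
    simp only [Ty.shift, Ty.Sem, BTy.sem_shift B, RTerm.holds_shift]; rfl
  | .fn T T', k, E, e => by
    simp only [Ty.shift, Ty.Sem, Ty.sem_shift T, Ty.sem_shift T', REnv.cons_drop]

end

mutual

theorem BTy.rel_shift : ∀ (B : BTy User Loc Op) (k : ℕ) (E₁ E₂ : REnv User Loc Op)
    (e₁ e₂ : Expr User Loc Op), (B.shift k).Rel S σ₁ σ₂ E₁ E₂ e₁ e₂ ↔
      B.Rel S σ₁ σ₂ (E₁.drop k) (E₂.drop k) e₁ e₂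
  | .prim p, k, _, _, _, _ => by simp only [BTy.shift, BTy.Rel]
  | .tag T pol, k, _, _, _, _ => by
    simp only [BTy.shift, BTy.Rel, Ty.rel_shift T, Ty.sem_shift T, RTerm.holds_shift]
  | .ref T, k, _, _, _, _ => by simp only [BTy.shift, BTy.Rel]

theorem Ty.rel_shift : ∀ (T : Ty User Loc Op) (k : ℕ) (E₁ E₂ : REnv User Loc Op)
    (e₁ e₂ : Expr User Loc Op), (T.shift k).Rel S σ₁ σ₂ E₁ E₂ e₁ e₂ ↔
      T.Rel S σ₁ σ₂ (E₁.drop k) (E₂.drop k) e₁ e₂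
  | .base B r, k, _, _, _, _ => by simp only [Ty.shift, Ty.Rel, BTy.rel_shift B]
  | .fn T T', k, _, _, _, _ => by
    simp only [Ty.shift, Ty.Rel, Ty.sem_shift T, Ty.rel_shift T, Ty.rel_shift T', REnv.cons_drop]

end

/-- The value of `t` depends on program variables only. -/
def RTerm.Simple (t : RTerm User Loc Op) : Prop := ∃ n, t.Scoped n false false false

theorem RTerm.Simple.eval_nu {t : RTerm User Loc Op} (ht : t.Simple) (E : REnv User Loc Op)
    (a : RVal User Loc Op) : t.eval S { E with nu := a } = t.eval S E := by
  obtain ⟨n, ht⟩ := ht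
  exact ht.eval_congr (fun _ _ => rfl) (by simp) (by simp) (by simp)

theorem RTerm.Scoped.shift {n : ℕ} {hnu hcur hpol : Bool} {r : RTerm User Loc Op}
    (h : r.Scoped n hnu hcur hpol) (k : ℕ) : (r.shift k).Scoped (n + 1) hnu hcur hpol := by
  unfold RTerm.shift
  induction r with
  | var m => simp only [Scoped, map] at h ⊢; split_ifs <;> simp only [Scoped] <;> omega
  | _ => simp_all [Scoped, map]

theorem RTerm.Simple.shift {t : RTerm User Loc Op} (ht : t.Simple) (k : ℕ) :
    (t.shift k).Simple := by
  obtain ⟨n, ht⟩ := ht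
  exact ⟨_, ht.shift k⟩

theorem RTerm.eval_shift_cons (t : RTerm User Loc Op) (E : REnv User Loc Op)
    (a : RVal User Loc Op) : (t.shift 0).eval S (E.cons a) = t.eval S E := by
  rw [eval_shift, REnv.drop_zero_cons]

mutual

theorem BTy.sem_subst : ∀ (B : BTy User Loc Op) (k : ℕ) {t : RTerm User Loc Op} (_ : t.Simple)
    (E : REnv User Loc Op) (e : Expr User Loc Op),
    (B.subst k t).Sem S σ E e ↔ B.Sem S σ (E.insert k (t.eval S E)) e
  | .prim p, k, t, ht, E, e => by simp only [BTy.subst, BTy.Sem]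
  | .tag T pol, k, t, ht, E, e => by simp only [BTy.subst, BTy.Sem, Ty.sem_subst T k ht]
  | .ref T, k, t, ht, E, e => by simp only [BTy.subst, BTy.Sem]

theorem Ty.sem_subst : ∀ (T : Ty User Loc Op) (k : ℕ) {t : RTerm User Loc Op} (_ : t.Simple)
    (E : REnv User Loc Op) (e : Expr User Loc Op),
    (T.subst k t).Sem S σ E e ↔ T.Sem S σ (E.insert k (t.eval S E)) e
  | .base B r, k, t, ht, E, e => by
    simp only [Ty.subst, Ty.Sem, BTy.sem_subst B k ht, RTerm.holds_subst, ht.eval_nu]; rfl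
  | .fn T T', k, t, ht, E, e => by
    simp only [Ty.subst, Ty.Sem, Ty.sem_subst T k ht, Ty.sem_subst T' (k + 1) (ht.shift 0),
      RTerm.eval_shift_cons, REnv.cons_insert]

end

mutual

theorem BTy.rel_subst : ∀ (B : BTy User Loc Op) (k : ℕ) {t : RTerm User Loc Op} (_ : t.Simple)
    (E₁ E₂ : REnv User Loc Op) (e₁ e₂ : Expr User Loc Op),
    (B.subst k t).Rel S σ₁ σ₂ E₁ E₂ e₁ e₂ ↔
      B.Rel S σ₁ σ₂ (E₁.insert k (t.eval S E₁)) (E₂.insert k (t.eval S E₂)) e₁ e₂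
  | .prim p, k, t, ht, _, _, _, _ => by simp only [BTy.subst, BTy.Rel]
  | .tag T pol, k, t, ht, _, _, _, _ => by
    simp only [BTy.subst, BTy.Rel, Ty.rel_subst T k ht, Ty.sem_subst T k ht, RTerm.holds_subst]
  | .ref T, k, t, ht, _, _, _, _ => by simp only [BTy.subst, BTy.Rel]

theorem Ty.rel_subst : ∀ (T : Ty User Loc Op) (k : ℕ) {t : RTerm User Loc Op} (_ : t.Simple)
    (E₁ E₂ : REnv User Loc Op) (e₁ e₂ : Expr User Loc Op),
    (T.subst k t).Rel S σ₁ σ₂ E₁ E₂ e₁ e₂ ↔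
      T.Rel S σ₁ σ₂ (E₁.insert k (t.eval S E₁)) (E₂.insert k (t.eval S E₂)) e₁ e₂
  | .base B r, k, t, ht, _, _, _, _ => by simp only [Ty.subst, Ty.Rel, BTy.rel_subst B k ht]
  | .fn T T', k, t, ht, _, _, _, _ => by
    simp only [Ty.subst, Ty.Rel, Ty.sem_subst T k ht, Ty.rel_subst T k ht,
      Ty.rel_subst T' (k + 1) (ht.shift 0), RTerm.eval_shift_cons, REnv.cons_insert]

end

theorem Ty.Sem.hasAbs {T : Ty User Loc Op} {E : REnv User Loc Op} {e : Expr User Loc Op}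
    (h : T.Sem S σ E e) : ∃ a, HasAbs S σ e a := by
  cases T with
  | base B r =>
    rw [Ty.Sem] at h
    obtain ⟨-, a, h, -⟩ := h
    exact ⟨a, h⟩
  | fn T T' =>
    rw [Ty.Sem] at h
    obtain ⟨⟨a, h, -⟩, -⟩ := h
    exact ⟨a, h⟩

mutual

theorem BTy.Sem.shape (hσ : σ.Data) : ∀ {B : BTy User Loc Op} {E : REnv User Loc Op}
    {e : Expr User Loc Op} {a : RVal User Loc Op}, B.Sem S σ E e → HasAbs S σ e a → B.Shape S a
  | .prim p, E, e, a, h, ha => by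
    rw [BTy.Sem] at h
    obtain ⟨d, h, hd⟩ := h
    rw [BTy.Shape]
    exact ⟨d, ha.unique hσ h, hd⟩
  | .tag T pol, E, e, a, h, ha => by
    rw [BTy.Sem] at h
    rw [BTy.Shape]
    exact Ty.Sem.shape hσ h ha
  | .ref T, E, e, a, h, ha => by
    rw [BTy.Sem] at h
    obtain ⟨l, h, hl⟩ := h
    rw [BTy.Shape]
    exact ⟨l, ha.unique hσ h, hl⟩

theorem Ty.Sem.shape (hσ : σ.Data) : ∀ {T : Ty User Loc Op} {E : REnv User Loc Op}
    {e : Expr User Loc Op} {a : RVal User Loc Op}, T.Sem S σ E e → HasAbs S σ e a → T.Shape S a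
  | .base B r, E, e, a, h, ha => by
    rw [Ty.Sem] at h
    rw [Ty.Shape]
    exact BTy.Sem.shape hσ h.1 ha
  | .fn T T', E, e, a, h, ha => by
    rw [Ty.Sem] at h
    obtain ⟨⟨b, h, hb⟩, -⟩ := h
    rw [Ty.Shape, ha.unique hσ h]
    exact hb

end

theorem Ty.Sem.assumption (hσ : σ.Data) {T : Ty User Loc Op} {E : REnv User Loc Op}
    {e : Expr User Loc Op} {a : RVal User Loc Op} (h : T.Sem S σ E e) (ha : HasAbs S σ e a) :
    T.Assumption S E a := by
  cases T with
  | base B r =>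
    rw [Ty.Sem] at h
    obtain ⟨-, b, h, hr⟩ := h
    rw [ha.unique hσ h]
    exact hr
  | fn T T' => trivial

/-- The assumptions in `Γ` do not depend on the value variable. -/
def NuInvariant (S : Sig User Loc Op) (Γ : Ctx User Loc Op) : Prop :=
  ∀ E a, Models S Γ E → Models S Γ { E with nu := a }

theorem NuInvariant.cons {Γ : Ctx User Loc Op} (h : NuInvariant S Γ) (T : Ty User Loc Op) :
    NuInvariant S (.var T :: Γ) :=
  fun _ a hE => ⟨h _ a hE.1, hE.2⟩

theorem Models.cons (hσ : σ.Data) {Γ : Ctx User Loc Op} {E : REnv User Loc Op}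
    {T : Ty User Loc Op} {d : Expr User Loc Op} {a : RVal User Loc Op} (hE : Models S Γ E)
    (hd : T.Sem S σ E d) (ha : HasAbs S σ d a) : Models S (.var T :: Γ) (E.cons a) :=
  ⟨hE, hd.shape hσ ha, hd.assumption hσ ha⟩

/-- Soundness of subtyping for the unary interpretation. -/
theorem Sub.sem (hσ : σ.Data) {Γ : Ctx User Loc Op} {T T' : Ty User Loc Op} (h : Sub S Γ T T') :
    NuInvariant S Γ → ∀ E e, Models S Γ E → T.Sem S σ E e → T'.Sem S σ E e := by
  refine Sub.rec
    (motive_1 := fun Γ B B' _ => NuInvariant S Γ → ∀ E e, Models S Γ E → B.Sem S σ E e →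
      B'.Sem S σ E e)
    (motive_2 := fun Γ T T' _ => NuInvariant S Γ → ∀ E e, Models S Γ E → T.Sem S σ E e →
      T'.Sem S σ E e) ?_ ?_ ?_ ?_ ?_ h
  · intro Γ B _ E e _ h
    exact h
  · intro Γ T T' r r' _ _ ih hΓ E e hE h
    rw [BTy.Sem] at h ⊢
    exact ih hΓ E e hE h
  · intro Γ B B' r r' _ hr ih hΓ E e hE h
    rw [Ty.Sem] at h ⊢
    obtain ⟨h, a, ha, hra⟩ := h
    exact ⟨ih hΓ E e hE h, a, ha, hr _ (hΓ E a hE) (h.shape hσ ha) hra⟩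
  · intro Γ T₁ T₁' T₂ T₂' _ _ ih₁ ih₂ hΓ E e hE h
    rw [Ty.Sem] at h ⊢
    refine ⟨h.1, fun d a hd ha => ?_⟩
    exact ih₂ (hΓ.cons _) _ _ (hE.cons hσ hd ha) (h.2 d a (ih₁ hΓ E d hE hd) ha)
  · intro Γ T hΓ E e hE h
    obtain ⟨a, ha⟩ := h.hasAbs
    rw [Ty.tagged, Ty.Sem, BTy.Sem]
    exact ⟨h, a, ha, rfl⟩

/-- Soundness of subtyping for indistinguishability. -/
theorem Sub.rel (h₁ : σ₁.Data) (h₂ : σ₂.Data) {Γ : Ctx User Loc Op} {T T' : Ty User Loc Op}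
    (h : Sub S Γ T T') : NuInvariant S Γ → ∀ E₁ E₂ e₁ e₂, Models S Γ E₁ → Models S Γ E₂ →
      T.Sem S σ₁ E₁ e₁ → T.Sem S σ₂ E₂ e₂ → T.Rel S σ₁ σ₂ E₁ E₂ e₁ e₂ →
      T'.Rel S σ₁ σ₂ E₁ E₂ e₁ e₂ := by
  refine Sub.rec
    (motive_1 := fun Γ B B' _ => NuInvariant S Γ → ∀ E₁ E₂ e₁ e₂, Models S Γ E₁ →
      Models S Γ E₂ → B.Sem S σ₁ E₁ e₁ → B.Sem S σ₂ E₂ e₂ → B.Rel S σ₁ σ₂ E₁ E₂ e₁ e₂ →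
      B'.Rel S σ₁ σ₂ E₁ E₂ e₁ e₂)
    (motive_2 := fun Γ T T' _ => NuInvariant S Γ → ∀ E₁ E₂ e₁ e₂, Models S Γ E₁ →
      Models S Γ E₂ → T.Sem S σ₁ E₁ e₁ → T.Sem S σ₂ E₂ e₂ → T.Rel S σ₁ σ₂ E₁ E₂ e₁ e₂ →
      T'.Rel S σ₁ σ₂ E₁ E₂ e₁ e₂) ?_ ?_ ?_ ?_ ?_ h
  · intro Γ B _ E₁ E₂ e₁ e₂ _ _ _ _ h
    exact h
  · intro Γ T T' r r' hsub hr ih hΓ E₁ E₂ e₁ e₂ hE₁ hE₂ hs₁ hs₂ h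
    rw [BTy.Sem] at hs₁ hs₂
    rw [BTy.Rel] at h ⊢
    obtain ⟨k₁, k₂, k⟩ := h
    refine ⟨fun p => ?_, fun p => ?_, fun p p' => ?_⟩
    · obtain ⟨d, hd, hr⟩ := k₁ (hr _ hE₁ p)
      exact ⟨d, hsub.sem h₂ hΓ _ _ hE₂ hd, ih hΓ _ _ _ _ hE₁ hE₂ hs₁ hd hr⟩
    · obtain ⟨d, hd, hr⟩ := k₂ (hr _ hE₂ p)
      exact ⟨d, hsub.sem h₁ hΓ _ _ hE₁ hd, ih hΓ _ _ _ _ hE₁ hE₂ hd hs₂ hr⟩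
    · exact ih hΓ _ _ _ _ hE₁ hE₂ hs₁ hs₂ (k (hr _ hE₁ p) (hr _ hE₂ p'))
  · intro Γ B B' r r' _ _ ih hΓ E₁ E₂ e₁ e₂ hE₁ hE₂ hs₁ hs₂ h
    rw [Ty.Sem] at hs₁ hs₂
    rw [Ty.Rel] at h ⊢
    exact ih hΓ _ _ _ _ hE₁ hE₂ hs₁.1 hs₂.1 h
  · intro Γ T₁ T₁' T₂ T₂' hsub _ ih₁ ih₂ hΓ E₁ E₂ e₁ e₂ hE₁ hE₂ hs₁ hs₂ h
    rw [Ty.Sem] at hs₁ hs₂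
    rw [Ty.Rel] at h ⊢
    intro d₁ d₂ a₁ a₂ hd₁ hd₂ ha₁ ha₂ hd
    have k₁ := hsub.sem h₁ hΓ _ _ hE₁ hd₁
    have k₂ := hsub.sem h₂ hΓ _ _ hE₂ hd₂
    exact ih₂ (hΓ.cons _) _ _ _ _ (hE₁.cons h₁ hd₁ ha₁) (hE₂.cons h₂ hd₂ ha₂)
      (hs₁.2 _ _ k₁ ha₁) (hs₂.2 _ _ k₂ ha₂)
      (h _ _ _ _ k₁ k₂ ha₁ ha₂ (ih₁ hΓ _ _ _ _ hE₁ hE₂ hd₁ hd₂ hd))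
  · intro Γ T hΓ E₁ E₂ e₁ e₂ hE₁ hE₂ hs₁ hs₂ h
    rw [Ty.tagged, Ty.Rel, BTy.Rel]
    exact ⟨fun _ => ⟨_, hs₂, h⟩, fun _ => ⟨_, hs₁, h⟩, fun _ _ => h⟩

mutual

/-- Storable data with the same value are indistinguishable. -/
theorem BTy.Ground.rel : ∀ {B : BTy User Loc Op} {E₁ E₂ : REnv User Loc Op}
    {e₁ e₂ : Expr User Loc Op} {a : RVal User Loc Op}, B.Ground → B.Sem S σ₁ E₁ e₁ →
    B.Sem S σ₂ E₂ e₂ → HasAbs S σ₁ e₁ a → HasAbs S σ₂ e₂ a → B.Rel S σ₁ σ₂ E₁ E₂ e₁ e₂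
  | .prim p, _, _, _, _, a, _, _, _, h₁, h₂ => by rw [BTy.Rel]; exact ⟨a, h₁, h₂⟩
  | .ref p, _, _, _, _, a, _, _, _, h₁, h₂ => by rw [BTy.Rel]; exact ⟨a, h₁, h₂⟩
  | .tag T pol, _, _, _, _, a, hB, s₁, s₂, h₁, h₂ => by
    rw [BTy.Ground] at hB
    rw [BTy.Sem] at s₁ s₂
    have := Ty.Ground.rel hB s₁ s₂ h₁ h₂
    rw [BTy.Rel]
    exact ⟨fun _ => ⟨_, s₂, this⟩, fun _ => ⟨_, s₁, this⟩, fun _ _ => this⟩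

theorem Ty.Ground.rel : ∀ {T : Ty User Loc Op} {E₁ E₂ : REnv User Loc Op}
    {e₁ e₂ : Expr User Loc Op} {a : RVal User Loc Op}, T.Ground → T.Sem S σ₁ E₁ e₁ →
    T.Sem S σ₂ E₂ e₂ → HasAbs S σ₁ e₁ a → HasAbs S σ₂ e₂ a → T.Rel S σ₁ σ₂ E₁ E₂ e₁ e₂
  | .base B r, _, _, _, _, a, hT, s₁, s₂, h₁, h₂ => by
    rw [Ty.Ground] at hT
    rw [Ty.Sem] at s₁ s₂
    rw [Ty.Rel]
    exact BTy.Ground.rel hT s₁.1 s₂.1 h₁ h₂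
  | .fn T T', _, _, _, _, a, hT, _, _, _, _ => by
    rw [Ty.Ground] at hT
    exact hT.elim

end

end interpretation

/-! ### Well-scopedness of derivable types -/

section regularity

variable {User Loc Op : Type} {S : Sig User Loc Op}

/-- The entries of `Γ` are well-scoped. -/
def CtxWF : Ctx User Loc Op → Prop
  | [] => True
  | .var T :: Γ => T.WF (nvars Γ) true ∧ CtxWF Γ
  | .cond r :: Γ => r.Scoped (nvars Γ) false true false ∧ CtxWF Γ

theorem CtxWF.nuInvariant : ∀ {Γ : Ctx User Loc Op}, CtxWF Γ → NuInvariant S Γ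
  | [], _ => fun _ _ h => h
  | .var T :: _, h => h.2.nuInvariant.cons T
  | .cond _ :: _, h => fun E a hE => ⟨h.2.nuInvariant E a hE.1, (h.1.holds_nu E a).2 hE.2⟩

namespace RTerm

theorem Scoped.mono {n n' : ℕ} {hnu hcur hcur' hpol : Bool} {r : RTerm User Loc Op}
    (h : r.Scoped n hnu hcur hpol) (hn : n ≤ n') (hc : hcur = true → hcur' = true) :
    r.Scoped n' hnu hcur' hpol := by
  induction r with
  | var m => simp only [Scoped] at h ⊢; omega
  | _ => simp_all [Scoped]

theorem Scoped.of_shift {n k : ℕ} {hnu hcur hpol : Bool} {r : RTerm User Loc Op}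
    (h : (r.shift k).Scoped (n + 1) hnu hcur hpol) (hk : k ≤ n) : r.Scoped n hnu hcur hpol := by
  unfold RTerm.shift at h
  induction r with
  | var m => simp only [map] at h; split_ifs at h <;> simp only [Scoped] at h ⊢ <;> omega
  | _ => simp_all [Scoped, map]

theorem Scoped.relax {n : ℕ} {hnu hcur hpol : Bool} {t : RTerm User Loc Op}
    (h : t.Scoped n false false false) : t.Scoped n hnu hcur hpol := by
  induction t <;> simp_all [Scoped]

theorem Scoped.subst {n k : ℕ} {hnu hcur hpol : Bool} {r t : RTerm User Loc Op}
    (h : r.Scoped (n + 1) hnu hcur hpol) (hk : k ≤ n) (ht : t.Scoped n false false false) :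
    (r.subst k t).Scoped n hnu hcur hpol := by
  unfold RTerm.subst
  induction r with
  | var m =>
    simp only [Scoped, map] at h ⊢
    split_ifs
    · simp only [Scoped]; omega
    · exact ht.relax
    · simp only [Scoped]; omega
  | _ => simp_all [Scoped, map]

theorem Scoped.substNu {n : ℕ} {hcur : Bool} {r : RTerm User Loc Op}
    (h : r.Scoped n true hcur false) (d : Datum User Loc) :
    (r.substNu (.const (.datum d))).Scoped n false hcur false := by
  unfold RTerm.substNu
  induction r <;> simp_all [Scoped, map]

end RTerm

mutual

theorem BTy.WF.mono {n n' : ℕ} {h h' : Bool} (hn : n ≤ n') (hh : h = true → h' = true) :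
    ∀ {B : BTy User Loc Op}, B.WF n h → B.WF n' h'
  | .prim p, _ => by rw [BTy.WF]; trivial
  | .tag T pol, k => by
    rw [BTy.WF] at k ⊢
    exact ⟨Ty.WF.mono hn hh k.1, k.2.mono hn hh⟩
  | .ref T, k => by rw [BTy.WF] at k ⊢; exact k

theorem Ty.WF.mono {n n' : ℕ} {h h' : Bool} (hn : n ≤ n') (hh : h = true → h' = true) :
    ∀ {T : Ty User Loc Op}, T.WF n h → T.WF n' h'
  | .base B r, k => by
    rw [Ty.WF] at k ⊢
    exact ⟨BTy.WF.mono hn hh k.1, k.2.mono hn hh⟩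
  | .fn T T', k => by
    rw [Ty.WF] at k ⊢
    exact ⟨Ty.WF.mono hn hh k.1, Ty.WF.mono (Nat.succ_le_succ hn) hh k.2⟩

end

mutual

theorem BTy.WF.shift {n : ℕ} {h : Bool} (k : ℕ) :
    ∀ {B : BTy User Loc Op}, B.WF n h → (B.shift k).WF (n + 1) h
  | .prim p, _ => by rw [BTy.shift, BTy.WF]; trivial
  | .tag T pol, w => by
    rw [BTy.WF] at w
    rw [BTy.shift, BTy.WF]
    exact ⟨Ty.WF.shift k w.1, w.2.shift k⟩
  | .ref T, w => by rw [BTy.WF] at w; rw [BTy.shift, BTy.WF]; exact w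

theorem Ty.WF.shift {n : ℕ} {h : Bool} (k : ℕ) :
    ∀ {T : Ty User Loc Op}, T.WF n h → (T.shift k).WF (n + 1) h
  | .base B r, w => by
    rw [Ty.WF] at w
    rw [Ty.shift, Ty.WF]
    exact ⟨BTy.WF.shift k w.1, w.2.shift k⟩
  | .fn T T', w => by
    rw [Ty.WF] at w
    rw [Ty.shift, Ty.WF]
    exact ⟨Ty.WF.shift k w.1, Ty.WF.shift (k + 1) w.2⟩

end

mutual

theorem BTy.WF.of_shift {n k : ℕ} {h : Bool} (hk : k ≤ n) :
    ∀ {B : BTy User Loc Op}, (B.shift k).WF (n + 1) h → B.WF n h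
  | .prim p, _ => by rw [BTy.WF]; trivial
  | .tag T pol, w => by
    rw [BTy.shift, BTy.WF] at w
    rw [BTy.WF]
    exact ⟨Ty.WF.of_shift hk w.1, w.2.of_shift hk⟩
  | .ref T, w => by rw [BTy.shift, BTy.WF] at w; rw [BTy.WF]; exact w

theorem Ty.WF.of_shift {n k : ℕ} {h : Bool} (hk : k ≤ n) :
    ∀ {T : Ty User Loc Op}, (T.shift k).WF (n + 1) h → T.WF n h
  | .base B r, w => by
    rw [Ty.shift, Ty.WF] at w
    rw [Ty.WF]
    exact ⟨BTy.WF.of_shift hk w.1, w.2.of_shift hk⟩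
  | .fn T T', w => by
    rw [Ty.shift, Ty.WF] at w
    rw [Ty.WF]
    exact ⟨Ty.WF.of_shift hk w.1, Ty.WF.of_shift (Nat.succ_le_succ hk) w.2⟩

end

mutual

theorem BTy.WF.subst {n k : ℕ} {h : Bool} {t : RTerm User Loc Op} (hk : k ≤ n)
    (ht : t.Scoped n false false false) :
    ∀ {B : BTy User Loc Op}, B.WF (n + 1) h → (B.subst k t).WF n h
  | .prim p, _ => by rw [BTy.subst, BTy.WF]; trivial
  | .tag T pol, w => by
    rw [BTy.WF] at w
    rw [BTy.subst, BTy.WF]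
    exact ⟨Ty.WF.subst hk ht w.1, w.2.subst hk ht⟩
  | .ref T, w => by rw [BTy.WF] at w; rw [BTy.subst, BTy.WF]; exact w

theorem Ty.WF.subst {n k : ℕ} {h : Bool} {t : RTerm User Loc Op} (hk : k ≤ n)
    (ht : t.Scoped n false false false) :
    ∀ {T : Ty User Loc Op}, T.WF (n + 1) h → (T.subst k t).WF n h
  | .base B r, w => by
    rw [Ty.WF] at w
    rw [Ty.subst, Ty.WF]
    exact ⟨BTy.WF.subst hk ht w.1, w.2.subst hk ht⟩
  | .fn T T', w => by
    rw [Ty.WF] at w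
    rw [Ty.subst, Ty.WF]
    exact ⟨Ty.WF.subst hk ht w.1, Ty.WF.subst (Nat.succ_le_succ hk) (ht.shift 0) w.2⟩

end

theorem lookup_cond (r : RTerm User Loc Op) (Γ : Ctx User Loc Op) (n : ℕ) :
    lookup (.cond r :: Γ) n = lookup Γ n := by
  cases n <;> rfl

theorem lookup_wf : ∀ {Γ : Ctx User Loc Op} {n : ℕ} {T : Ty User Loc Op}, CtxWF Γ →
    lookup Γ n = some T → T.WF (nvars Γ) true
  | .var _ :: _, 0, _, hΓ, h => by
    simp only [lookup, Option.some.injEq] at h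
    subst h
    exact hΓ.1.shift 0
  | .var _ :: _, n + 1, _, hΓ, h => by
    simp only [lookup, Option.map_eq_some_iff] at h
    obtain ⟨T, h, rfl⟩ := h
    exact (lookup_wf hΓ.2 h).shift 0
  | .cond r :: Γ, n, _, hΓ, h => lookup_wf (Γ := Γ) hΓ.2 (lookup_cond r Γ n ▸ h)

theorem lookup_lt : ∀ {Γ : Ctx User Loc Op} {n : ℕ} {T : Ty User Loc Op},
    lookup Γ n = some T → n < nvars Γ
  | .var _ :: _, 0, _, _ => Nat.succ_pos _
  | .var _ :: _, n + 1, _, h => by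
    simp only [lookup, Option.map_eq_some_iff] at h
    obtain ⟨T, h, rfl⟩ := h
    exact Nat.succ_lt_succ (lookup_lt h)
  | .cond r :: Γ, n, _, h => lookup_lt (Γ := Γ) (lookup_cond r Γ n ▸ h)

theorem Expr.toRTerm_app {e e' : Expr User Loc Op} {t : RTerm User Loc Op}
    (h : (Expr.app e e').toRTerm = some t) :
    e.opSpine = true ∧ ∃ t₁ t₂, e.toRTerm = some t₁ ∧ e'.toRTerm = some t₂ ∧ t = .app t₁ t₂ := by
  simp only [toRTerm] at h
  split_ifs at h with hs
  refine ⟨hs, ?_⟩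
  split at h
  · rename_i t₁ t₂ h₁ h₂
    exact ⟨t₁, t₂, h₁, h₂, (Option.some.inj h).symm⟩
  · cases h

/-- The terms of typed expressions mention program variables in scope only. -/
theorem HasType.toRTerm_scoped {Γ : Ctx User Loc Op} {e : Expr User Loc Op} {T : Ty User Loc Op}
    (h : HasType S Γ e T) {t : RTerm User Loc Op} (ht : e.toRTerm = some t) :
    t.Scoped (nvars Γ) false false false := by
  induction h generalizing t with
  | const => cases ht; trivial
  | var _ _ _ h => cases ht; exact lookup_lt h
  | app_dep _ _ _ _ _ _ _ _ _ ih ih' =>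
    obtain ⟨-, t₁, t₂, h₁, h₂, rfl⟩ := Expr.toRTerm_app ht
    exact ⟨ih h₁, ih' h₂⟩
  | app _ _ _ _ _ _ _ ih ih' =>
    obtain ⟨-, t₁, t₂, h₁, h₂, rfl⟩ := Expr.toRTerm_app ht
    exact ⟨ih h₁, ih' h₂⟩
  | sub _ _ _ _ _ _ _ ih => exact ih ht
  | _ => cases ht

theorem opTy_wf {B : BTy User Loc Op} (ps : List Prim) :
    ∀ {n : ℕ} {t : RTerm User Loc Op}, (∀ n, B.WF n true) → t.Scoped n false false false →
      (opTy B ps t).WF n true := by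
  induction ps with
  | nil =>
    intro n t hB ht
    rw [opTy, Ty.WF]
    exact ⟨hB n, rfl, ht.relax⟩
  | cons p ps ih =>
    intro n t hB ht
    rw [opTy, Ty.WF, Ty.WF, BTy.WF]
    exact ⟨⟨trivial, trivial⟩, ih hB ⟨ht.shift 0, Nat.succ_pos n⟩⟩

theorem Sig.ty_wf (S : Sig User Loc Op) (c : Const User Loc Op) (n : ℕ) : (S.ty c).WF n true := by
  cases c with
  | datum d =>
    rw [Sig.ty, Ty.WF]
    refine ⟨?_, rfl, trivial⟩
    cases d <;> rw [Sig.datumTy, BTy.WF] <;> first | trivial | exact S.locTy_wf _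
  | op f args =>
    refine opTy_wf _ (fun n => ?_) trivial
    have := S.cod_wf f
    cases h : S.cod f with
    | prim p => rw [Cod.toBTy, BTy.WF]; trivial
    | field T => rw [Cod.toBTy, BTy.WF]; exact this T h

theorem Ty.tagged_wf {T : Ty User Loc Op} {pol : RTerm User Loc Op} {n : ℕ} {h : Bool} :
    (T.tagged pol).WF n h ↔ T.WF n h ∧ pol.Scoped n false h true := by
  rw [Ty.tagged, Ty.WF, BTy.WF]
  exact ⟨fun k => k.1, fun k => ⟨k, trivial⟩⟩

theorem Ty.refTo_wf {T : Ty User Loc Op} {n : ℕ} {h : Bool} :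
    (T.refTo).WF n h ↔ T.WF 0 false := by
  rw [Ty.refTo, Ty.WF, BTy.WF]
  exact ⟨fun k => k.1, fun k => ⟨k, trivial⟩⟩

/-- Types of typed expressions are well-scoped. -/
theorem HasType.wf {Γ : Ctx User Loc Op} {e : Expr User Loc Op} {T : Ty User Loc Op}
    (h : HasType S Γ e T) (hΓ : CtxWF Γ) : T.WF (nvars Γ) true := by
  induction h with
  | const Γ c _ => exact S.ty_wf c _
  | var Γ n T h => exact lookup_wf hΓ h
  | lam Γ e T T' hT _ ih => rw [Ty.WF]; exact ⟨hT, ih ⟨hT, hΓ⟩⟩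
  | app_dep Γ e e' T T' t _ h ht ih ih' =>
    have := ih hΓ
    rw [Ty.WF] at this
    exact this.2.subst (Nat.zero_le _) (h.toRTerm_scoped ht)
  | app Γ e e' T T' _ _ ih _ =>
    have := ih hΓ
    rw [Ty.WF] at this
    exact this.2.of_shift (Nat.zero_le _)
  | get Γ e B r t h ht ih =>
    have := Ty.refTo_wf.1 (ih hΓ)
    rw [Ty.WF] at this ⊢
    exact ⟨this.1.mono (Nat.zero_le _) (by simp), this.2.mono (Nat.zero_le _) (by simp),
      rfl, rfl, (h.toRTerm_scoped ht).relax⟩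
  | get_tagged Γ e B r pol t h ht ih =>
    have := Ty.refTo_wf.1 (ih hΓ)
    rw [Ty.WF, BTy.WF, Ty.WF] at this
    rw [Ty.tagged_wf, Ty.WF]
    exact ⟨⟨this.1.1.1.mono (Nat.zero_le _) (by simp),
      this.1.1.2.mono (Nat.zero_le _) (by simp), rfl, rfl, (h.toRTerm_scoped ht).relax⟩,
      this.1.2.mono (Nat.zero_le _) (by simp)⟩
  | ite Γ e e₁ e₂ r T _ _ _ ih ih₁ _ =>
    have := ih hΓ
    rw [Ty.WF] at this
    exact ih₁ ⟨this.2.substNu _, hΓ⟩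
  | bind Γ e₁ e₂ T₁ T₂ pol _ _ _ ih =>
    have := ih hΓ
    rw [Ty.WF] at this
    exact this.2.of_shift (Nat.zero_le _)
  | down Γ e r pol _ ih =>
    have := Ty.tagged_wf.1 (ih hΓ)
    exact Ty.tagged_wf.2 ⟨this.1, this.2.1⟩
  | sub _ _ _ _ _ _ h => exact h
  | cast Γ T T' h h' => rw [Ty.WF]; exact ⟨h, h'.shift 0⟩

end regularity

/-! ### Constants -/

section constants

variable {User Loc Op : Type} {S : Sig User Loc Op} {σ σ₁ σ₂ : Store User Loc Op}

theorem HasAbs.delta {e d : Expr User Loc Op} {f : Op} {args : List (Datum User Loc)}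
    {a : Datum User Loc} (he : HasAbs S σ e (.const (.op f args)))
    (hd : HasAbs S σ d (.const (.datum a))) :
    HasAbs S σ (.app e d) (.const (S.delta f args a)) :=
  hasAbs_const_iff.2 <|
    ((hasAbs_const_iff.1 he).app (hasAbs_const_iff.1 hd)).trans (Par.delta f args a).red

theorem RTerm.Simple.app_var {t : RTerm User Loc Op} (ht : t.Simple) :
    (RTerm.app (t.shift 0) (.var 0)).Simple := by
  obtain ⟨n, ht⟩ := ht
  exact ⟨n + 1, ht.shift 0, Nat.succ_pos n⟩

theorem BTy.sem_cod {f : Op} {args : List (Datum User Loc)}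
    (hargs : List.Forall₂ Datum.HasPrim args (S.dom f)) {e : Expr User Loc Op}
    (he : HasAbs S σ e (.const (.datum (S.sem f args)))) (E : REnv User Loc Op) :
    (S.cod f).toBTy.Sem S σ E e := by
  cases h : S.cod f with
  | prim p =>
    rw [Cod.toBTy, BTy.Sem]
    exact ⟨_, he, S.sem_prim f p args h hargs⟩
  | field T =>
    obtain ⟨l, hl, hT⟩ := S.sem_field f T args h hargs
    rw [Cod.toBTy, BTy.Sem]
    exact ⟨l, hl ▸ he, hT⟩

theorem Sig.delta_last {f : Op} {args : List (Datum User Loc)} (d : Datum User Loc)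
    (h : args.length + 1 = (S.dom f).length) :
    S.delta f args d = .datum (S.sem f (args ++ [d])) := by
  rw [Sig.delta, if_neg (by omega)]

theorem Sig.delta_partial {f : Op} {args : List (Datum User Loc)} (d : Datum User Loc)
    (h : args.length + 1 < (S.dom f).length) : S.delta f args d = .op f (args ++ [d]) := by
  rw [Sig.delta, if_pos h]

theorem sem_opTy (hσ : σ.Data) (f : Op) (p : Prim) (ps : List Prim) :
    ∀ (qs : List Prim) (args : List (Datum User Loc)) (t : RTerm User Loc Op)
    (E : REnv User Loc Op) (e : Expr User Loc Op), S.dom f = qs ++ p :: ps →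
    List.Forall₂ Datum.HasPrim args qs → HasAbs S σ e (.const (.op f args)) → t.Simple →
    t.eval S E = .const (.op f args) → (opTy (S.cod f).toBTy (p :: ps) t).Sem S σ E e := by
  induction ps generalizing p with
  | nil =>
    intro qs args t E e hdom hargs he ht hE
    have hlen := hargs.length_eq
    rw [opTy, opTy, Ty.Sem]
    refine ⟨⟨_, he, .inr ⟨_, _, rfl⟩⟩, fun d a hd ha => ?_⟩
    rw [Ty.Sem, BTy.Sem] at hd
    obtain ⟨⟨b, hb, hp⟩, -⟩ := hd
    obtain rfl := ha.unique hσ hb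
    have hlen' : args.length + 1 = (S.dom f).length := by simp [hdom, hlen]
    have hde := he.delta hb
    rw [Sig.delta_last b hlen'] at hde
    rw [Ty.Sem]
    refine ⟨BTy.sem_cod ?_ hde _, _, hde, ?_⟩
    · rw [hdom]
      exact List.rel_append hargs (.cons hp .nil)
    · rw [RTerm.holds_eq]
      change _ = RVal.app S ((t.shift 0).eval S _) (.const (.datum b))
      rw [(ht.shift 0).eval_nu, RTerm.eval_shift_cons, hE]
      simp [RTerm.eval, RVal.app, Sig.delta_last b hlen']
  | cons p' ps ih =>
    intro qs args t E e hdom hargs he ht hE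
    have hlen := hargs.length_eq
    rw [opTy, Ty.Sem]
    refine ⟨⟨_, he, .inr ⟨_, _, rfl⟩⟩, fun d a hd ha => ?_⟩
    rw [Ty.Sem, BTy.Sem] at hd
    obtain ⟨⟨b, hb, hp⟩, -⟩ := hd
    obtain rfl := ha.unique hσ hb
    have hlen' : args.length + 1 < (S.dom f).length := by simp [hdom, hlen]
    have hde := he.delta hb
    rw [Sig.delta_partial b hlen'] at hde
    refine ih p' (qs ++ [p]) (args ++ [b]) _ _ _ (by simp [hdom])
      (List.rel_append hargs (.cons hp .nil)) hde ht.app_var ?_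
    change RVal.app S ((t.shift 0).eval S _) _ = _
    rw [RTerm.eval_shift_cons, hE, ← Sig.delta_partial b hlen']
    rfl

theorem rel_opTy (h₁ : σ₁.Data) (f : Op) (ps : List Prim) :
    ∀ (c : Const User Loc Op) (t : RTerm User Loc Op)
    (E₁ E₂ : REnv User Loc Op) (e₁ e₂ : Expr User Loc Op),
    (∀ (d : Datum User Loc), c = .datum d → ps = []) →
    (∀ g args, c = .op g args → g = f ∧ args.length + ps.length = (S.dom f).length) →
    HasAbs S σ₁ e₁ (.const c) → HasAbs S σ₂ e₂ (.const c) →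
    (opTy (S.cod f).toBTy ps t).Rel S σ₁ σ₂ E₁ E₂ e₁ e₂ := by
  induction ps with
  | nil =>
    intro c t E₁ E₂ e₁ e₂ _ _ k₁ k₂
    rw [opTy, Ty.Rel]
    cases S.cod f <;> rw [Cod.toBTy, BTy.Rel] <;> exact ⟨_, k₁, k₂⟩
  | cons p ps ih =>
    intro c t E₁ E₂ e₁ e₂ hd ho k₁ k₂
    rw [opTy, Ty.Rel]
    intro d₁ d₂ a₁ a₂ s₁ s₂ ha₁ ha₂ hr
    rw [Ty.Rel, BTy.Rel] at hr
    rw [Ty.Sem, BTy.Sem] at s₁ s₂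
    obtain ⟨a, hr₁, hr₂⟩ := hr
    obtain ⟨⟨b, hb, -⟩, -⟩ := s₁
    obtain rfl := hr₁.unique h₁ hb
    cases c with
    | datum d => simpa using hd d rfl
    | op g args =>
      obtain ⟨rfl, hlen⟩ := ho g args rfl
      refine ih _ _ _ _ _ _ ?_ ?_ (k₁.delta hr₁) (k₂.delta hr₂)
      · intro d h
        unfold Sig.delta at h
        split_ifs at h with hlt
        simp only [List.length_cons] at hlen
        exact List.eq_nil_of_length_eq_zero (by omega)
      · intro g' args' h
        unfold Sig.delta at h
        split_ifs at h with hlt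
        cases h
        refine ⟨rfl, ?_⟩
        simp only [List.length_cons, List.length_append, List.length_nil] at hlen ⊢
        omega

theorem sem_const (hσ : σ.Data) {c : Const User Loc Op} (hc : S.ConstOK c)
    (E : REnv User Loc Op) : (S.ty c).Sem S σ E (.const c) := by
  cases c with
  | datum d =>
    rw [Sig.ty, Ty.Sem]
    refine ⟨?_, _, hasAbs_const _, RTerm.holds_eq.2 rfl⟩
    cases d <;> rw [Sig.datumTy, BTy.Sem] <;> refine ⟨_, hasAbs_const _, ?_⟩ <;>
      trivial
  | op f args =>
    obtain ⟨hlt, hargs⟩ := hc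
    rw [Sig.ty]
    cases h : (S.dom f).drop args.length with
    | nil => rw [List.drop_eq_nil_iff] at h; omega
    | cons p ps =>
      refine sem_opTy hσ f p ps _ args _ E _ ?_ hargs (hasAbs_const _) ⟨0, trivial⟩ rfl
      rw [← h, List.take_append_drop]

theorem rel_const (h₁ : σ₁.Data) {c : Const User Loc Op} (hc : S.ConstOK c)
    (E₁ E₂ : REnv User Loc Op) : (S.ty c).Rel S σ₁ σ₂ E₁ E₂ (.const c) (.const c) := by
  cases c with
  | datum d =>
    rw [Sig.ty, Ty.Rel]
    cases d <;> rw [Sig.datumTy, BTy.Rel] <;> exact ⟨_, hasAbs_const _, hasAbs_const _⟩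
  | op f args =>
    obtain ⟨hlt, hargs⟩ := hc
    rw [Sig.ty]
    refine rel_opTy h₁ f _ (.op f args) _ _ _ _ _ (by simp) ?_ (hasAbs_const _)
      (hasAbs_const _)
    rintro g args' ⟨⟩
    refine ⟨rfl, ?_⟩
    rw [List.length_drop]
    omega

end constants

/-! ### Well-typed stores -/

section stores

variable {User Loc Op : Type} {S : Sig User Loc Op}

/-- Subtyping preserves sorts. -/
theorem Sub.shape {Γ : Ctx User Loc Op} {T T' : Ty User Loc Op} (h : Sub S Γ T T') :
    ∀ a, T.Shape S a → T'.Shape S a := by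
  refine Sub.rec (motive_1 := fun _ B B' _ => ∀ a, B.Shape S a → B'.Shape S a)
    (motive_2 := fun _ T T' _ => ∀ a, T.Shape S a → T'.Shape S a) ?_ ?_ ?_ ?_ ?_ h
  · exact fun _ _ _ h => h
  · intro _ _ _ _ _ _ _ ih a h
    rw [BTy.Shape] at h ⊢
    exact ih a h
  · intro _ _ _ _ _ _ _ ih a h
    rw [Ty.Shape] at h ⊢
    exact ih a h
  · intro _ _ _ _ _ _ _ _ _ a h
    rw [Ty.Shape] at h ⊢
    exact h
  · intro _ _ a h
    rw [Ty.tagged, Ty.Shape, BTy.Shape]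
    exact h

theorem HasType.shape_value {Γ : Ctx User Loc Op} {v : Expr User Loc Op} {T : Ty User Loc Op}
    (h : HasType S Γ v T) (hv : v.IsValue) (hc : v.CastFree) : T.Shape S v.abs := by
  induction h with
  | const Γ c h =>
    cases c with
    | datum d =>
      rw [Sig.ty, Ty.Shape]
      cases d <;> rw [Sig.datumTy, BTy.Shape] <;> refine ⟨_, rfl, ?_⟩ <;> trivial
    | op f args =>
      rw [Sig.ty]
      cases h' : (S.dom f).drop args.length with
      | nil => rw [List.drop_eq_nil_iff] at h'; exact absurd h.1 (by omega)
      | cons p ps => rw [opTy, Ty.Shape]; exact .inr ⟨_, _, rfl⟩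
  | lam => rw [Ty.Shape]; exact .inl rfl
  | sub _ _ _ _ _ h _ ih => exact h.shape _ (ih hv hc)
  | cast => exact hc.elim
  | _ => exact hv.elim

mutual

theorem BTy.Ground.not_closure : ∀ {B : BTy User Loc Op}, B.Ground → ¬ B.Shape S .closure
  | .prim p, _, h => by
    rw [BTy.Shape] at h; obtain ⟨_, h, -⟩ := h; cases h
  | .ref T, _, h => by
    rw [BTy.Shape] at h; obtain ⟨_, h, -⟩ := h; cases h
  | .tag T pol, hB, h => by
    rw [BTy.Ground] at hB
    rw [BTy.Shape] at h
    exact Ty.Ground.not_closure hB h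

theorem Ty.Ground.not_closure : ∀ {T : Ty User Loc Op}, T.Ground → ¬ T.Shape S .closure
  | .base B r, hT, h => by
    rw [Ty.Ground] at hT
    rw [Ty.Shape] at h
    exact BTy.Ground.not_closure hT h
  | .fn T T', hT, _ => by rw [Ty.Ground] at hT; exact hT

end

/-- The properties of well-typed stores that soundness relies on. -/
structure GoodStore (S : Sig User Loc Op) (σ : Store User Loc Op) : Prop where
  data : σ.Data
  shape : S.StoreShape σ.abs
  sem : ∀ l E, E.cur = σ.abs → S.StoreShape E.pstore → (S.locTy l).Sem S σ E (σ.mem l)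

theorem HasType.const_sem {σ : Store User Loc Op} (hσ : σ.Data) {c : Const User Loc Op}
    {T : Ty User Loc Op} (h : HasType S [] (.const c) T) {E : REnv User Loc Op}
    (hE : Models S [] E) : T.Sem S σ E (.const c) := by
  generalize hΓ : ([] : Ctx User Loc Op) = Γ at h
  generalize he : Expr.const c = e at h
  induction h with
  | const Γ c h => exact sem_const hσ h E
  | sub Γ e T T' _ hsub _ ih =>
    subst hΓ
    exact hsub.sem hσ (fun _ _ h => h) _ _ hE (ih rfl he)
  | _ => cases he

theorem WellTyped.good {σ : Store User Loc Op} (h : WellTyped S σ) : GoodStore S σ := by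
  have hshape : S.StoreShape σ.abs := fun l => (h l).2.2.shape_value (h l).1 (h l).2.1
  have hdata : σ.Data := by
    intro l
    have hs : (S.locTy l).Shape S (σ.mem l).abs := hshape l
    have hv := (h l).1
    cases he : σ.mem l with
    | const c => exact ⟨c, rfl⟩
    | lam e =>
      rw [he] at hs
      exact ((S.locTy_ground l).not_closure hs).elim
    | cast => exact ((he ▸ (h l).2.1 : Expr.CastFree (.cast _ _ _))).elim
    | _ => rw [he] at hv; exact hv.elim
  refine ⟨hdata, hshape, fun l E hcur hps => ?_⟩
  obtain ⟨c, hc⟩ := hdata l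
  have ht := (h l).2.2
  rw [hc] at ht ⊢
  exact ht.const_sem hdata ⟨hcur ▸ hshape, hps⟩

end stores

/-! ### Terms denoted by expressions -/

section denotation

variable {User Loc Op : Type} {S : Sig User Loc Op} {σ : Store User Loc Op}

/-- Constants applied to arguments. -/
def Expr.constSpine : Expr User Loc Op → Bool
  | .const _ => true
  | .app e _ => e.constSpine
  | _ => false

theorem Expr.constSpine_inst {e : Expr User Loc Op} (h : e.opSpine = true)
    (γ : ℕ → Expr User Loc Op) : (e.inst γ).constSpine = true := by
  induction e with
  | const c => rfl
  | app e d ih => exact ih h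
  | _ => cases h

theorem Par.constSpine {e e' : Expr User Loc Op} (h : Par S σ e e') (he : e.constSpine = true) :
    e'.constSpine = true := by
  induction h with
  | const => rfl
  | app _ _ ih => exact ih he
  | delta => rfl
  | _ => cases he

theorem Red.app_constSpine_inv {e d v : Expr User Loc Op} (h : Red S σ (.app e d) v)
    (he : e.constSpine = true) (hv : v.IsValue) :
    ∃ f args a, Red S σ e (.const (.op f args)) ∧ Red S σ d (.const (.datum a)) ∧
      v = .const (S.delta f args a) := by
  generalize hx : Expr.app e d = x at h
  induction h using Relation.ReflTransGen.head_induction_on generalizing e d with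
  | refl => subst hx; exact hv.elim
  | head hp hr ih =>
    subst hx
    cases hp with
    | app p q =>
      obtain ⟨f, args, a, k₁, k₂, rfl⟩ := ih (p.constSpine he) rfl
      exact ⟨f, args, a, .head p k₁, .head q k₂, rfl⟩
    | beta => cases he
    | delta f args a =>
      refine ⟨f, args, a, .refl, .refl, ?_⟩
      have k := Red.of_value hr (v := .const (S.delta f args a)) trivial
      cases v <;> simp_all [Expr.abs, Expr.IsValue]

/-- The term denoted by an expression gives its logical value. -/
theorem HasAbs.eq_eval {Γ : Ctx User Loc Op} {γ : ℕ → Expr User Loc Op} {E : REnv User Loc Op}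
    (hσ : σ.Data) (hγ : ∀ n < nvars Γ, HasAbs S σ (γ n) (E.var n)) {e : Expr User Loc Op} :
    ∀ {t : RTerm User Loc Op} {a : RVal User Loc Op}, e.toRTerm = some t →
      t.Scoped (nvars Γ) false false false → HasAbs S σ (e.inst γ) a → a = t.eval S E := by
  induction e with
  | const c =>
    intro t a ht _ ha
    cases ht
    exact ha.unique hσ (hasAbs_const c)
  | var n =>
    intro t a ht hs ha
    cases ht
    exact ha.unique hσ (hγ n hs)
  | app e d ih ih' =>
    intro t a ht hs ha
    obtain ⟨hop, t₁, t₂, h₁, h₂, rfl⟩ := Expr.toRTerm_app ht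
    obtain ⟨v, hr, hv, rfl⟩ := ha
    obtain ⟨f, args, b, k₁, k₂, rfl⟩ := Red.app_constSpine_inv hr (Expr.constSpine_inst hop γ) hv
    have e₁ := ih h₁ hs.1 (hasAbs_const_iff.2 k₁)
    have e₂ := ih' h₂ hs.2 (hasAbs_const_iff.2 k₂)
    simp only [RTerm.eval, ← e₁, ← e₂]
    rfl
  | _ => intro t a ht; cases ht

end denotation

/-! ### Semantic typing -/

section semantic

variable {User Loc Op : Type} {S : Sig User Loc Op}

/-- A run: the store of an execution, together with the store and the user at which policies
are evaluated. -/
structure Run (S : Sig User Loc Op) where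
  store : Store User Loc Op
  pstore : Loc → RVal User Loc Op
  puser : User
  good : GoodStore S store
  shape : S.StoreShape pstore

/-- The current store and the policy variables have the values that the run prescribes. -/
def Run.Env (ρ : Run S) (E : REnv User Loc Op) : Prop :=
  E.cur = ρ.store.abs ∧ E.pstore = ρ.pstore ∧ E.puser = ρ.puser

/-- Locations that are visible in one of two runs have the same content in both. -/
def Similar (ρ₁ ρ₂ : Run S) : Prop :=
  ∀ l E₁ E₂, ρ₁.Env E₁ → ρ₂.Env E₂ →
    ((S.locTy l).pol.Holds S E₁ ∨ (S.locTy l).pol.Holds S E₂) →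
    ρ₁.store.mem l = ρ₂.store.mem l

/-- The substitution `γ` with valuation `E` realizes the environment `Γ`. -/
def Realizes (ρ : Run S) : Ctx User Loc Op → (ℕ → Expr User Loc Op) → REnv User Loc Op → Prop
  | [], _, E => ρ.Env E
  | .var T :: Γ, γ, E => Realizes ρ Γ (fun n => γ (n + 1)) E.tail ∧
      T.Sem S ρ.store E.tail (γ 0) ∧ HasAbs S ρ.store (γ 0) (E.var 0)
  | .cond r :: Γ, γ, E => Realizes ρ Γ γ E ∧ r.Holds S E

/-- The expressions that two substitutions assign to a variable are indistinguishable. -/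
def RelatedSubst (ρ₁ ρ₂ : Run S) : Ctx User Loc Op → (ℕ → Expr User Loc Op) →
    (ℕ → Expr User Loc Op) → REnv User Loc Op → REnv User Loc Op → Prop
  | [], _, _, _, _ => True
  | .var T :: Γ, γ₁, γ₂, E₁, E₂ =>
      RelatedSubst ρ₁ ρ₂ Γ (fun n => γ₁ (n + 1)) (fun n => γ₂ (n + 1)) E₁.tail E₂.tail ∧
      T.Rel S ρ₁.store ρ₂.store E₁.tail E₂.tail (γ₁ 0) (γ₂ 0)
  | .cond _ :: Γ, γ₁, γ₂, E₁, E₂ => RelatedSubst ρ₁ ρ₂ Γ γ₁ γ₂ E₁ E₂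

/-- Two realizations of `Γ` in similar runs with indistinguishable expressions. -/
structure Pair (Γ : Ctx User Loc Op) (ρ₁ ρ₂ : Run S) (γ₁ γ₂ : ℕ → Expr User Loc Op)
    (E₁ E₂ : REnv User Loc Op) : Prop where
  similar : Similar ρ₁ ρ₂
  left : Realizes ρ₁ Γ γ₁ E₁
  right : Realizes ρ₂ Γ γ₂ E₂
  related : RelatedSubst ρ₁ ρ₂ Γ γ₁ γ₂ E₁ E₂

/-- Semantic typing: `e` behaves as an element of `T`, and does not distinguish
indistinguishable realizations of `Γ`. -/
structure SemTyped (S : Sig User Loc Op) (Γ : Ctx User Loc Op) (e : Expr User Loc Op)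
    (T : Ty User Loc Op) : Prop where
  sem : ∀ (ρ : Run S) γ E, Realizes ρ Γ γ E → T.Sem S ρ.store E (e.inst γ)
  rel : ∀ (ρ₁ ρ₂ : Run S) γ₁ γ₂ E₁ E₂, Pair Γ ρ₁ ρ₂ γ₁ γ₂ E₁ E₂ →
    T.Rel S ρ₁.store ρ₂.store E₁ E₂ (e.inst γ₁) (e.inst γ₂)

namespace Realizes

variable {ρ : Run S}

theorem env : ∀ {Γ : Ctx User Loc Op} {γ : ℕ → Expr User Loc Op} {E : REnv User Loc Op},
    Realizes ρ Γ γ E → ρ.Env E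
  | [], _, _, h => h
  | .var _ :: Γ, _, _, h => have k := env (Γ := Γ) h.1; ⟨k.1, k.2.1, k.2.2⟩
  | .cond _ :: Γ, _, _, h => env (Γ := Γ) h.1

theorem models : ∀ {Γ : Ctx User Loc Op} {γ : ℕ → Expr User Loc Op} {E : REnv User Loc Op},
    Realizes ρ Γ γ E → Models S Γ E
  | [], _, _, h => ⟨h.1 ▸ ρ.good.shape, h.2.1 ▸ ρ.shape⟩
  | .var _ :: Γ, _, _, h => ⟨models (Γ := Γ) h.1, h.2.1.shape ρ.good.data h.2.2,
      h.2.1.assumption ρ.good.data h.2.2⟩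
  | .cond _ :: Γ, _, _, h => ⟨models (Γ := Γ) h.1, h.2⟩

theorem cons {Γ : Ctx User Loc Op} {γ : ℕ → Expr User Loc Op} {E : REnv User Loc Op}
    (h : Realizes ρ Γ γ E) {T : Ty User Loc Op} {d : Expr User Loc Op} {a : RVal User Loc Op}
    (hd : T.Sem S ρ.store E d) (ha : HasAbs S ρ.store d a) :
    Realizes ρ (.var T :: Γ) (Expr.scons d γ) (E.cons a) :=
  ⟨h, hd, ha⟩

theorem hasAbs : ∀ {Γ : Ctx User Loc Op} {γ : ℕ → Expr User Loc Op} {E : REnv User Loc Op},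
    Realizes ρ Γ γ E → ∀ n < nvars Γ, HasAbs S ρ.store (γ n) (E.var n)
  | .var _ :: _, _, _, h, 0, _ => h.2.2
  | .var _ :: Γ, _, _, h, n + 1, hn => hasAbs (Γ := Γ) h.1 n (Nat.lt_of_succ_lt_succ hn)
  | .cond _ :: Γ, _, _, h, n, hn => hasAbs (Γ := Γ) h.1 n hn

theorem lookup : ∀ {Γ : Ctx User Loc Op} {γ : ℕ → Expr User Loc Op} {E : REnv User Loc Op},
    Realizes ρ Γ γ E → ∀ {n T}, lookup Γ n = some T → T.Sem S ρ.store E (γ n)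
  | .var _ :: _, _, E, h, 0, _, hl => by
    simp only [Lifty.lookup, Option.some.injEq] at hl
    subst hl
    rw [Ty.sem_shift, REnv.drop_zero]
    exact h.2.1
  | .var _ :: Γ, _, _, h, n + 1, _, hl => by
    simp only [Lifty.lookup, Option.map_eq_some_iff] at hl
    obtain ⟨T, hl, rfl⟩ := hl
    rw [Ty.sem_shift, REnv.drop_zero]
    exact lookup (Γ := Γ) h.1 hl
  | .cond r :: Γ, _, _, h, n, _, hl => lookup (Γ := Γ) h.1 (lookup_cond r Γ n ▸ hl)

theorem eq_eval {Γ : Ctx User Loc Op} {γ : ℕ → Expr User Loc Op} {E : REnv User Loc Op}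
    (h : Realizes ρ Γ γ E) {e : Expr User Loc Op} {t : RTerm User Loc Op} {a : RVal User Loc Op}
    (ht : e.toRTerm = some t) (hs : t.Scoped (nvars Γ) false false false)
    (ha : HasAbs S ρ.store (e.inst γ) a) : a = t.eval S E :=
  ha.eq_eval ρ.good.data h.hasAbs ht hs

end Realizes

theorem RelatedSubst.lookup {ρ₁ ρ₂ : Run S} : ∀ {Γ : Ctx User Loc Op}
    {γ₁ γ₂ : ℕ → Expr User Loc Op} {E₁ E₂ : REnv User Loc Op}, RelatedSubst ρ₁ ρ₂ Γ γ₁ γ₂ E₁ E₂ →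
    ∀ {n T}, lookup Γ n = some T → T.Rel S ρ₁.store ρ₂.store E₁ E₂ (γ₁ n) (γ₂ n)
  | .var _ :: _, _, _, _, _, h, 0, _, hl => by
    simp only [Lifty.lookup, Option.some.injEq] at hl
    subst hl
    rw [Ty.rel_shift, REnv.drop_zero, REnv.drop_zero]
    exact h.2
  | .var _ :: Γ, _, _, _, _, h, n + 1, _, hl => by
    simp only [Lifty.lookup, Option.map_eq_some_iff] at hl
    obtain ⟨T, hl, rfl⟩ := hl
    rw [Ty.rel_shift, REnv.drop_zero, REnv.drop_zero]
    exact lookup (Γ := Γ) h.1 hl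
  | .cond r :: Γ, _, _, _, _, h, n, _, hl => lookup (Γ := Γ) h (lookup_cond r Γ n ▸ hl)

namespace Pair

variable {Γ : Ctx User Loc Op} {ρ₁ ρ₂ : Run S} {γ₁ γ₂ : ℕ → Expr User Loc Op}
  {E₁ E₂ : REnv User Loc Op}

theorem cons (h : Pair Γ ρ₁ ρ₂ γ₁ γ₂ E₁ E₂) {T : Ty User Loc Op} {d₁ d₂ : Expr User Loc Op}
    {a₁ a₂ : RVal User Loc Op} (hd₁ : T.Sem S ρ₁.store E₁ d₁) (hd₂ : T.Sem S ρ₂.store E₂ d₂)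
    (ha₁ : HasAbs S ρ₁.store d₁ a₁) (ha₂ : HasAbs S ρ₂.store d₂ a₂)
    (hd : T.Rel S ρ₁.store ρ₂.store E₁ E₂ d₁ d₂) :
    Pair (.var T :: Γ) ρ₁ ρ₂ (Expr.scons d₁ γ₁) (Expr.scons d₂ γ₂) (E₁.cons a₁) (E₂.cons a₂) :=
  ⟨h.similar, h.left.cons hd₁ ha₁, h.right.cons hd₂ ha₂, h.related, hd⟩

theorem cond (h : Pair Γ ρ₁ ρ₂ γ₁ γ₂ E₁ E₂) {r : RTerm User Loc Op} (h₁ : r.Holds S E₁)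
    (h₂ : r.Holds S E₂) : Pair (.cond r :: Γ) ρ₁ ρ₂ γ₁ γ₂ E₁ E₂ :=
  ⟨h.similar, ⟨h.left, h₁⟩, ⟨h.right, h₂⟩, h.related⟩

end Pair

theorem Ty.sem_tagged {σ : Store User Loc Op} {T : Ty User Loc Op} {pol : RTerm User Loc Op}
    {E : REnv User Loc Op} {e : Expr User Loc Op} :
    (T.tagged pol).Sem S σ E e ↔ T.Sem S σ E e := by
  rw [Ty.tagged, Ty.Sem, BTy.Sem]
  refine ⟨fun h => h.1, fun h => ⟨h, ?_⟩⟩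
  obtain ⟨a, ha⟩ := h.hasAbs
  exact ⟨a, ha, rfl⟩

theorem Ty.rel_tagged {σ₁ σ₂ : Store User Loc Op} {T : Ty User Loc Op}
    {pol : RTerm User Loc Op} {E₁ E₂ : REnv User Loc Op} {e₁ e₂ : Expr User Loc Op} :
    (T.tagged pol).Rel S σ₁ σ₂ E₁ E₂ e₁ e₂ ↔
      (pol.Holds S E₁ → ∃ d₂, T.Sem S σ₂ E₂ d₂ ∧ T.Rel S σ₁ σ₂ E₁ E₂ e₁ d₂) ∧
      (pol.Holds S E₂ → ∃ d₁, T.Sem S σ₁ E₁ d₁ ∧ T.Rel S σ₁ σ₂ E₁ E₂ d₁ e₂) ∧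
      (pol.Holds S E₁ → pol.Holds S E₂ → T.Rel S σ₁ σ₂ E₁ E₂ e₁ e₂) := by
  rw [Ty.tagged, Ty.Rel, BTy.Rel]

theorem Ty.sem_refTo {σ : Store User Loc Op} {T : Ty User Loc Op} {E : REnv User Loc Op}
    {e : Expr User Loc Op} (h : T.refTo.Sem S σ E e) :
    ∃ l, HasAbs S σ e (.const (.datum (.loc l))) ∧ S.locTy l = T := by
  rw [Ty.refTo, Ty.Sem, BTy.Sem] at h
  exact h.1

theorem Ty.rel_refTo {σ₁ σ₂ : Store User Loc Op} (h₁ : σ₁.Data)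
    {T : Ty User Loc Op} {E₁ E₂ : REnv User Loc Op} {e₁ e₂ : Expr User Loc Op}
    (k₁ : T.refTo.Sem S σ₁ E₁ e₁) (h : T.refTo.Rel S σ₁ σ₂ E₁ E₂ e₁ e₂) :
    ∃ l, HasAbs S σ₁ e₁ (.const (.datum (.loc l))) ∧
      HasAbs S σ₂ e₂ (.const (.datum (.loc l))) ∧ S.locTy l = T := by
  obtain ⟨l, hl, hT⟩ := Ty.sem_refTo k₁
  rw [Ty.refTo, Ty.Rel, BTy.Rel] at h
  obtain ⟨a, ha₁, ha₂⟩ := h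
  obtain rfl := ha₁.unique h₁ hl
  exact ⟨l, hl, ha₂, hT⟩

theorem HasAbs.read {σ : Store User Loc Op} {e : Expr User Loc Op} {l : Loc}
    (h : HasAbs S σ e (.const (.datum (.loc l)))) : Red S σ (.get e) (σ.mem l) :=
  (hasAbs_const_iff.1 h).get.trans (Par.read l).red

theorem Store.Data.hasAbs {σ : Store User Loc Op} (hσ : σ.Data) (l : Loc) :
    HasAbs S σ (σ.mem l) (σ.abs l) := by
  obtain ⟨c, hc⟩ := hσ l
  simp only [Store.abs, hc]
  exact hasAbs_const c

/-- The refinement that `get` adds to a content type. -/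
theorem Ty.sem_get {ρ : Run S} {E : REnv User Loc Op} (hE : ρ.Env E) {l : Loc}
    {B : BTy User Loc Op} {r t : RTerm User Loc Op} {e : Expr User Loc Op} (ht : t.Simple)
    (hl : t.eval S E = .const (.datum (.loc l))) (he : Red S ρ.store e (ρ.store.mem l))
    (h : Ty.Sem S ρ.store (.base B r) E (ρ.store.mem l)) :
    Ty.Sem S ρ.store (.base B (.and r (.eq .nu (.sel .cur t)))) E e := by
  rw [Ty.Sem] at h ⊢
  obtain ⟨hB, a, ha, hr⟩ := h
  refine ⟨(BTy.sem_red ρ.good.data B E he).2 hB, a, ha.expand he, RTerm.holds_and.2 ⟨hr, ?_⟩⟩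
  rw [RTerm.holds_eq]
  simp only [RTerm.eval]
  rw [ht.eval_nu, hl, hE.1, ha.unique ρ.good.data (ρ.good.data.hasAbs l)]
  rfl

theorem Run.env_sem {ρ : Run S} {E : REnv User Loc Op} (hE : ρ.Env E) (l : Loc) :
    (S.locTy l).Sem S ρ.store E (ρ.store.mem l) :=
  ρ.good.sem l E hE.1 (hE.2.1 ▸ ρ.shape)

theorem Ty.sem_implies {σ : Store User Loc Op} (hσ : σ.Data) {n : ℕ} {hcur hpol : Bool}
    {r : RTerm User Loc Op} (hr : r.Scoped n false hcur hpol) {E : REnv User Loc Op}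
    {e : Expr User Loc Op} :
    (Ty.base (.prim .bool) (.imp .nu r)).Sem S σ E e ↔
      ∃ b, HasAbs S σ e (.const (.datum (.bool b))) ∧ (b = true → r.Holds S E) := by
  rw [Ty.Sem, BTy.Sem]
  simp only [RTerm.holds_imp, RTerm.holds_nu_iff, hr.holds_nu]
  constructor
  · rintro ⟨⟨d, hd, hp⟩, a, ha, h⟩
    cases d with
    | bool b =>
      refine ⟨b, hd, fun hb => h ?_⟩
      rw [ha.unique hσ hd, hb]
    | _ => exact hp.elim
  · rintro ⟨b, hb, h⟩
    exact ⟨⟨_, hb, trivial⟩, _, hb, fun k => h (by simpa using k)⟩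

theorem Ty.rel_implies {σ₁ σ₂ : Store User Loc Op} {p : Prim} {r : RTerm User Loc Op}
    {E₁ E₂ : REnv User Loc Op} {e₁ e₂ : Expr User Loc Op} :
    (Ty.base (.prim p) r).Rel S σ₁ σ₂ E₁ E₂ e₁ e₂ ↔
      ∃ a, HasAbs S σ₁ e₁ a ∧ HasAbs S σ₂ e₂ a := by
  rw [Ty.Rel, BTy.Rel]

namespace SemTyped

variable {Γ : Ctx User Loc Op}

theorem const (Γ : Ctx User Loc Op) {c : Const User Loc Op} (hc : S.ConstOK c) :
    SemTyped S Γ (.const c) (S.ty c) :=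
  ⟨fun ρ _ E _ => sem_const ρ.good.data hc E,
    fun ρ₁ _ _ _ E₁ E₂ _ => rel_const ρ₁.good.data hc E₁ E₂⟩

theorem var {n : ℕ} {T : Ty User Loc Op} (h : lookup Γ n = some T) : SemTyped S Γ (.var n) T :=
  ⟨fun _ _ _ hγ => hγ.lookup h, fun _ _ _ _ _ _ hγ => hγ.related.lookup h⟩

theorem beta_red {σ : Store User Loc Op} (e d : Expr User Loc Op) (γ : ℕ → Expr User Loc Op) :
    Red S σ (.app ((Expr.lam e).inst γ) d) (e.inst (Expr.scons d γ)) := by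
  have := (Par.beta (S := S) (σ := σ) (.refl (e.inst (Expr.up γ))) (.refl d)).red
  rwa [Expr.inst_up_subst] at this

theorem lam {e : Expr User Loc Op} {T T' : Ty User Loc Op} (h : SemTyped S (.var T :: Γ) e T') :
    SemTyped S Γ (.lam e) (.fn T T') := by
  constructor
  · intro ρ γ E hγ
    rw [Ty.Sem]
    refine ⟨⟨_, hasAbs_value (v := (Expr.lam e).inst γ) trivial, .inl rfl⟩, fun d a hd ha => ?_⟩
    rw [Ty.sem_red ρ.good.data T' _ (beta_red e d γ)]
    exact h.sem ρ _ _ (hγ.cons hd ha)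
  · intro ρ₁ ρ₂ γ₁ γ₂ E₁ E₂ hγ
    rw [Ty.Rel]
    intro d₁ d₂ a₁ a₂ hd₁ hd₂ ha₁ ha₂ hd
    rw [Ty.rel_red ρ₁.good.data ρ₂.good.data T' _ _ (beta_red e d₁ γ₁) (beta_red e d₂ γ₂)]
    exact h.rel ρ₁ ρ₂ _ _ _ _ (hγ.cons hd₁ hd₂ ha₁ ha₂ hd)

theorem app_fn {σ : Store User Loc Op} {e d : Expr User Loc Op} {T T' : Ty User Loc Op}
    {E : REnv User Loc Op} {a : RVal User Loc Op} (he : (Ty.fn T T').Sem S σ E e)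
    (hd : T.Sem S σ E d) (ha : HasAbs S σ d a) : T'.Sem S σ (E.cons a) (.app e d) := by
  rw [Ty.Sem] at he
  exact he.2 d a hd ha

theorem app_shift {σ : Store User Loc Op} {e d : Expr User Loc Op} {T T' : Ty User Loc Op}
    {E : REnv User Loc Op} (he : (Ty.fn T (T'.shift 0)).Sem S σ E e)
    (hd : T.Sem S σ E d) : T'.Sem S σ E (.app e d) := by
  obtain ⟨a, ha⟩ := hd.hasAbs
  have := app_fn he hd ha
  rwa [Ty.sem_shift, REnv.drop_zero_cons] at this

theorem rel_app_shift {σ₁ σ₂ : Store User Loc Op} {e₁ e₂ d₁ d₂ : Expr User Loc Op}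
    {T T' : Ty User Loc Op} {E₁ E₂ : REnv User Loc Op}
    (he : (Ty.fn T (T'.shift 0)).Rel S σ₁ σ₂ E₁ E₂ e₁ e₂) (hd₁ : T.Sem S σ₁ E₁ d₁)
    (hd₂ : T.Sem S σ₂ E₂ d₂) (hd : T.Rel S σ₁ σ₂ E₁ E₂ d₁ d₂) :
    T'.Rel S σ₁ σ₂ E₁ E₂ (.app e₁ d₁) (.app e₂ d₂) := by
  obtain ⟨a₁, ha₁⟩ := hd₁.hasAbs
  obtain ⟨a₂, ha₂⟩ := hd₂.hasAbs
  rw [Ty.Rel] at he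
  have := he _ _ _ _ hd₁ hd₂ ha₁ ha₂ hd
  rwa [Ty.rel_shift, REnv.drop_zero_cons, REnv.drop_zero_cons] at this

theorem app {e d : Expr User Loc Op} {T T' : Ty User Loc Op}
    (he : SemTyped S Γ e (.fn T (T'.shift 0))) (hd : SemTyped S Γ d T) :
    SemTyped S Γ (.app e d) T' :=
  ⟨fun ρ _ _ hγ => app_shift (he.sem ρ _ _ hγ) (hd.sem ρ _ _ hγ),
    fun ρ₁ ρ₂ _ _ _ _ hγ => rel_app_shift (he.rel ρ₁ ρ₂ _ _ _ _ hγ) (hd.sem ρ₁ _ _ hγ.left)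
      (hd.sem ρ₂ _ _ hγ.right) (hd.rel ρ₁ ρ₂ _ _ _ _ hγ)⟩

theorem app_dep {e d : Expr User Loc Op} {T T' : Ty User Loc Op} {t : RTerm User Loc Op}
    (he : SemTyped S Γ e (.fn T T')) (hd : SemTyped S Γ d T) (ht : d.toRTerm = some t)
    (hs : t.Scoped (nvars Γ) false false false) : SemTyped S Γ (.app e d) (T'.subst 0 t) := by
  constructor
  · intro ρ γ E hγ
    have k := hd.sem ρ _ _ hγ
    obtain ⟨a, ha⟩ := k.hasAbs
    rw [Ty.sem_subst T' 0 ⟨_, hs⟩, REnv.insert_zero, ← hγ.eq_eval ht hs ha]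
    exact app_fn (he.sem ρ _ _ hγ) k ha
  · intro ρ₁ ρ₂ γ₁ γ₂ E₁ E₂ hγ
    have k₁ := hd.sem ρ₁ _ _ hγ.left
    have k₂ := hd.sem ρ₂ _ _ hγ.right
    obtain ⟨a₁, ha₁⟩ := k₁.hasAbs
    obtain ⟨a₂, ha₂⟩ := k₂.hasAbs
    rw [Ty.rel_subst T' 0 ⟨_, hs⟩, REnv.insert_zero, REnv.insert_zero,
      ← hγ.left.eq_eval ht hs ha₁, ← hγ.right.eq_eval ht hs ha₂]
    have := he.rel ρ₁ ρ₂ _ _ _ _ hγ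
    rw [Ty.Rel] at this
    exact this _ _ _ _ k₁ k₂ ha₁ ha₂ (hd.rel ρ₁ ρ₂ _ _ _ _ hγ)

theorem get {e : Expr User Loc Op} {B : BTy User Loc Op} {r t : RTerm User Loc Op}
    (h : SemTyped S Γ e (Ty.refTo (.base B r))) (ht : e.toRTerm = some t)
    (hs : t.Scoped (nvars Γ) false false false) :
    SemTyped S Γ (.get e) (.base B (.and r (.eq .nu (.sel .cur t)))) := by
  constructor
  · intro ρ γ E hγ
    obtain ⟨l, hl, hT⟩ := Ty.sem_refTo (h.sem ρ _ _ hγ)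
    exact Ty.sem_get hγ.env ⟨_, hs⟩ (hγ.eq_eval ht hs hl).symm hl.read
      (hT ▸ Run.env_sem hγ.env l)
  · intro ρ₁ ρ₂ γ₁ γ₂ E₁ E₂ hγ
    obtain ⟨l, hl₁, hl₂, hT⟩ := Ty.rel_refTo ρ₁.good.data
      (h.sem ρ₁ _ _ hγ.left) (h.rel ρ₁ ρ₂ _ _ _ _ hγ)
    rw [Ty.Rel]
    change B.Rel S _ _ _ _ (.get (e.inst γ₁)) (.get (e.inst γ₂))
    rw [BTy.rel_red ρ₁.good.data ρ₂.good.data B _ _ hl₁.read hl₂.read]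
    have s₁ := Run.env_sem hγ.left.env l
    have s₂ := Run.env_sem hγ.right.env l
    have hsim := hγ.similar l _ _ hγ.left.env hγ.right.env
    have hg := S.locTy_ground l
    have a₁ := ρ₁.good.data.hasAbs (S := S) l
    have a₂ := ρ₂.good.data.hasAbs (S := S) l
    rw [hT] at s₁ s₂ hsim hg
    rw [Ty.Sem] at s₁ s₂
    rw [Ty.Ground] at hg
    have key : (Ty.pol (.base B r)).Holds S E₁ ∨ (Ty.pol (.base B r)).Holds S E₂ →
        B.Rel S ρ₁.store ρ₂.store E₁ E₂ (ρ₁.store.mem l) (ρ₂.store.mem l) := by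
      intro k
      refine hg.rel s₁.1 s₂.1 a₁ ?_
      rw [Store.abs, hsim k]
      exact a₂
    cases B with
    | prim p => exact key (.inl rfl)
    | ref T => exact key (.inl rfl)
    | tag T pol =>
      rw [BTy.Rel] at key ⊢
      exact ⟨fun k => (key (.inl k)).1 k, fun k => (key (.inr k)).2.1 k,
        fun k k' => (key (.inl k)).2.2 k k'⟩

theorem get_tagged {e : Expr User Loc Op} {B : BTy User Loc Op} {r pol t : RTerm User Loc Op}
    (h : SemTyped S Γ e (Ty.refTo (.base (.tag (.base B r) pol) RTerm.top)))
    (ht : e.toRTerm = some t) (hs : t.Scoped (nvars Γ) false false false) :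
    SemTyped S Γ (.get e) (Ty.tagged (.base B (.and r (.eq .nu (.sel .cur t)))) pol) := by
  have hsem : ∀ (ρ : Run S) γ E, Realizes ρ Γ γ E →
      Ty.Sem S ρ.store (.base B (.and r (.eq .nu (.sel .cur t)))) E ((Expr.get e).inst γ) := by
    intro ρ γ E hγ
    obtain ⟨l, hl, hT⟩ := Ty.sem_refTo (h.sem ρ _ _ hγ)
    exact Ty.sem_get hγ.env ⟨_, hs⟩ (hγ.eq_eval ht hs hl).symm hl.read
      (Ty.sem_tagged.1 (hT ▸ Run.env_sem hγ.env l))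
  refine ⟨fun ρ γ E hγ => Ty.sem_tagged.2 (hsem ρ γ E hγ), ?_⟩
  intro ρ₁ ρ₂ γ₁ γ₂ E₁ E₂ hγ
  obtain ⟨l, hl₁, hl₂, hT⟩ := Ty.rel_refTo ρ₁.good.data
    (h.sem ρ₁ _ _ hγ.left) (h.rel ρ₁ ρ₂ _ _ _ _ hγ)
  have hsim := hγ.similar l _ _ hγ.left.env hγ.right.env
  have hg := S.locTy_ground l
  rw [hT] at hsim hg
  rw [Ty.Ground, BTy.Ground, Ty.Ground] at hg
  have s₁ := hsem ρ₁ _ _ hγ.left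
  have s₂ := hsem ρ₂ _ _ hγ.right
  have key : pol.Holds S E₁ ∨ pol.Holds S E₂ →
      Ty.Rel S ρ₁.store ρ₂.store (.base B (.and r (.eq .nu (.sel .cur t)))) E₁ E₂
        ((Expr.get e).inst γ₁) ((Expr.get e).inst γ₂) := by
    intro k
    refine Ty.Ground.rel (by rw [Ty.Ground]; exact hg) s₁ s₂
      ((ρ₁.good.data.hasAbs l).expand hl₁.read) ?_
    rw [Store.abs, hsim k]
    exact (ρ₂.good.data.hasAbs l).expand hl₂.read
  rw [Ty.rel_tagged]
  exact ⟨fun k => ⟨_, s₂, key (.inl k)⟩, fun k => ⟨_, s₁, key (.inr k)⟩,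
    fun k _ => key (.inl k)⟩

theorem bool_cases {σ : Store User Loc Op} (hσ : σ.Data) {r : RTerm User Loc Op}
    {E : REnv User Loc Op} {e : Expr User Loc Op} (h : (Ty.base (.prim .bool) r).Sem S σ E e) :
    (HasAbs S σ e (.const (.datum (.bool true))) ∧ (r.substNu RTerm.top).Holds S E) ∨
    (HasAbs S σ e (.const (.datum (.bool false))) ∧ (r.substNu RTerm.bot).Holds S E) := by
  rw [Ty.Sem, BTy.Sem] at h
  obtain ⟨⟨d, hd, hp⟩, a, ha, hr⟩ := h
  obtain rfl := ha.unique hσ hd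
  cases d with
  | bool b =>
    cases b
    · exact .inr ⟨hd, (RTerm.holds_substNu _ _ _).2 hr⟩
    · exact .inl ⟨hd, (RTerm.holds_substNu _ _ _).2 hr⟩
  | _ => exact hp.elim

theorem ite_red_true {σ : Store User Loc Op} {e : Expr User Loc Op}
    (h : HasAbs S σ e (.const (.datum (.bool true)))) (e₁ e₂ : Expr User Loc Op) :
    Red S σ (.ite e e₁ e₂) e₁ :=
  ((hasAbs_const_iff.1 h).ite _ _).trans (Par.ite_true _ (.refl _)).red

theorem ite_red_false {σ : Store User Loc Op} {e : Expr User Loc Op}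
    (h : HasAbs S σ e (.const (.datum (.bool false)))) (e₁ e₂ : Expr User Loc Op) :
    Red S σ (.ite e e₁ e₂) e₂ :=
  ((hasAbs_const_iff.1 h).ite _ _).trans (Par.ite_false _ (.refl _)).red

theorem ite {e e₁ e₂ : Expr User Loc Op} {r : RTerm User Loc Op} {T : Ty User Loc Op}
    (h : SemTyped S Γ e (.base (.prim .bool) r))
    (h₁ : SemTyped S (.cond (r.substNu RTerm.top) :: Γ) e₁ T)
    (h₂ : SemTyped S (.cond (r.substNu RTerm.bot) :: Γ) e₂ T) : SemTyped S Γ (.ite e e₁ e₂) T := by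
  constructor
  · intro ρ γ E hγ
    rcases bool_cases ρ.good.data (h.sem ρ _ _ hγ) with ⟨hb, hr⟩ | ⟨hb, hr⟩
    · exact (Ty.sem_red ρ.good.data T E (ite_red_true hb _ _)).2 (h₁.sem ρ _ _ ⟨hγ, hr⟩)
    · exact (Ty.sem_red ρ.good.data T E (ite_red_false hb _ _)).2 (h₂.sem ρ _ _ ⟨hγ, hr⟩)
  · intro ρ₁ ρ₂ γ₁ γ₂ E₁ E₂ hγ
    have d₁ := ρ₁.good.data
    have d₂ := ρ₂.good.data
    have hrel := h.rel ρ₁ ρ₂ _ _ _ _ hγ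
    rw [Ty.rel_implies] at hrel
    obtain ⟨a, ha₁, ha₂⟩ := hrel
    rcases bool_cases d₁ (h.sem ρ₁ _ _ hγ.left) with ⟨hb₁, hr₁⟩ | ⟨hb₁, hr₁⟩ <;>
    rcases bool_cases d₂ (h.sem ρ₂ _ _ hγ.right) with ⟨hb₂, hr₂⟩ | ⟨hb₂, hr₂⟩
    · exact (Ty.rel_red d₁ d₂ T _ _ (ite_red_true hb₁ _ _) (ite_red_true hb₂ _ _)).2
        (h₁.rel ρ₁ ρ₂ _ _ _ _ (hγ.cond hr₁ hr₂))
    · exact absurd ((ha₁.unique d₁ hb₁).symm.trans (ha₂.unique d₂ hb₂)) (by simp)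
    · exact absurd ((ha₁.unique d₁ hb₁).symm.trans (ha₂.unique d₂ hb₂)) (by simp)
    · exact (Ty.rel_red d₁ d₂ T _ _ (ite_red_false hb₁ _ _) (ite_red_false hb₂ _ _)).2
        (h₂.rel ρ₁ ρ₂ _ _ _ _ (hγ.cond hr₁ hr₂))

theorem bind {e₁ e₂ : Expr User Loc Op} {T₁ T₂ : Ty User Loc Op} {pol : RTerm User Loc Op}
    (h₁ : SemTyped S Γ e₁ (T₁.tagged pol))
    (h₂ : SemTyped S Γ e₂ (.fn T₁ ((T₂.tagged pol).shift 0))) :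
    SemTyped S Γ (.bind e₁ e₂) (T₂.tagged pol) := by
  have hred : ∀ (σ : Store User Loc Op) γ, Red S σ ((Expr.bind e₁ e₂).inst γ)
      (.app (e₂.inst γ) (e₁.inst γ)) := fun _ _ => (Par.unbind (.refl _) (.refl _)).red
  constructor
  · intro ρ γ E hγ
    rw [Ty.sem_red ρ.good.data _ _ (hred _ _)]
    exact app_shift (h₂.sem ρ _ _ hγ) (Ty.sem_tagged.1 (h₁.sem ρ _ _ hγ))
  · intro ρ₁ ρ₂ γ₁ γ₂ E₁ E₂ hγ
    rw [Ty.rel_red ρ₁.good.data ρ₂.good.data _ _ _ (hred _ _) (hred _ _)]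
    have s₁ := Ty.sem_tagged.1 (h₁.sem ρ₁ _ _ hγ.left)
    have s₂ := Ty.sem_tagged.1 (h₁.sem ρ₂ _ _ hγ.right)
    have f := h₂.rel ρ₁ ρ₂ _ _ _ _ hγ
    obtain ⟨k₁, k₂, k⟩ := Ty.rel_tagged.1 (h₁.rel ρ₁ ρ₂ _ _ _ _ hγ)
    refine Ty.rel_tagged.2 ⟨fun p => ?_, fun p => ?_, fun p p' => ?_⟩
    · obtain ⟨d, hd, hr⟩ := k₁ p
      exact (Ty.rel_tagged.1 (rel_app_shift f s₁ hd hr)).1 p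
    · obtain ⟨d, hd, hr⟩ := k₂ p
      exact (Ty.rel_tagged.1 (rel_app_shift f hd s₂ hr)).2.1 p
    · exact (Ty.rel_tagged.1 (rel_app_shift f s₁ s₂ (k p p'))).2.2 p p'

theorem down {e : Expr User Loc Op} {r pol : RTerm User Loc Op} {n : ℕ} {hcur hpol : Bool}
    (hr : r.Scoped n false hcur hpol)
    (h : SemTyped S Γ e (Ty.tagged (.base (.prim .bool) (.imp .nu r)) (.and pol r))) :
    SemTyped S Γ (.down e) (Ty.tagged (.base (.prim .bool) (.imp .nu r)) pol) := by
  have hred : ∀ (σ : Store User Loc Op) γ, Red S σ ((Expr.down e).inst γ) (e.inst γ) :=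
    fun _ _ => (Par.lower (.refl _)).red
  constructor
  · intro ρ γ E hγ
    rw [Ty.sem_red ρ.good.data _ _ (hred _ _), Ty.sem_tagged]
    exact Ty.sem_tagged.1 (h.sem ρ _ _ hγ)
  · intro ρ₁ ρ₂ γ₁ γ₂ E₁ E₂ hγ
    have d₁ := ρ₁.good.data
    have d₂ := ρ₂.good.data
    rw [Ty.rel_red d₁ d₂ _ _ _ (hred _ _) (hred _ _)]
    obtain ⟨b₁, hb₁, hr₁⟩ := (Ty.sem_implies d₁ hr).1 (Ty.sem_tagged.1 (h.sem ρ₁ _ _ hγ.left))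
    obtain ⟨b₂, hb₂, hr₂⟩ := (Ty.sem_implies d₂ hr).1 (Ty.sem_tagged.1 (h.sem ρ₂ _ _ hγ.right))
    obtain ⟨k₁, k₂, k⟩ := Ty.rel_tagged.1 (h.rel ρ₁ ρ₂ _ _ _ _ hγ)
    simp only [Ty.rel_implies, Ty.sem_implies d₁ hr, Ty.sem_implies d₂ hr,
      RTerm.holds_and] at k₁ k₂ k
    simp only [Ty.rel_tagged, Ty.rel_implies, Ty.sem_implies d₁ hr, Ty.sem_implies d₂ hr]
    have false_of : ∀ {P : Prop} {b : Bool}, (b = true → P) → ¬ P → b = false := by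
      intro P b h h'
      cases b
      · rfl
      · exact absurd (h rfl) h'
    have bool_eq : ∀ {b c : Bool}, (RVal.const (.datum (.bool b)) : RVal User Loc Op) =
        .const (.datum (.bool c)) → b = c := by
      rintro b c ⟨⟩; rfl
    refine ⟨fun p => ?_, fun p => ?_, fun p p' => ?_⟩
    · by_cases q : r.Holds S E₁
      · exact k₁ ⟨p, q⟩
      · obtain rfl := false_of hr₁ q
        exact ⟨.const (.datum (.bool false)), ⟨false, hasAbs_const _, by simp⟩, _, hb₁,
          hasAbs_const _⟩
    · by_cases q : r.Holds S E₂
      · exact k₂ ⟨p, q⟩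
      · obtain rfl := false_of hr₂ q
        exact ⟨.const (.datum (.bool false)), ⟨false, hasAbs_const _, by simp⟩, _,
          hasAbs_const _, hb₂⟩
    · by_cases q : r.Holds S E₁ <;> by_cases q' : r.Holds S E₂
      · exact k ⟨p, q⟩ ⟨p', q'⟩
      · obtain rfl := false_of hr₂ q'
        obtain ⟨d, ⟨b, hb, hbr⟩, a, ha, ha'⟩ := k₁ ⟨p, q⟩
        obtain rfl := false_of hbr q'
        obtain rfl := ha'.unique d₂ hb
        exact ⟨_, ha, hb₂⟩
      · obtain rfl := false_of hr₁ q
        obtain ⟨d, ⟨b, hb, hbr⟩, a, ha, ha'⟩ := k₂ ⟨p', q'⟩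
        obtain rfl := false_of hbr q
        obtain rfl := ha.unique d₁ hb
        exact ⟨_, hb₁, ha'⟩
      · obtain rfl := false_of hr₁ q
        obtain rfl := false_of hr₂ q'
        exact ⟨_, hb₁, hb₂⟩

theorem sub {e : Expr User Loc Op} {T T' : Ty User Loc Op} (hΓ : CtxWF Γ)
    (h : SemTyped S Γ e T) (hs : Sub S Γ T T') : SemTyped S Γ e T' :=
  ⟨fun ρ _ _ hγ => hs.sem ρ.good.data hΓ.nuInvariant _ _ hγ.models (h.sem ρ _ _ hγ),
    fun ρ₁ ρ₂ _ _ _ _ hγ => hs.rel ρ₁.good.data ρ₂.good.data hΓ.nuInvariant _ _ _ _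
      hγ.left.models hγ.right.models (h.sem ρ₁ _ _ hγ.left) (h.sem ρ₂ _ _ hγ.right)
      (h.rel ρ₁ ρ₂ _ _ _ _ hγ)⟩

theorem subst {p d : Expr User Loc Op} {T : Ty User Loc Op}
    (h : SemTyped S Γ (.app (.lam p) d) T) : SemTyped S Γ (p.subst 0 d) T := by
  have hred : ∀ (σ : Store User Loc Op) γ, Red S σ ((Expr.app (.lam p) d).inst γ)
      ((p.subst 0 d).inst γ) := by
    intro σ γ
    rw [Expr.inst_subst]
    exact beta_red p (d.inst γ) γ
  exact ⟨fun ρ _ _ hγ => (Ty.sem_red ρ.good.data T _ (hred _ _)).1 (h.sem ρ _ _ hγ),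
    fun ρ₁ ρ₂ _ _ _ _ hγ => (Ty.rel_red ρ₁.good.data ρ₂.good.data T _ _ (hred _ _)
      (hred _ _)).1 (h.rel ρ₁ ρ₂ _ _ _ _ hγ)⟩

end SemTyped

end semantic

/-! ### Soundness of typing and of generated patches -/

section soundness

variable {User Loc Op : Type} {S : Sig User Loc Op}

/-- Replacement of every cast applied to a term by a patch that satisfies `G`. -/
inductive PatchWith (G : Ctx User Loc Op → Ty User Loc Op → Ty User Loc Op →
    Expr User Loc Op → Prop) : Expr User Loc Op → Expr User Loc Op → Prop
  | const (c) : PatchWith G (.const c) (.const c)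
  | var (n) : PatchWith G (.var n) (.var n)
  | lam {e e'} : PatchWith G e e' → PatchWith G (.lam e) (.lam e')
  | app {e e' d d'} : PatchWith G e e' → PatchWith G d d' →
      PatchWith G (.app e d) (.app e' d')
  | ite {e e' e₁ e₁' e₂ e₂'} : PatchWith G e e' → PatchWith G e₁ e₁' → PatchWith G e₂ e₂' →
      PatchWith G (.ite e e₁ e₂) (.ite e' e₁' e₂')
  | get {e e'} : PatchWith G e e' → PatchWith G (.get e) (.get e')
  | bind {e e' d d'} : PatchWith G e e' → PatchWith G d d' →
      PatchWith G (.bind e d) (.bind e' d')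
  | down {e e'} : PatchWith G e e' → PatchWith G (.down e) (.down e')
  | cast {d d' Γ Ta Te p} : PatchWith G d d' → G Γ Ta Te p →
      PatchWith G (.app (.cast Γ Ta Te) d) (p.subst 0 d')

variable {G : Ctx User Loc Op → Ty User Loc Op → Ty User Loc Op → Expr User Loc Op → Prop}

theorem PatchWith.of_castFree {e : Expr User Loc Op} (h : e.CastFree) : PatchWith G e e := by
  induction e with
  | const => exact .const _
  | var => exact .var _
  | lam _ ih => exact .lam (ih h)
  | app _ _ ih ih' => exact .app (ih h.1) (ih' h.2)
  | ite _ _ _ ih ih' ih'' => exact .ite (ih h.1) (ih' h.2.1) (ih'' h.2.2)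
  | get _ ih => exact .get (ih h)
  | bind _ _ ih ih' => exact .bind (ih h.1) (ih' h.2)
  | down _ ih => exact .down (ih h)
  | cast => exact h.elim

theorem Patch.patchWith {P : Procs User Loc Op} {R : Set (Const User Loc Op)}
    {e e' : Expr User Loc Op} (h : Patch S P R e e') : PatchWith (Generate S P R) e e' := by
  induction h with
  | const => exact .const _
  | var => exact .var _
  | lam _ _ _ ih => exact .lam ih
  | app _ _ _ _ _ _ ih ih' => exact .app ih ih'
  | ite _ _ _ _ _ _ _ _ _ ih ih' ih'' => exact .ite ih ih' ih''
  | get _ _ _ ih => exact .get ih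
  | bind _ _ _ _ _ _ ih ih' => exact .bind ih ih'
  | down _ _ _ ih => exact .down ih
  | cast _ _ _ _ _ _ _ hg ih => exact .cast ih hg

theorem PatchWith.opSpine {e e' : Expr User Loc Op} (h : PatchWith G e e')
    (he : e.opSpine = true) : e'.opSpine = true := by
  induction h with
  | const => exact he
  | app _ _ ih => exact ih he
  | _ => cases he

theorem PatchWith.toRTerm {e e' : Expr User Loc Op} (h : PatchWith G e e')
    {t : RTerm User Loc Op} (ht : e.toRTerm = some t) : e'.toRTerm = some t := by
  induction h generalizing t with
  | const => exact ht
  | var => exact ht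
  | app h _ ih ih' =>
    obtain ⟨hop, t₁, t₂, h₁, h₂, rfl⟩ := Expr.toRTerm_app ht
    simp only [Expr.toRTerm, h.opSpine hop, ih h₁, ih' h₂, if_true]
  | cast => obtain ⟨hop, -⟩ := Expr.toRTerm_app ht; cases hop
  | _ => cases ht

/-- What a cast does at its own type, it does at all types of the cast. -/
theorem HasType.cast_inv {Γ Γ' : Ctx User Loc Op} {Ta Te F : Ty User Loc Op} (hΓ : CtxWF Γ)
    (h : HasType S Γ (.cast Γ' Ta Te) F) : Γ' = Γ ∧ Ta.WF (nvars Γ) true ∧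
      Te.WF (nvars Γ) true ∧ ∀ f, SemTyped S Γ f (.fn Ta (Te.shift 0)) → SemTyped S Γ f F := by
  generalize he : Expr.cast Γ' Ta Te = e at h
  induction h with
  | cast Γ T T' h h' =>
    cases he
    exact ⟨rfl, h, h', fun _ k => k⟩
  | sub Γ e T T' _ hs _ ih =>
    obtain ⟨rfl, h, h', k⟩ := ih hΓ he
    exact ⟨rfl, h, h', fun f hf => (k f hf).sub hΓ hs⟩
  | _ => cases he

/-- Typed expressions whose casts are replaced by semantically typed patches are semantically
typed. -/
theorem HasType.semTyped
    (hG : ∀ Γ Ta Te p, G Γ Ta Te p → CtxWF Γ → Ta.WF (nvars Γ) true → Te.WF (nvars Γ) true →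
      SemTyped S (.var Ta :: Γ) p (Te.shift 0))
    {Γ : Ctx User Loc Op} {e e' : Expr User Loc Op} {T : Ty User Loc Op} (h : HasType S Γ e T)
    (hΓ : CtxWF Γ) (hp : PatchWith G e e') : SemTyped S Γ e' T := by
  have hcast : ∀ {Γ Γ' : Ctx User Loc Op} {Ta Te F : Ty User Loc Op} {p : Expr User Loc Op},
      CtxWF Γ → HasType S Γ (.cast Γ' Ta Te) F → G Γ' Ta Te p → SemTyped S Γ (.lam p) F := by
    intro Γ Γ' Ta Te F p hΓ h hg
    obtain ⟨rfl, ha, he, k⟩ := h.cast_inv hΓ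
    exact k _ (hG _ _ _ _ hg hΓ ha he).lam
  induction h generalizing e' with
  | const Γ c hc => cases hp; exact .const Γ hc
  | var Γ n T h => cases hp; exact .var h
  | lam Γ e T T' hT _ ih => cases hp with
    | lam hp => exact (ih ⟨hT, hΓ⟩ hp).lam
  | app_dep Γ e d T T' t h hd ht ih ih' =>
    have hs := hd.toRTerm_scoped ht
    cases hp with
    | app p q => exact (ih hΓ p).app_dep (ih' hΓ q) (q.toRTerm ht) hs
    | cast q hg =>
      exact ((hcast hΓ h hg).app_dep (ih' hΓ q) (q.toRTerm ht) hs).subst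
  | app Γ e d T T' h hd ih ih' =>
    cases hp with
    | app p q => exact (ih hΓ p).app (ih' hΓ q)
    | cast q hg => exact ((hcast hΓ h hg).app (ih' hΓ q)).subst
  | get Γ e B r t h ht ih => cases hp with
    | get p => exact (ih hΓ p).get (p.toRTerm ht) (h.toRTerm_scoped ht)
  | get_tagged Γ e B r pol t h ht ih => cases hp with
    | get p => exact (ih hΓ p).get_tagged (p.toRTerm ht) (h.toRTerm_scoped ht)
  | ite Γ e e₁ e₂ r T h _ _ ih ih₁ ih₂ =>
    have hw := h.wf hΓ
    rw [Ty.WF] at hw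
    cases hp with
    | ite p p₁ p₂ =>
      exact (ih hΓ p).ite (ih₁ ⟨hw.2.substNu _, hΓ⟩ p₁) (ih₂ ⟨hw.2.substNu _, hΓ⟩ p₂)
  | bind Γ e₁ e₂ T₁ T₂ pol _ _ ih₁ ih₂ => cases hp with
    | bind p q => exact (ih₁ hΓ p).bind (ih₂ hΓ q)
  | down Γ e r pol h ih => cases hp with
    | down p => exact (ih hΓ p).down (Ty.tagged_wf.1 (h.wf hΓ)).2.2
  | sub Γ e T T' _ hs _ ih => exact (ih hΓ hp).sub hΓ hs
  | cast => cases hp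

theorem HasType.semTyped_of_castFree {Γ : Ctx User Loc Op} {e : Expr User Loc Op}
    {T : Ty User Loc Op} (h : HasType S Γ e T) (hΓ : CtxWF Γ) (he : e.CastFree) :
    SemTyped S Γ e T :=
  h.semTyped (G := fun _ _ _ _ => False) (fun _ _ _ _ h => h.elim) hΓ (.of_castFree he)

namespace SemTyped

variable {Γ : Ctx User Loc Op}

theorem weaken {e : Expr User Loc Op} {T : Ty User Loc Op} (h : SemTyped S Γ e T)
    (T' : Ty User Loc Op) : SemTyped S (.var T' :: Γ) (e.shift 0) (T.shift 0) := by
  constructor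
  · intro ρ γ E hγ
    rw [Ty.sem_shift, REnv.drop_zero, Expr.shift_inst]
    exact h.sem ρ _ _ hγ.1
  · intro ρ₁ ρ₂ γ₁ γ₂ E₁ E₂ hγ
    rw [Ty.rel_shift, REnv.drop_zero, REnv.drop_zero, Expr.shift_inst, Expr.shift_inst]
    exact h.rel ρ₁ ρ₂ _ _ _ _ ⟨hγ.similar, hγ.left.1, hγ.right.1, hγ.related.1⟩

theorem weaken_cond {e : Expr User Loc Op} {T : Ty User Loc Op} (h : SemTyped S Γ e T)
    (r : RTerm User Loc Op) : SemTyped S (.cond r :: Γ) e T :=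
  ⟨fun ρ _ _ hγ => h.sem ρ _ _ hγ.1,
    fun ρ₁ ρ₂ _ _ _ _ hγ => h.rel ρ₁ ρ₂ _ _ _ _
      ⟨hγ.similar, hγ.left.1, hγ.right.1, hγ.related⟩⟩

/-- A path condition that follows from the environment is redundant. -/
theorem of_cond {e : Expr User Loc Op} {T : Ty User Loc Op} {r : RTerm User Loc Op}
    (hr : ∀ E, Models S Γ E → r.Holds S E) (h : SemTyped S (.cond r :: Γ) e T) :
    SemTyped S Γ e T :=
  ⟨fun ρ _ _ hγ => h.sem ρ _ _ ⟨hγ, hr _ hγ.models⟩,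
    fun ρ₁ ρ₂ _ _ _ _ hγ => h.rel ρ₁ ρ₂ _ _ _ _
      (hγ.cond (hr _ hγ.left.models) (hr _ hγ.right.models))⟩

/-- A path condition may be strengthened, below a new variable. -/
theorem weaken_under_cond {e : Expr User Loc Op} {T T' : Ty User Loc Op}
    {r r' : RTerm User Loc Op} (hr : ∀ E, r'.Holds S E → r.Holds S E.tail)
    (h : SemTyped S (.cond r :: Γ) e T) :
    SemTyped S (.cond r' :: .var T' :: Γ) (e.shift 0) (T.shift 0) := by
  constructor
  · intro ρ γ E hγ
    rw [Ty.sem_shift, REnv.drop_zero, Expr.shift_inst]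
    exact h.sem ρ _ _ ⟨hγ.1.1, hr _ hγ.2⟩
  · intro ρ₁ ρ₂ γ₁ γ₂ E₁ E₂ hγ
    rw [Ty.rel_shift, REnv.drop_zero, REnv.drop_zero, Expr.shift_inst, Expr.shift_inst]
    exact h.rel ρ₁ ρ₂ _ _ _ _ ⟨hγ.similar, ⟨hγ.left.1.1, hr _ hγ.left.2⟩,
      ⟨hγ.right.1.1, hr _ hγ.right.2⟩, hγ.related.1⟩

/-- A branch guarded by a test of its condition. -/
theorem guarded {Ta T : Ty User Loc Op} {pol c : RTerm User Loc Op}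
    {guard b patch : Expr User Loc Op} {n : ℕ} {hcur hpol : Bool}
    (hc : c.Scoped n false hcur hpol)
    (hguard : SemTyped S Γ guard ((guardTy c).tagged pol))
    (hb : SemTyped S (.cond (c.shift 0) :: .var Ta :: Γ) b ((T.tagged pol).shift 0))
    (hpatch : SemTyped S (.var Ta :: Γ) patch ((T.tagged pol).shift 0)) :
    SemTyped S (.var Ta :: Γ)
      (.bind (guard.shift 0) (.lam (.ite (.var 0) (b.shift 0) (patch.shift 0))))
      ((T.tagged pol).shift 0) := by
  have htag : ∀ T : Ty User Loc Op,
      (T.tagged pol).shift 0 = (T.shift 0).tagged (pol.shift 0) := by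
    intro T
    rw [Ty.tagged, Ty.shift, BTy.shift]
    rfl
  have hg := hguard.weaken Ta
  rw [htag] at hg
  have hvar : SemTyped S (.var ((guardTy c).shift 0) :: .var Ta :: Γ) (.var 0)
      (((guardTy c).shift 0).shift 0) := .var rfl
  have hshift : ((guardTy c).shift 0).shift 0 = .base (.prim .bool)
      ((RTerm.and (.imp .nu c) (.imp c .nu)).shift 0 |>.shift 0) := by
    rw [guardTy, Ty.shift, BTy.shift, Ty.shift, BTy.shift]
  rw [hshift] at hvar
  have hcond : ∀ E, ((((RTerm.and (.imp .nu c) (.imp c .nu)).shift 0).shift 0).substNu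
      RTerm.top).Holds S E → (c.shift 0).Holds S E.tail := by
    intro E h
    rw [RTerm.holds_substNu, RTerm.holds_shift, RTerm.holds_shift, RTerm.holds_and,
      RTerm.holds_imp] at h
    have := h.1 rfl
    rw [REnv.drop_zero, REnv.drop_zero] at this
    rw [RTerm.holds_shift, REnv.drop_zero]
    exact (hc.holds_nu _ _).1 this
  have hite := hvar.ite (hb.weaken_under_cond (T' := (guardTy c).shift 0) hcond)
    ((hpatch.weaken ((guardTy c).shift 0)).weaken_cond _)
  rw [htag T] at hite ⊢
  exact hg.bind hite.lam

end SemTyped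

theorem mapM_some_mem_zip {α β : Type*} {f : α → Option β} :
    ∀ {l : List α} {r : List β}, l.mapM f = some r → ∀ {a b}, (a, b) ∈ l.zip r → f a = some b
  | [], _, _, _, _, h => by simp at h
  | x :: l, r, hr, a, b, h => by
    rw [List.mapM_cons] at hr
    cases hx : f x with
    | none => simp [hx] at hr
    | some y =>
      cases hl : l.mapM f with
      | none => simp [hx, hl] at hr
      | some ys =>
        simp only [hx, hl, Option.pure_def, Option.bind_eq_bind, Option.bind_some,
          Option.some.injEq] at hr
        subst hr
        simp only [List.zip_cons_cons, List.mem_cons, Prod.mk.injEq] at h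
        rcases h with ⟨rfl, rfl⟩ | h
        · exact hx
        · exact mapM_some_mem_zip hl h

variable {P : Procs User Loc Op}

theorem Combine.semTyped (hP : P.Correct S) {Γ : Ctx User Loc Op} (hΓ : CtxWF Γ)
    {Ta T : Ty User Loc Op} {pol : RTerm User Loc Op}
    {l : List (Expr User Loc Op × RTerm User Loc Op)} {patch result : Expr User Loc Op}
    (h : Combine P Γ pol l patch result)
    (hl : ∀ b c, (b, c) ∈ l → c.Scoped (nvars Γ) false true false ∧
      SemTyped S (.cond (c.shift 0) :: .var Ta :: Γ) b ((T.tagged pol).shift 0))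
    (hpatch : SemTyped S (.var Ta :: Γ) patch ((T.tagged pol).shift 0)) :
    SemTyped S (.var Ta :: Γ) result ((T.tagged pol).shift 0) := by
  induction h with
  | nil => exact hpatch
  | cons b c rest patch guard result hs _ ih =>
    obtain ⟨hc, hb⟩ := hl b c (List.mem_cons_self ..)
    obtain ⟨hcf, ht⟩ := hP.synthesize _ _ _ hs
    exact ih (fun b c h => hl b c (List.mem_cons_of_mem _ h))
      (.guarded hc (ht.semTyped_of_castFree hΓ hcf) hb hpatch)

/-- Generated patches have the expected type. -/
theorem Generate.semTyped (hP : P.Correct S) {R : Set (Const User Loc Op)} {Γ : Ctx User Loc Op}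
    {Ta Te : Ty User Loc Op} {p : Expr User Loc Op} (h : Generate S P R Γ Ta Te p)
    (hΓ : CtxWF Γ) (hTa : Ta.WF (nvars Γ) true) :
    SemTyped S (.var Ta :: Γ) p (Te.shift 0) := by
  obtain ⟨T, pol, conds, dflt, c, guarded, rfl, hconds, hperm, -, hc, hcomb⟩ := h
  have key : ∀ b c', (b, c') ∈ (dflt, c) :: guarded → c'.Scoped (nvars Γ) false true false ∧
      SemTyped S (.cond (c'.shift 0) :: .var Ta :: Γ) b ((T.tagged pol).shift 0) := by
    intro b c' hbc
    have hmem := hperm.subset hbc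
    obtain ⟨hcs, ht⟩ := hP.abduce _ _ _ _ _ (mapM_some_mem_zip hconds hmem)
    have hcf := (hP.synthesizeAll _ _ _ _ _ (List.of_mem_zip hmem).1).1
    exact ⟨hcs, ht.semTyped_of_castFree ⟨hcs.shift 0, hTa, hΓ⟩ hcf⟩
  refine hcomb.semTyped hP hΓ (fun b c h => key b c (List.mem_cons_of_mem _ h)) ?_
  refine .of_cond (fun E hE => ?_) (key dflt c (List.mem_cons_self ..)).2
  rw [RTerm.holds_shift, REnv.drop_zero]
  exact hc _ hE.1 rfl

theorem HasType.semTyped_patch (hP : P.Correct S) {R : Set (Const User Loc Op)}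
    {Γ : Ctx User Loc Op} {e e' : Expr User Loc Op} {T : Ty User Loc Op} (h : HasType S Γ e T)
    (hΓ : CtxWF Γ) (hp : Patch S P R e e') : SemTyped S Γ e' T :=
  h.semTyped (fun _ _ _ _ hg hΓ hTa _ => hg.semTyped hP hΓ hTa) hΓ hp.patchWith

end soundness

/-! ### Noninterference -/

section noninterference

variable {User Loc Op : Type} {S : Sig User Loc Op}

/-- Semantic typing of statements. -/
inductive SemStmt (S : Sig User Loc Op) : Ctx User Loc Op → Stmt User Loc Op → Prop
  | lt {Γ e s T} : SemTyped S Γ e T → SemStmt S (.var T :: Γ) s → SemStmt S Γ (.lt e s)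
  | print {Γ e e' pol} : RTerm.Scoped (nvars Γ) false true true pol →
      SemTyped S Γ e (Ty.tagged (.base (.prim .user) (pol.applyPolicy .cur .nu)) pol) →
      SemTyped S Γ e' (Ty.tagged (.base (.prim .str) RTerm.top) pol) →
      SemStmt S Γ (.print e e')
  | set {Γ e e' T} : SemTyped S Γ e (Ty.refTo T) → SemTyped S Γ e' T → SemStmt S Γ (.set e e')

theorem StmtTyped.semStmt {P : Procs User Loc Op} (hP : P.Correct S)
    {R : Set (Const User Loc Op)} {Γ : Ctx User Loc Op} {s s' : Stmt User Loc Op}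
    (h : StmtTyped S Γ s) (hΓ : CtxWF Γ) (hp : PatchStmt S P R s s') : SemStmt S Γ s' := by
  induction h generalizing s' with
  | lt Γ e s T h _ ih => cases hp with
    | lt _ _ _ _ p q => exact .lt (h.semTyped_patch hP hΓ p) (ih ⟨h.wf hΓ, hΓ⟩ q)
  | print Γ e e' pol h h' => cases hp with
    | print _ _ _ _ p q =>
      exact .print (Ty.tagged_wf.1 (h.wf hΓ)).2 (h.semTyped_patch hP hΓ p)
        (h'.semTyped_patch hP hΓ q)
  | set Γ e e' T h h' => cases hp with
    | set _ _ _ _ p q => exact .set (h.semTyped_patch hP hΓ p) (h'.semTyped_patch hP hΓ q)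

theorem HasAbs.eq_const {σ : Store User Loc Op} (hσ : σ.Data) {v : Expr User Loc Op}
    {c : Const User Loc Op} (hv : v.IsValue) (h : HasAbs S σ v (.const c)) : v = .const c := by
  have := h.unique hσ (hasAbs_value hv)
  cases v <;> simp_all [Expr.abs]

theorem BTy.Sem.const {σ : Store User Loc Op} {B : BTy User Loc Op} {r : RTerm User Loc Op}
    (hB : (Ty.base B r).Plain) {E : REnv User Loc Op} {e : Expr User Loc Op}
    (h : B.Sem S σ E e) : ∃ c, HasAbs S σ e (.const c) := by
  cases B with
  | prim p => rw [BTy.Sem] at h; obtain ⟨d, h, -⟩ := h; exact ⟨_, h⟩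
  | ref T => rw [BTy.Sem] at h; obtain ⟨d, h, -⟩ := h; exact ⟨_, h⟩
  | tag => exact hB.elim

theorem Ty.Plain.eq {σ₁ σ₂ : Store User Loc Op} (h₁ : σ₁.Data) (h₂ : σ₂.Data)
    {T : Ty User Loc Op} (hT : T.Plain) {E₁ E₂ : REnv User Loc Op} {v₁ v₂ : Expr User Loc Op}
    (hv₁ : v₁.IsValue) (hv₂ : v₂.IsValue) (hs : T.Sem S σ₁ E₁ v₁)
    (hr : T.Rel S σ₁ σ₂ E₁ E₂ v₁ v₂) : v₁ = v₂ := by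
  cases T with
  | fn => exact hT.elim
  | base B r =>
    rw [Ty.Sem] at hs
    rw [Ty.Rel] at hr
    obtain ⟨c, hc⟩ := hs.1.const hT
    have : ∃ a, HasAbs S σ₁ v₁ a ∧ HasAbs S σ₂ v₂ a := by
      cases B with
      | prim => rwa [BTy.Rel] at hr
      | ref => rwa [BTy.Rel] at hr
      | tag => exact hT.elim
    obtain ⟨a, ha₁, ha₂⟩ := this
    obtain rfl := ha₁.unique h₁ hc
    rw [hc.eq_const h₁ hv₁, ha₂.eq_const h₂ hv₂]

/-- Indistinguishable visible values of flat types are equal. -/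
theorem Ty.Flat.eq {σ₁ σ₂ : Store User Loc Op} (h₁ : σ₁.Data) (h₂ : σ₂.Data)
    {T : Ty User Loc Op} (hT : T.Flat) {E₁ E₂ : REnv User Loc Op} {v₁ v₂ : Expr User Loc Op}
    (hv₁ : v₁.IsValue) (hv₂ : v₂.IsValue) (hs : T.Sem S σ₁ E₁ v₁)
    (hr : T.Rel S σ₁ σ₂ E₁ E₂ v₁ v₂) (hp₁ : T.pol.Holds S E₁) (hp₂ : T.pol.Holds S E₂) :
    v₁ = v₂ := by
  cases T with
  | fn => exact hT.elim
  | base B r =>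
    cases B with
    | prim p => exact Ty.Plain.eq (T := .base (.prim p) r) h₁ h₂ trivial hv₁ hv₂ hs hr
    | ref T => exact Ty.Plain.eq (T := .base (.ref T) r) h₁ h₂ trivial hv₁ hv₂ hs hr
    | tag T pol =>
      rw [Ty.Rel, BTy.Rel] at hr
      rw [Ty.Sem, BTy.Sem] at hs
      exact Ty.Plain.eq h₁ h₂ hT hv₁ hv₂ hs.1 (hr.2.2 hp₁ hp₂)

theorem Exec.lt_inv {σ σ' : Store User Loc Op} {e : Expr User Loc Op} {s : Stmt User Loc Op}
    (h : Exec S σ (.lt e s) σ') : ∃ v, EvalsTo S σ e v ∧ Exec S σ (s.subst 0 v) σ' := by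
  cases h
  exact ⟨_, ‹_›, ‹_›⟩

open Classical in
theorem Exec.set_inv {σ σ' : Store User Loc Op} {e e' : Expr User Loc Op}
    (h : Exec S σ (.set e e') σ') : ∃ l, e = .const (.datum (.loc l)) ∧ e'.IsValue ∧
      σ' = { σ with mem := Function.update σ.mem l e' } := by
  cases h
  exact ⟨_, rfl, ‹_›, rfl⟩

open Classical in
theorem Exec.print_inv {σ σ' : Store User Loc Op} {e e' : Expr User Loc Op}
    (h : Exec S σ (.print e e') σ') : ∃ u, e = .const (.datum (.user u)) ∧ e'.IsValue ∧
      σ' = { σ with out := Function.update σ.out u (σ.out u ++ [e']) } := by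
  cases h
  exact ⟨_, rfl, ‹_›, rfl⟩

section executions

variable {ρ₁ ρ₂ : Run S} {Γ : Ctx User Loc Op} {γ₁ γ₂ : ℕ → Expr User Loc Op}
  {E₁ E₂ : REnv User Loc Op} {σ₁' σ₂' : Store User Loc Op}

theorem Pair.evalsTo (h : Pair Γ ρ₁ ρ₂ γ₁ γ₂ E₁ E₂) {e v₁ v₂ : Expr User Loc Op}
    {T : Ty User Loc Op} (he : SemTyped S Γ e T) (h₁ : EvalsTo S ρ₁.store (e.inst γ₁) v₁)
    (h₂ : EvalsTo S ρ₂.store (e.inst γ₂) v₂) : Pair (.var T :: Γ) ρ₁ ρ₂ (Expr.scons v₁ γ₁)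
      (Expr.scons v₂ γ₂) (E₁.cons v₁.abs) (E₂.cons v₂.abs) := by
  refine h.cons ?_ ?_ (hasAbs_value h₁.2) (hasAbs_value h₂.2) ?_
  · exact (Ty.sem_red ρ₁.good.data T E₁ h₁.red).1 (he.sem ρ₁ _ _ h.left)
  · exact (Ty.sem_red ρ₂.good.data T E₂ h₂.red).1 (he.sem ρ₂ _ _ h.right)
  · exact (Ty.rel_red ρ₁.good.data ρ₂.good.data T E₁ E₂ h₁.red h₂.red).1
      (he.rel ρ₁ ρ₂ _ _ _ _ h)

theorem SemStmt.exec_set {s : Stmt User Loc Op} (hs : SemStmt S Γ s) (hset : s.IsSet)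
    (h : Pair Γ ρ₁ ρ₂ γ₁ γ₂ E₁ E₂) (h₁ : Exec S ρ₁.store (s.inst γ₁) σ₁')
    (h₂ : Exec S ρ₂.store (s.inst γ₂) σ₂') :
    σ₁'.out = ρ₁.store.out ∧ σ₂'.out = ρ₂.store.out ∧
      ∀ l, (∀ E, ρ₁.Env E → (S.locTy l).pol.Holds S E) →
        (∀ E, ρ₂.Env E → (S.locTy l).pol.Holds S E) → (S.locTy l).Flat →
        ρ₁.store.mem l = ρ₂.store.mem l → σ₁'.mem l = σ₂'.mem l := by
  induction hs generalizing γ₁ γ₂ E₁ E₂ with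
  | lt he _ ih =>
    obtain ⟨v₁, k₁, x₁⟩ := h₁.lt_inv
    obtain ⟨v₂, k₂, x₂⟩ := h₂.lt_inv
    rw [Stmt.inst_up_subst] at x₁ x₂
    exact ih hset (h.evalsTo he k₁ k₂) x₁ x₂
  | print => exact hset.elim
  | @set Γ e e' T he he' =>
    obtain ⟨l₁, hl₁, hv₁, rfl⟩ := h₁.set_inv
    obtain ⟨l₂, hl₂, hv₂, rfl⟩ := h₂.set_inv
    have s₁ := he.sem ρ₁ _ _ h.left
    have r := he.rel ρ₁ ρ₂ _ _ _ _ h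
    rw [hl₁] at s₁ r
    rw [hl₂] at r
    obtain ⟨l, k₁, k₂, rfl⟩ := Ty.rel_refTo ρ₁.good.data s₁ r
    cases k₁.eq_const ρ₁.good.data (v := .const (.datum (.loc l₁))) trivial
    cases k₂.eq_const ρ₂.good.data (v := .const (.datum (.loc l₂))) trivial
    refine ⟨rfl, rfl, fun l' hp₁ hp₂ hf heq => ?_⟩
    classical
    by_cases hl : l' = l₁
    · subst hl
      simp only [Function.update_self]
      exact hf.eq ρ₁.good.data ρ₂.good.data hv₁ hv₂ (he'.sem ρ₁ _ _ h.left)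
        (he'.rel ρ₁ ρ₂ _ _ _ _ h) (hp₁ _ h.left.env) (hp₂ _ h.right.env)
    · simp only [Function.update_of_ne hl]
      exact heq

/-- Under its own store, the recipient of a printed message may see it. -/
theorem Run.Env.holds_of_recipient {ρ : Run S} {E : REnv User Loc Op} (h : ρ.Env E)
    (hps : ρ.pstore = ρ.store.abs) {pol : RTerm User Loc Op} {n : ℕ}
    (hpol : pol.Scoped n false true true) {e : Expr User Loc Op}
    (he : Ty.Sem S ρ.store (.base (.prim .user) (pol.applyPolicy .cur .nu)) E e)
    (hu : HasAbs S ρ.store e (.const (.datum (.user ρ.puser)))) : pol.Holds S E := by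
  rw [Ty.Sem] at he
  obtain ⟨-, a, ha, hr⟩ := he
  obtain rfl := ha.unique ρ.good.data hu
  rw [RTerm.holds_applyPolicy pol rfl] at hr
  obtain ⟨h₁, h₂, h₃⟩ := h
  refine (hpol.holds_congr ?_ ?_ ?_ ?_).1 hr
  · exact fun _ _ => rfl
  · simp
  · exact fun _ => rfl
  · exact fun _ => ⟨by rw [h₂, hps, ← h₁], h₃.symm⟩

theorem SemStmt.exec_print {s : Stmt User Loc Op} (hs : SemStmt S Γ s) (hprint : s.IsPrint)
    (hps₁ : ρ₁.pstore = ρ₁.store.abs) (hps₂ : ρ₂.pstore = ρ₂.store.abs)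
    (hpu : ρ₁.puser = ρ₂.puser) (hout : ρ₁.store.out ρ₁.puser = ρ₂.store.out ρ₁.puser)
    (h : Pair Γ ρ₁ ρ₂ γ₁ γ₂ E₁ E₂) (h₁ : Exec S ρ₁.store (s.inst γ₁) σ₁')
    (h₂ : Exec S ρ₂.store (s.inst γ₂) σ₂') :
    σ₁'.mem = ρ₁.store.mem ∧ σ₂'.mem = ρ₂.store.mem ∧
      σ₁'.out ρ₁.puser = σ₂'.out ρ₁.puser := by
  induction hs generalizing γ₁ γ₂ E₁ E₂ with
  | lt he _ ih =>
    obtain ⟨v₁, k₁, x₁⟩ := h₁.lt_inv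
    obtain ⟨v₂, k₂, x₂⟩ := h₂.lt_inv
    rw [Stmt.inst_up_subst] at x₁ x₂
    exact ih hprint (h.evalsTo he k₁ k₂) x₁ x₂
  | set => exact hprint.elim
  | @print Γ e e' pol hpol he he' =>
    obtain ⟨u₁, hu₁, hv₁, rfl⟩ := h₁.print_inv
    obtain ⟨u₂, hu₂, hv₂, rfl⟩ := h₂.print_inv
    have d₁ := ρ₁.good.data
    have d₂ := ρ₂.good.data
    have s₁ := Ty.sem_tagged.1 (he.sem ρ₁ _ _ h.left)
    have s₂ := Ty.sem_tagged.1 (he.sem ρ₂ _ _ h.right)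
    have r := Ty.rel_tagged.1 (he.rel ρ₁ ρ₂ _ _ _ _ h)
    rw [hu₁] at s₁ r
    rw [hu₂] at s₂ r
    simp only [Ty.rel_implies] at r
    obtain ⟨r₁, r₂, r⟩ := r
    have holds₁ : ∀ {d}, Ty.Sem S ρ₁.store (.base (.prim .user) (pol.applyPolicy .cur .nu)) E₁ d →
        HasAbs S ρ₁.store d (.const (.datum (.user ρ₁.puser))) → pol.Holds S E₁ :=
      h.left.env.holds_of_recipient hps₁ hpol
    have holds₂ : ∀ {d}, Ty.Sem S ρ₂.store (.base (.prim .user) (pol.applyPolicy .cur .nu)) E₂ d →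
        HasAbs S ρ₂.store d (.const (.datum (.user ρ₂.puser))) → pol.Holds S E₂ :=
      h.right.env.holds_of_recipient hps₂ hpol
    have both : u₁ = ρ₁.puser ∨ u₂ = ρ₂.puser → pol.Holds S E₁ ∧ pol.Holds S E₂ := by
      rintro (rfl | rfl)
      · have p := holds₁ s₁ (hasAbs_const _)
        obtain ⟨d, hd, a, ha₁, ha₂⟩ := r₁ p
        obtain rfl := ha₁.unique d₁ (hasAbs_const _)
        exact ⟨p, holds₂ hd (hpu ▸ ha₂)⟩
      · have p := holds₂ s₂ (hasAbs_const _)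
        obtain ⟨d, hd, a, ha₁, ha₂⟩ := r₂ p
        obtain rfl := ha₂.unique d₂ (hasAbs_const _)
        exact ⟨holds₁ hd (hpu ▸ ha₁), p⟩
    refine ⟨rfl, rfl, ?_⟩
    by_cases hu : u₁ = ρ₁.puser ∨ u₂ = ρ₂.puser
    · obtain ⟨p₁, p₂⟩ := both hu
      obtain ⟨a, ha₁, ha₂⟩ := r p₁ p₂
      have : u₁ = u₂ := by
        have := (ha₁.unique d₁ (hasAbs_const _)).symm.trans (ha₂.unique d₂ (hasAbs_const _))
        simpa using this
      subst this
      obtain rfl : u₁ = ρ₁.puser := hu.elim id fun k => k.trans hpu.symm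
      have m := (Ty.rel_tagged.1 (he'.rel ρ₁ ρ₂ _ _ _ _ h)).2.2 p₁ p₂
      have hm := Ty.Plain.eq (T := .base (.prim .str) RTerm.top) d₁ d₂ trivial hv₁ hv₂
        (Ty.sem_tagged.1 (he'.sem ρ₁ _ _ h.left)) m
      simp only [Function.update_self, hout, hm]
    · classical
      rw [not_or] at hu
      simp only [Function.update_of_ne (Ne.symm hu.1), Function.update_of_ne (hpu ▸ Ne.symm hu.2)]
      exact hout

end executions

theorem Ty.WF.pol {T : Ty User Loc Op} {n : ℕ} {h : Bool} (hT : T.WF n h) :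
    T.pol.Scoped n false h true := by
  cases T with
  | fn => trivial
  | base B r => cases B with
    | tag T pol =>
      rw [Ty.WF, BTy.WF] at hT
      exact hT.1.2
    | _ => trivial

theorem holds_iff_policyHolds {pol : RTerm User Loc Op} (hpol : pol.Scoped 0 false false true)
    {σ : Store User Loc Op} {E : REnv User Loc Op} (h : E.pstore = σ.abs) :
    pol.Holds S E ↔ PolicyHolds S pol σ E.puser :=
  hpol.holds_congr (by simp) (by simp) (by simp) fun _ => ⟨h, rfl⟩

/-- The run of a well-typed store with policies evaluated at a well-typed store. -/
def WellTyped.run {σ τ : Store User Loc Op} (h : WellTyped S σ) (h' : WellTyped S τ) (o : User) :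
    Run S :=
  ⟨σ, τ.abs, o, h.good, h'.good.shape⟩

/-- A valuation without program variables. -/
def emptyEnv (σ τ : Store User Loc Op) (o : User) : REnv User Loc Op :=
  { var := fun _ => .closure, cur := σ.abs, nu := .closure, pstore := τ.abs, puser := o }

theorem ObsEquiv.pair {σ₁ σ₂ τ₁ τ₂ : Store User Loc Op} {o : User} (h₁ : WellTyped S σ₁)
    (h₂ : WellTyped S σ₂) (k₁ : WellTyped S τ₁) (k₂ : WellTyped S τ₂) (h : ObsEquiv S o σ₁ σ₂)
    (hτ₁ : τ₁ = σ₁ ∨ τ₁ = σ₂) (hτ₂ : τ₂ = σ₁ ∨ τ₂ = σ₂) :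
    Pair [] (h₁.run k₁ o) (h₂.run k₂ o) .var .var (emptyEnv σ₁ τ₁ o) (emptyEnv σ₂ τ₂ o) := by
  refine ⟨fun l E₁ E₂ hE₁ hE₂ hp => h.2 l ?_, ⟨rfl, rfl, rfl⟩, ⟨rfl, rfl, rfl⟩, trivial⟩
  have hpol := (S.locTy_wf l).pol
  rw [holds_iff_policyHolds hpol hE₁.2.1, holds_iff_policyHolds hpol hE₂.2.1, hE₁.2.2,
    hE₂.2.2] at hp
  rcases hτ₁ with rfl | rfl <;> rcases hτ₂ with rfl | rfl <;>
    first
    | exact hp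
    | exact hp.symm
    | exact .inl (hp.elim id id)
    | exact .inr (hp.elim id id)

theorem SemStmt.contextualNI {s : Stmt User Loc Op} (hs : SemStmt S [] s) : ContextualNI S s := by
  intro o σ₁ σ₂ σ₁' σ₂' h₁ h₂ h x₁ x₂
  rw [← s.inst_var] at x₁ x₂
  constructor
  · intro hprint
    obtain ⟨m₁, m₂, ho⟩ := hs.exec_print (ρ₁ := h₁.run h₁ o) (ρ₂ := h₂.run h₂ o) hprint rfl rfl
      rfl h.1 (h.pair h₁ h₂ h₁ h₂ (.inl rfl) (.inr rfl)) x₁ x₂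
    have a₁ : σ₁'.abs = σ₁.abs := by unfold Store.abs; rw [m₁]; rfl
    have a₂ : σ₂'.abs = σ₂.abs := by unfold Store.abs; rw [m₂]; rfl
    refine ⟨ho, fun l hl => ?_⟩
    rw [m₁, m₂]
    refine h.2 l ?_
    simpa only [Observable, PolicyHolds, a₁, a₂] using hl
  · intro hset
    have key : ∀ τ : Store User Loc Op, WellTyped S τ → τ = σ₁ ∨ τ = σ₂ →
        σ₁'.out = σ₁.out ∧ σ₂'.out = σ₂.out ∧ ∀ l, PolicyHolds S (S.locTy l).pol τ o →
          (S.locTy l).Flat → σ₁.mem l = σ₂.mem l → σ₁'.mem l = σ₂'.mem l := by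
      intro τ k hτ
      obtain ⟨o₁, o₂, hm⟩ := hs.exec_set (ρ₁ := h₁.run k o) (ρ₂ := h₂.run k o) hset
        (h.pair h₁ h₂ k k hτ hτ) x₁ x₂
      refine ⟨o₁, o₂, fun l hp => hm l (fun E hE => ?_) fun E hE => ?_⟩ <;>
      · rw [holds_iff_policyHolds (S.locTy_wf l).pol hE.2.1, hE.2.2]
        exact hp
    have key₁ := key σ₁ h₁ (.inl rfl)
    have key₂ := key σ₂ h₂ (.inr rfl)
    refine ⟨by rw [key₁.1, key₁.2.1, h.1], fun l hl hf => ?_⟩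
    rcases hl with hp | hp
    · exact key₁.2.2 l hp hf (h.2 l (.inl hp))
    · exact key₂.2.2 l hp hf (h.2 l (.inr hp))

theorem SemTyped.exprContextualNI {e : Expr User Loc Op} {T : Ty User Loc Op}
    (h : SemTyped S [] e T) : ExprContextualNI S e T := by
  intro hf o σ₁ σ₂ v₁ v₂ h₁ h₂ hobs hp₁ hp₂ k₁ k₂
  have hpair := hobs.pair h₁ h₂ h₁ h₂ (.inl rfl) (.inr rfl)
  rw [← e.inst_var] at k₁ k₂
  have := hpair.evalsTo h k₁ k₂
  exact hf.eq h₁.good.data h₂.good.data k₁.2 k₂.2 this.left.2.1 this.related.2 hp₁ hp₂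

end noninterference

end Lifty

theorem mainTheorem1 {User Loc Op : Type} (S : Lifty.Sig User Loc Op)
    (P : Lifty.Procs User Loc Op) (hP : P.Correct S) (R : Set (Lifty.Const User Loc Op)) :
    (∀ s s' : Lifty.Stmt User Loc Op,
      Lifty.EnforceStmt S P R [] s s' → Lifty.ContextualNI S s') ∧
    (∀ (e e' : Lifty.Expr User Loc Op) (T : Lifty.Ty User Loc Op),
      Lifty.Enforce S P R [] e T e' → Lifty.ExprContextualNI S e' T) := by
  refine ⟨fun s s' h => ?_, fun e e' T h => ?_⟩
  · obtain ⟨_, ⟨-, ht⟩, hp⟩ := h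
    exact (ht.semStmt hP trivial hp).contextualNI
  · obtain ⟨_, ⟨-, ht⟩, hp⟩ := h
    exact (ht.semTyped_patch hP trivial hp).exprContextualNI
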